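/- Let $Y$ and $U$ be separable complex Hilbert spaces and let $A:D(A)\subseteq Y\to Y$ generate a strongly continuous semigroup $e^{At}$ on $Y$ with $\|e^{At}\|_{\mathcal L(Y)}\le Me^{-\omega t}$ for all $t\ge 0$, for some $M$ and some $\omega>0$. For $\alpha>0$ write $A^{\alpha}$ for the fractional power $(-A)^{\alpha}$, i.e. the inverse, defined on the range, of the injective bounded operator $$A^{-\alpha}x=\frac1{\Gamma(\alpha)}\int_0^\infty t^{\alpha-1}e^{At}x\,dt,$$ and similarly ${A^*}^{\alpha}$ for $(-A^*)^\alpha$, with $e^{A^*t}=(e^{At})^*$. All domains carry the graph norm; $[D(A^*)]'$ and $[D({A^*}^{\alpha})]'$ are the spaces of bounded antilinear functionals on $D(A^*)$ and $D({A^*}^\alpha)$. An element $y\in Y$ is identified with the functional $x\mapsto (y,x)_Y$, and elements of $[D(A^*)]'$ and $[D({A^*}^\alpha)]'$ are identified when they agree on $D(A^*)\cap D({A^*}^\alpha)$. The semigroup acts on $[D(A^*)]'$ by $\langle e^{At}\varphi,x\rangle=\langle\varphi,e^{A^*t}x\rangle$. Let $B:U\to[D(A^*)]'$ be bounded and linear,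 with adjoint $B^*:D(A^*)\to U$, $\langle Bu,x\rangle=(u,B^*x)_U$. Assume that $$B^*e^{A^*t}x=F(t)x+G(t)x,\qquad t>0,\ x\in D(A^*),$$ with bounded linear operators $F(t):Y\to U$ and $G(t):D(A^*)\to U$ such that: * there are $\gamma\in(0,1)$ and $\eta,N>0$ with $\|F(t)\|_{\mathcal L(Y,U)}\le N\,t^{-\gamma}e^{-\eta t}$ for all $t>0$; * there is $T_1>0$ such that, for every $p\in[1,\infty)$, the map $x\mapsto G(\cdot)x$ on $D(A^*)$ extends to a bounded operator from $Y$ to $L^p(0,T_1;U)$; * there are $T>0$, $\epsilon>0$ and $q\in(1,2)$ such that the map $y\mapsto G(\cdot){A^*}^{-\epsilon}y$, defined for those $y$ with ${A^*}^{-\epsilon}y\in D(A^*)$, extends to a bounded operator from $Y$ to $C([0,T];U)$, and the map $x\mapsto B^*e^{A^*\cdot}{A^*}^{\epsilon}x$, defined on $D({A^*}^{1+\epsilon})=\{x\in D({A^*}^\epsilon):{A^*}^\epsilon x\in D(A^*)\}$, extends to a bounded operator from $Y$ to $L^q(0,T;U)$. Let $L$ be the input-to-state map $$Lv(t)=\int_0^t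 e^{A(t-s)}Bv(s)\,ds,\qquad t\ge0,$$ the integral being taken in $[D(A^*)]'$. Let $q'$ be the conjugate exponent of $q$. Then: 1. $L$ maps $L^1(0,\infty;U)$ continuously into $L^r(0,\infty;[D({A^*}^{\epsilon})]')$ for each $r\in[1,\frac1\gamma)$; 2. $L$ maps $L^p(0,\infty;U)$ continuously into $L^r(0,\infty;Y)$ for each $p\in(1,\frac1{1-\gamma})$ and $r\in\big[p,\frac{p}{1-(1-\gamma)p}\big]$; 3. $L$ maps $L^{\frac1{1-\gamma}}(0,\infty;U)$ continuously into $L^r(0,\infty;Y)$ for each $r\in[\frac1{1-\gamma},\infty)$; 4. $L$ maps $L^p(0,\infty;U)$ continuously into $L^r(0,\infty;Y)\cap C_b([0,\infty);Y)$ for each $p\in(\frac1{1-\gamma},\infty]$ and $r\in[p,\infty]$; 5. $L$ maps $L^r(0,\infty;U)$ continuously into $C_b([0,\infty);D(A^{\epsilon}))$ for each $r\in[q',\infty]$. -/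

import Mathlib

open MeasureTheory Set Filter Topology
open scoped NNReal ENNReal

/-! ### The graph-norm space of an unbounded operator and its antidual -/

section GraphDomain

variable {Y : Type*} [NormedAddCommGroup Y] [InnerProductSpace ℂ Y]

/-- The space `D(T)`: the domain of the unbounded operator `T`, to be equipped with the
graph norm `(‖x‖² + ‖T x‖²)^{1/2}`. -/
def GraphDom (T : Y →ₗ.[ℂ] Y) : Type _ := T.domain

namespace GraphDom

variable (T : Y →ₗ.[ℂ] Y)

instance instAddCommGroup : AddCommGroup (GraphDom T) :=
  inferInstanceAs (AddCommGroup T.domain)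

instance instModule : Module ℂ (GraphDom T) :=
  inferInstanceAs (Module ℂ T.domain)

/-- The map `x ↦ (x, T x)` into the Hilbert sum `Y ⊕ Y`. -/
def toGraph : GraphDom T →ₗ[ℂ] WithLp 2 (Y × Y) :=
  (WithLp.linearEquiv 2 ℂ (Y × Y)).symm.toLinearMap ∘ₗ
    (LinearMap.prod T.domain.subtype T.toFun : T.domain →ₗ[ℂ] Y × Y)

theorem toGraph_injective : Function.Injective (toGraph T) := by
  intro x y h
  have h2 := congrArg (fun z : WithLp 2 (Y × Y) => z.fst) h
  exact Subtype.ext h2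

noncomputable instance instNormedAddCommGroup : NormedAddCommGroup (GraphDom T) :=
  NormedAddCommGroup.induced (GraphDom T) (WithLp 2 (Y × Y)) (toGraph T) (toGraph_injective T)

noncomputable instance instNormedSpace : NormedSpace ℂ (GraphDom T) :=
  NormedSpace.induced ℂ (GraphDom T) (WithLp 2 (Y × Y)) (toGraph T)

variable {T}

/-- The element of `Y` underlying an element of `D(T)`. -/
def val (x : GraphDom T) : Y := ((show T.domain from x) : Y)

/-- The value `T x` for `x ∈ D(T)`. -/
def app (x : GraphDom T) : Y := T (show T.domain from x)

/-- An element of the domain, as an element of `D(T)`. -/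
def mk (x : Y) (hx : x ∈ T.domain) : GraphDom T := (⟨x, hx⟩ : T.domain)

theorem norm_sq (x : GraphDom T) : ‖x‖ ^ 2 = ‖x.val‖ ^ 2 + ‖x.app‖ ^ 2 :=
  WithLp.prod_norm_sq_eq_of_L2 (toGraph T x)

end GraphDom

/-- The space `[D(T)]'`: bounded antilinear functionals on `D(T)`, with the dual norm.
The value `φ x` is the duality pairing `⟨φ, x⟩`, linear in `φ` and antilinear in `x`. -/
abbrev AntiDual (T : Y →ₗ.[ℂ] Y) : Type _ := GraphDom T →L⋆[ℂ] ℂ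

/-- The functional `φ ∈ [D(T)]'` is (given by) the element `y` of the pivot space `Y`:
`⟨φ, x⟩ = (y, x)_Y` for all `x ∈ D(T)`. -/
def IsElem {T : Y →ₗ.[ℂ] Y} (φ : AntiDual T) (y : Y) : Prop :=
  ∀ x : GraphDom T, φ x = inner ℂ x.val y

/-- The functionals `φ ∈ [D(T)]'` and `ψ ∈ [D(T')]'` are identified: they agree on the
common part of `D(T)` and `D(T')`. -/
def SameFunctional {T T' : Y →ₗ.[ℂ] Y} (φ : AntiDual T) (ψ : AntiDual T') : Prop :=
  ∀ (x : Y) (h : x ∈ T.domain) (h' : x ∈ T'.domain),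
    φ (GraphDom.mk x h) = ψ (GraphDom.mk x h')

end GraphDomain

/-! ### Exponentially stable strongly continuous semigroups -/

/-- An exponentially stable strongly continuous semigroup of bounded operators. -/
structure StableSemigroup (Y : Type*) [NormedAddCommGroup Y] [InnerProductSpace ℂ Y] where
  toFun : ℝ≥0 → Y →L[ℂ] Y
  map_zero' : toFun 0 = ContinuousLinearMap.id ℂ Y
  map_add' : ∀ s t, toFun (s + t) = toFun s ∘L toFun t
  continuous' : ∀ x, Continuous fun t => toFun t x
  stable' : ∃ M ω : ℝ, 0 < ω ∧ ∀ t : ℝ≥0, ‖toFun t‖ ≤ M * Real.exp (-ω * t)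

namespace StableSemigroup

variable {Y : Type*} [NormedAddCommGroup Y] [InnerProductSpace ℂ Y]

instance : CoeFun (StableSemigroup Y) (fun _ => ℝ≥0 → Y →L[ℂ] Y) := ⟨toFun⟩

variable (S : StableSemigroup Y)

/-- The graph of the infinitesimal generator: pairs `(x, y)` with
`(S(t) x - x) / t → y` as `t → 0+`. -/
def generatorGraph : Submodule ℂ (Y × Y) where
  carrier := {p | Tendsto (fun t : ℝ≥0 => ((t : ℝ)⁻¹ : ℝ) • (S t p.1 - p.1)) (𝓝[>] 0) (𝓝 p.2)}
  zero_mem' := by simp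
  add_mem' := by
    intro p q hp hq
    refine (Tendsto.add hp hq).congr fun t => ?_
    simp only [Prod.fst_add, map_add, ← smul_add]
    congr 1
    abel
  smul_mem' := by
    intro c p hp
    refine (Tendsto.const_smul hp c).congr fun t => ?_
    simp only [Prod.smul_fst, map_smul, ← smul_sub]
    rw [smul_comm]

/-- The infinitesimal generator `A` of the semigroup, with its natural domain. -/
noncomputable def generator : Y →ₗ.[ℂ] Y := S.generatorGraph.toLinearPMap

theorem generatorGraph_functional (x : Y × Y) (hx : x ∈ S.generatorGraph) (h0 : x.1 = 0) :
    x.2 = 0 := by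
  have h : Tendsto (fun t : ℝ≥0 => ((t : ℝ)⁻¹ : ℝ) • (S t x.1 - x.1)) (𝓝[>] 0) (𝓝 x.2) := hx
  simp only [h0, map_zero, sub_zero, smul_zero] at h
  exact (tendsto_nhds_unique h tendsto_const_nhds)

/-- The semigroup leaves the domain of its generator invariant and commutes with it. -/
theorem generator_comm (t : ℝ≥0) (x : S.generator.domain) :
    ∃ h : S t x ∈ S.generator.domain, S.generator ⟨S t x, h⟩ = S t (S.generator x) := by
  have h1 := Submodule.mem_graph_toLinearPMap S.generatorGraph_functional x
  have h1' : Tendsto (fun r : ℝ≥0 => ((r : ℝ)⁻¹ : ℝ) • (S r x - x)) (𝓝[>] 0)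
    (𝓝 (S.generator x)) := h1
  have h2 : (S t x, S t (S.generator x)) ∈ S.generatorGraph := by
    change Tendsto (fun r : ℝ≥0 => ((r : ℝ)⁻¹ : ℝ) • (S r (S t x) - S t x)) _ _
    refine (((S t).continuous.tendsto _).comp h1').congr fun r => ?_
    have e : S r (S t x) = S t (S r x) := by
      have a := DFunLike.congr_fun (S.map_add' r t) (x : Y)
      have b := DFunLike.congr_fun (S.map_add' t r) (x : Y)
      rw [add_comm] at b
      exact a.symm.trans b
    simp only [Function.comp]
    rw [e, ← map_sub]
    exact (S t).map_smul_of_tower _ _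
  have h3 : S t x ∈ S.generator.domain := ⟨_, h2, rfl⟩
  refine ⟨h3, ?_⟩
  have h4 := Submodule.mem_graph_toLinearPMap S.generatorGraph_functional ⟨S t x, h3⟩
  have h5 := S.generatorGraph.sub_mem h4 h2
  exact sub_eq_zero.1 (S.generatorGraph_functional _ h5 (by simp))

/-! #### Fractional powers -/

theorem continuous_orbit (x : Y) : Continuous fun t : ℝ => S t.toNNReal x :=
  (S.continuous' x).comp continuous_real_toNNReal

theorem exists_integrable_bound (α : ℝ) (hα : 0 < α) :
    ∃ g : ℝ → ℝ, IntegrableOn g (Ioi 0) ∧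
      ∀ x : Y, ∀ t ∈ Ioi (0 : ℝ), ‖(t ^ (α - 1)) • S t.toNNReal x‖ ≤ g t * ‖x‖ := by
  obtain ⟨M, ω, hω, hM⟩ := S.stable'
  refine ⟨fun t => M * (t ^ (α - 1) * Real.exp (-ω * t ^ (1 : ℝ))), ?_, ?_⟩
  · exact (integrableOn_rpow_mul_exp_neg_mul_rpow (by linarith) one_pos hω).const_mul M
  · intro x t ht
    have ht0 : (0 : ℝ) < t := ht
    have h1 := hM t.toNNReal
    rw [Real.coe_toNNReal _ ht0.le] at h1
    simp only [norm_smul, Real.norm_of_nonneg (Real.rpow_nonneg ht0.le _), Real.rpow_one]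
    calc t ^ (α - 1) * ‖S t.toNNReal x‖
        ≤ t ^ (α - 1) * ((M * Real.exp (-ω * t)) * ‖x‖) := by
          gcongr
          exact (S t.toNNReal).le_of_opNorm_le h1 x
      _ = _ := by ring

theorem integrableOn_orbit (α : ℝ) (hα : 0 < α) (x : Y) :
    IntegrableOn (fun t : ℝ => (t ^ (α - 1)) • S t.toNNReal x) (Ioi 0) := by
  obtain ⟨g, hg, hb⟩ := S.exists_integrable_bound α hα
  refine Integrable.mono' (hg.mul_const ‖x‖) ?_ ((ae_restrict_iff' measurableSet_Ioi).2
    (Eventually.of_forall fun t ht => hb x t ht))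
  exact (measurable_id.pow_const (α - 1)).aestronglyMeasurable.smul
    (S.continuous_orbit x).aestronglyMeasurable

/-- The bounded operator `(-A)^{-α} x = Γ(α)⁻¹ ∫₀^∞ t^{α-1} S(t) x dt`, for `α > 0`. -/
noncomputable def negPow (α : ℝ) (hα : 0 < α) : Y →L[ℂ] Y :=
  LinearMap.mkContinuousOfExistsBound
    { toFun := fun x => (Real.Gamma α)⁻¹ • ∫ t in Ioi (0 : ℝ), (t ^ (α - 1)) • S t.toNNReal x
      map_add' := fun x y => by
        rw [← smul_add, ← integral_add (S.integrableOn_orbit α hα x) (S.integrableOn_orbit α hα y)]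
        simp only [map_add, smul_add]
      map_smul' := fun c x => by
        have e : ∀ t : ℝ, (t ^ (α - 1)) • S t.toNNReal (c • x) =
            c • ((t ^ (α - 1)) • S t.toNNReal x) := fun t => by
          rw [map_smul, smul_comm]
        simp only [e, integral_smul, RingHom.id_apply]
        rw [smul_comm] }
    (by
      obtain ⟨g, hg, hb⟩ := S.exists_integrable_bound α hα
      refine ⟨|(Real.Gamma α)⁻¹| * ∫ t in Ioi (0 : ℝ), g t, fun x => ?_⟩
      change ‖(Real.Gamma α)⁻¹ • ∫ t in Ioi (0 : ℝ), (t ^ (α - 1)) • S t.toNNReal x‖ ≤ _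
      rw [norm_smul, Real.norm_eq_abs, mul_assoc, ← integral_mul_const]
      gcongr
      exact norm_integral_le_of_norm_le (hg.mul_const ‖x‖)
        ((ae_restrict_iff' measurableSet_Ioi).2 (Eventually.of_forall fun t ht => hb x t ht)))

theorem negPow_apply (α : ℝ) (hα : 0 < α) (x : Y) : S.negPow α hα x =
    (Real.Gamma α)⁻¹ • ∫ t in Ioi (0 : ℝ), (t ^ (α - 1)) • S t.toNNReal x := rfl

/-- The fractional power `(-A)^α`, `α > 0`: the unbounded inverse of the injective bounded
operator `(-A)^{-α}`, whose domain is the range of `(-A)^{-α}`. -/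
noncomputable def fracPow (α : ℝ) (hα : 0 < α) : Y →ₗ.[ℂ] Y :=
  LinearPMap.inverse ((S.negPow α hα : Y →ₗ[ℂ] Y).toPMap ⊤)

/-! #### The adjoint semigroup -/

theorem negPow_one_apply (x : Y) :
    S.negPow 1 one_pos x = ∫ t in Ioi (0 : ℝ), S t.toNNReal x := by
  simp [negPow_apply]

theorem integrableOn_orbit_one (x : Y) :
    IntegrableOn (fun t : ℝ => S t.toNNReal x) (Ioi 0) := by
  simpa using S.integrableOn_orbit 1 one_pos x

theorem exists_bound : ∃ K : ℝ, 0 ≤ K ∧ ∀ t : ℝ≥0, ‖S t‖ ≤ K := by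
  obtain ⟨M, ω, hω, hM⟩ := S.stable'
  refine ⟨|M|, abs_nonneg _, fun t => (hM t).trans ?_⟩
  calc M * Real.exp (-ω * t) ≤ |M| * 1 := by
        gcongr
        · exact le_abs_self M
        · rw [Real.exp_le_one_iff]
          have := mul_nonneg hω.le t.2
          change 0 ≤ ω * (t : ℝ) at this
          linarith
    _ = |M| := mul_one _

theorem negPow_one_shift (h : ℝ≥0) (x : Y) :
    S.negPow 1 one_pos (S h x) =
      S.negPow 1 one_pos x - ∫ t in (0 : ℝ)..h, S t.toNNReal x := by
  rw [negPow_one_apply, negPow_one_apply]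
  have e1 : ∫ t in Ioi (0 : ℝ), S t.toNNReal (S h x) =
      ∫ t in Ioi (0 : ℝ), S (t + h).toNNReal x := by
    refine setIntegral_congr_fun measurableSet_Ioi fun t ht => ?_
    have ht0 : (0 : ℝ) < t := ht
    change S t.toNNReal (S h x) = S (t + h).toNNReal x
    rw [Real.toNNReal_add ht0.le (NNReal.coe_nonneg h), Real.toNNReal_coe, S.map_add']
    rfl
  have e2 : ∫ t in Ioi (0 : ℝ), S (t + h).toNNReal x =
      ∫ t in Ioi (h : ℝ), S t.toNNReal x := by
    have := (measurePreserving_add_right volume (h : ℝ)).setIntegral_preimage_emb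
      (measurableEmbedding_addRight (h : ℝ)) (fun t : ℝ => S t.toNNReal x) (Ioi (h : ℝ))
    simpa using this
  rw [e1, e2, ← intervalIntegral.integral_Ioi_sub_Ioi (S.integrableOn_orbit_one x)
    (NNReal.coe_nonneg h)]
  abel

variable [CompleteSpace Y]

theorem negPow_one_injective (x : Y) (hx : S.negPow 1 one_pos x = 0) : x = 0 := by
  have key : ∀ h : ℝ≥0, ∫ t in (0 : ℝ)..h, S t.toNNReal x = 0 := by
    intro h
    have hc : S.negPow 1 one_pos (S h x) = S h (S.negPow 1 one_pos x) := by
      rw [negPow_one_apply, negPow_one_apply,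
        ← (S h).integral_comp_comm (S.integrableOn_orbit_one x)]
      refine integral_congr_ae (Eventually.of_forall fun t => ?_)
      have a := DFunLike.congr_fun (S.map_add' h t.toNNReal) x
      have b := DFunLike.congr_fun (S.map_add' t.toNNReal h) x
      rw [add_comm] at b
      exact b.symm.trans a
    have := S.negPow_one_shift h x
    rw [hc, hx, map_zero, zero_sub] at this
    exact neg_eq_zero.1 this.symm
  have hd : HasDerivAt (fun u : ℝ => ∫ t in (0 : ℝ)..u, S t.toNNReal x)
      (S (0 : ℝ).toNNReal x) 0 :=
    intervalIntegral.integral_hasDerivAt_right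
      ((S.continuous_orbit x).intervalIntegrable _ _)
      ((S.continuous_orbit x).stronglyMeasurableAtFilter _ _)
      (S.continuous_orbit x).continuousAt
  have h1 := hd.hasDerivWithinAt (s := Ici (0 : ℝ))
  have h2 : HasDerivWithinAt (fun u : ℝ => ∫ t in (0 : ℝ)..u, S t.toNNReal x)
      (0 : Y) (Ici (0 : ℝ)) 0 := by
    refine (hasDerivWithinAt_const (0 : ℝ) (Ici (0 : ℝ)) (0 : Y)).congr ?_ (by simp)
    intro u hu
    exact key ⟨u, hu⟩
  have h3 := (uniqueDiffOn_Ici (0 : ℝ) 0 self_mem_Ici).eq_deriv _ h1 h2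
  simpa [S.map_zero'] using h3

/-- Strong continuity at `0` of the adjoint semigroup. -/
theorem tendsto_adjoint (x : Y) :
    Tendsto (fun h : ℝ≥0 => (S h).adjoint x) (𝓝 0) (𝓝 x) := by
  obtain ⟨K, hK0, hK⟩ := S.exists_bound
  set R : Y →L[ℂ] Y := S.negPow 1 one_pos with hR
  have hadj : ∀ h : ℝ≥0, ‖(S h).adjoint‖ ≤ K := fun h => by
    rw [LinearIsometryEquiv.norm_map]; exact hK h
  have hRh : ∀ h : ℝ≥0, ‖R ∘L S h - R‖ ≤ K * h := by
    intro h
    refine ContinuousLinearMap.opNorm_le_bound _ (by positivity) fun y => ?_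
    have e : (R ∘L S h - R) y = - ∫ t in (0 : ℝ)..h, S t.toNNReal y := by
      have := S.negPow_one_shift h y
      simp only [sub_apply, ContinuousLinearMap.comp_apply, hR, this]
      abel
    rw [e, norm_neg]
    have := intervalIntegral.norm_integral_le_of_norm_le_const (a := (0 : ℝ)) (b := h)
      (f := fun t : ℝ => S t.toNNReal y) (C := K * ‖y‖)
      (fun t _ => (S t.toNNReal).le_of_opNorm_le (hK _) y)
    rw [sub_zero, abs_of_nonneg (NNReal.coe_nonneg h)] at this
    linarith
  have hdense : Dense (LinearMap.range (R.adjoint : Y →ₗ[ℂ] Y) : Set Y) := by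
    rw [Submodule.dense_iff_topologicalClosure_eq_top,
      Submodule.topologicalClosure_eq_top_iff, Submodule.eq_bot_iff]
    intro z hz
    apply S.negPow_one_injective
    refine ext_inner_left ℂ fun w => ?_
    have := (Submodule.mem_orthogonal _ _).1 hz (R.adjoint w) ⟨w, rfl⟩
    rw [ContinuousLinearMap.adjoint_inner_left] at this
    simpa using this
  rw [Metric.tendsto_nhds]
  intro e he
  have hK1 : 0 < K + 1 := by linarith
  obtain ⟨_, ⟨w, rfl⟩, hw⟩ := hdense.exists_dist_lt x (ε := e / (2 * (K + 1))) (by positivity)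
  have hw' : ‖x - R.adjoint w‖ < e / (2 * (K + 1)) := by rwa [← dist_eq_norm]
  have hlim : Tendsto (fun h : ℝ≥0 => K * (h : ℝ) * ‖w‖) (𝓝 0) (𝓝 0) := by
    have : Continuous fun h : ℝ≥0 => K * (h : ℝ) * ‖w‖ := by fun_prop
    simpa using this.tendsto 0
  filter_upwards [hlim.eventually (gt_mem_nhds (half_pos he))] with h hh
  have h1 : ‖(S h).adjoint (R.adjoint w) - R.adjoint w‖ ≤ K * h * ‖w‖ := by
    have e1 : (S h).adjoint (R.adjoint w) - R.adjoint w = (R ∘L S h - R).adjoint w := by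
      rw [map_sub, ContinuousLinearMap.adjoint_comp]; rfl
    rw [e1]
    refine ContinuousLinearMap.le_of_opNorm_le _ ?_ w
    rw [LinearIsometryEquiv.norm_map]; exact hRh h
  have h2 : ‖(S h).adjoint (x - R.adjoint w)‖ ≤ K * ‖x - R.adjoint w‖ :=
    ContinuousLinearMap.le_of_opNorm_le _ (hadj h) _
  have h3 : (S h).adjoint x - x = (S h).adjoint (x - R.adjoint w)
      + ((S h).adjoint (R.adjoint w) - R.adjoint w) - (x - R.adjoint w) := by
    rw [map_sub]; abel
  rw [dist_eq_norm, h3]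
  have h4 : (K + 1) * ‖x - R.adjoint w‖ < e / 2 := by
    have := mul_lt_mul_of_pos_left hw' hK1
    have e4 : (K + 1) * (e / (2 * (K + 1))) = e / 2 := by field_simp
    linarith
  calc _ ≤ ‖(S h).adjoint (x - R.adjoint w)‖ + ‖(S h).adjoint (R.adjoint w) - R.adjoint w‖
        + ‖x - R.adjoint w‖ := (norm_sub_le _ _).trans (by gcongr; exact norm_add_le _ _)
    _ < e := by linarith

/-- The adjoint semigroup `e^{A* t} = (e^{A t})*`. -/
noncomputable def adjointSemigroup : StableSemigroup Y where
  toFun t := (S t).adjoint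
  map_zero' := by
    rw [S.map_zero']
    exact ContinuousLinearMap.adjoint_id
  map_add' s t := by rw [add_comm, S.map_add', ContinuousLinearMap.adjoint_comp]
  continuous' x := by
    obtain ⟨K, hK0, hK⟩ := S.exists_bound
    have hadj : ∀ h : ℝ≥0, ‖(S h).adjoint‖ ≤ K := fun h => by
      rw [LinearIsometryEquiv.norm_map]; exact hK h
    have hcomp : ∀ a b : ℝ≥0, (S (a + b)).adjoint x = (S a).adjoint ((S b).adjoint x) := by
      intro a b
      rw [add_comm, S.map_add', ContinuousLinearMap.adjoint_comp]; rfl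
    have main : ∀ a b : ℝ≥0, ‖(S a).adjoint x - (S b).adjoint x‖ ≤
        K * ‖(S (a - b + (b - a))).adjoint x - x‖ := by
      have aux : ∀ a b : ℝ≥0, b ≤ a → ‖(S a).adjoint x - (S b).adjoint x‖ ≤
          K * ‖(S (a - b)).adjoint x - x‖ := by
        intro a b hab
        have : (S a).adjoint x = (S b).adjoint ((S (a - b)).adjoint x) := by
          rw [← hcomp, add_tsub_cancel_of_le hab]
        rw [this, ← map_sub]
        exact ContinuousLinearMap.le_of_opNorm_le _ (hadj b) _
      intro a b
      rcases le_total b a with h | h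
      · rw [tsub_eq_zero_of_le h, add_zero]; exact aux a b h
      · rw [tsub_eq_zero_of_le h, zero_add, norm_sub_rev]; exact aux b a h
    rw [continuous_iff_continuousAt]
    intro b
    rw [ContinuousAt, tendsto_iff_norm_sub_tendsto_zero]
    refine squeeze_zero (fun _ => norm_nonneg _) (fun a => main a b) ?_
    have c1 : Tendsto (fun a : ℝ≥0 => a - b + (b - a)) (𝓝 b) (𝓝 0) := by
      have : Continuous fun a : ℝ≥0 => a - b + (b - a) := by fun_prop
      simpa using this.tendsto b
    have c2 := (((S.tendsto_adjoint x).comp c1).sub_const x).norm.const_mul K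
    simpa using c2
  stable' := by
    obtain ⟨M, ω, hω, hM⟩ := S.stable'
    refine ⟨M, ω, hω, fun t => ?_⟩
    rw [LinearIsometryEquiv.norm_map]
    exact hM t

/-- The operator `A*`, the Hilbert space adjoint of the generator. -/
noncomputable def adjGen : Y →ₗ.[ℂ] Y := S.generator.adjoint

theorem adjGen_comm (t : ℝ≥0) (x : S.adjGen.domain) :
    ∃ h : (S t).adjoint x ∈ S.adjGen.domain,
      S.adjGen ⟨(S t).adjoint x, h⟩ = (S t).adjoint (S.adjGen x) := by
  have hdom : (S t).adjoint x ∈ S.adjGen.domain := by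
    have hx : Continuous ((innerₛₗ ℂ (x : Y)).comp S.generator.toFun) := x.2
    change Continuous ((innerₛₗ ℂ ((S t).adjoint (x : Y))).comp S.generator.toFun)
    have hc : Continuous fun y : S.generator.domain =>
        (⟨S t y, (S.generator_comm t y).1⟩ : S.generator.domain) := by
      refine Continuous.subtype_mk ?_ _
      fun_prop
    refine (hx.comp hc).congr fun y => ?_
    change inner ℂ (x : Y) (S.generator ⟨S t y, _⟩) =
      inner ℂ ((S t).adjoint (x : Y)) (S.generator y)
    rw [(S.generator_comm t y).2, ContinuousLinearMap.adjoint_inner_left]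
  refine ⟨hdom, ?_⟩
  by_cases hd : Dense (S.generator.domain : Set Y)
  · refine LinearPMap.adjoint_apply_eq hd _ fun y => ?_
    have hf := LinearPMap.adjoint_isFormalAdjoint hd x
      ⟨S t y, (S.generator_comm t y).1⟩
    rw [(S.generator_comm t y).2] at hf
    change inner ℂ ((S t).adjoint (S.adjGen x)) (y : Y) =
      inner ℂ ((S t).adjoint (x : Y)) (S.generator y)
    rw [ContinuousLinearMap.adjoint_inner_left, ContinuousLinearMap.adjoint_inner_left]
    exact hf
  · have h1 : S.adjGen x = 0 := LinearPMap.adjoint_apply_of_not_dense hd x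
    rw [h1, map_zero]
    exact LinearPMap.adjoint_apply_of_not_dense hd _

/-- The restriction of `e^{A* t}` to `D(A*)`, bounded for the graph norm. -/
noncomputable def adjDom (t : ℝ≥0) : GraphDom S.adjGen →L[ℂ] GraphDom S.adjGen :=
  LinearMap.mkContinuous
    { toFun := fun x => GraphDom.mk ((S t).adjoint x.val) (S.adjGen_comm t x).1
      map_add' := fun x y => Subtype.ext (map_add (S t).adjoint x.val y.val)
      map_smul' := fun c x => Subtype.ext (map_smul (S t).adjoint c x.val) }
    ‖S t‖
    (by
      intro x
      have hb : ∀ y : Y, ‖(S t).adjoint y‖ ≤ ‖S t‖ * ‖y‖ := fun y =>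
        ContinuousLinearMap.le_of_opNorm_le _ (LinearIsometryEquiv.norm_map _ _).le y
      have h1 := hb x.val
      have h2 := hb x.app
      refine le_of_sq_le_sq ?_ (by positivity)
      rw [mul_pow, GraphDom.norm_sq, GraphDom.norm_sq x]
      have e1 : (GraphDom.mk ((S t).adjoint x.val) (S.adjGen_comm t x).1 :
        GraphDom S.adjGen).app = (S t).adjoint x.app := (S.adjGen_comm t x).2
      change ‖(S t).adjoint x.val‖ ^ 2 + ‖(GraphDom.mk ((S t).adjoint x.val)
        (S.adjGen_comm t x).1 : GraphDom S.adjGen).app‖ ^ 2 ≤ _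
      rw [e1, mul_add, ← mul_pow, ← mul_pow]
      gcongr)

/-- The extension of `e^{A t}` to the extrapolation space `[D(A*)]'`:
`⟨e^{A t} φ, x⟩ = ⟨φ, e^{A* t} x⟩`. -/
noncomputable def extrap (t : ℝ≥0) (φ : AntiDual S.adjGen) : AntiDual S.adjGen :=
  φ.comp (S.adjDom t)

end StableSemigroup

/-! ### The control operator and the input-to-state map -/

section Control

variable {Y U : Type*} [NormedAddCommGroup Y] [InnerProductSpace ℂ Y]
  [NormedAddCommGroup U] [InnerProductSpace ℂ U] [CompleteSpace U]

/-- The adjoint `B* : D(A*) → U` of `B : U → [D(A*)]'`, characterized by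
`⟨B u, x⟩ = (u, B* x)_U`. -/
noncomputable def controlAdjoint {T : Y →ₗ.[ℂ] Y} (B : U →L[ℂ] AntiDual T) :
    GraphDom T →L[ℂ] U :=
  ((InnerProductSpace.toDual ℂ U).symm.toContinuousLinearEquiv :
    StrongDual ℂ U →L⋆[ℂ] U).comp B.flip

theorem inner_controlAdjoint {T : Y →ₗ.[ℂ] Y} (B : U →L[ℂ] AntiDual T) (x : GraphDom T) (u : U) :
    inner ℂ (controlAdjoint B x) u = B u x :=
  InnerProductSpace.toDual_symm_apply

/-- The input-to-state map `(L v)(t) = ∫₀ᵗ e^{A (t - s)} B v(s) ds`, a Bochner integral in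
the extrapolation space `[D(A*)]'`. -/
noncomputable def inputToState [CompleteSpace Y] (S : StableSemigroup Y) (B : U →L[ℂ] AntiDual S.adjGen)
    (v : ℝ → U) (t : ℝ) : AntiDual S.adjGen :=
  ∫ s in (0 : ℝ)..t, S.extrap (t - s).toNNReal (B (v s))

/-- Lebesgue measure on the half-line `(0, ∞)`. -/
noncomputable def halfLine : Measure ℝ := volume.restrict (Ioi 0)

/-- The linear map `L`, from functions `(0, ∞) → U` to functions `[0, ∞) → V`, maps
`L^p(0, ∞; U)` continuously into `L^r(0, ∞; E)`: `L v` lies in the target and its norm is at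
most a constant times that of `v`.
The relation `J φ e` says which elements `φ` of `V` are identified with which elements `e`
of `E`. -/
def MapsLpLp {V E : Type*} [NormedAddCommGroup E] (J : V → E → Prop)
    (L : (ℝ → U) → ℝ → V) (p r : ℝ≥0∞) : Prop :=
  ∃ C : ℝ≥0, ∀ v : ℝ → U, MemLp v p halfLine →
    ∃ y : ℝ → E, MemLp y r halfLine ∧ (∀ᵐ t ∂halfLine, J (L v t) (y t)) ∧
      eLpNorm y r halfLine ≤ C * eLpNorm v p halfLine

/-- The linear map `L` maps `L^p(0, ∞; U)` continuously into `C_b([0, ∞); E)`. -/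
def MapsLpCb {V E : Type*} [NormedAddCommGroup E] (J : V → E → Prop)
    (L : (ℝ → U) → ℝ → V) (p : ℝ≥0∞) : Prop :=
  ∃ C : ℝ≥0, ∀ v : ℝ → U, MemLp v p halfLine →
    ∃ y : BoundedContinuousFunction ℝ≥0 E, (∀ t : ℝ≥0, J (L v t) (y t)) ∧
      ‖y‖ₑ ≤ C * eLpNorm v p halfLine

end Control

/-! Write R = (-A)⁻¹ and K = B*(-A*)⁻¹, a bounded operator from Y to U. In the extrapolation space B
= (-A)K*, so Lv(t) = (-A)z(t) with z(t) = ∫₀^∞ e^{Aσ}K*v(t-σ)dσ, where v is extended by zero to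
negative times. This z(t) is an ordinary Bochner integral in Y (`control_eq_extrapDual`,
`exists_inputToState_eq`). Claims 2-4 say that z(t) = Rw(t) with w controlled. For claim 1 it is
(-A)^{-ε}z(t) that must lie in the range of R, and for claim 5 z(t) must lie in the range of
R(-A)^{-ε}.

Range membership is obtained by duality. By Douglas' lemma (`exists_apply_eq_of_norm_inner_le`), z =
Qw with ‖w‖ ≤ c as soon as |(x,z)| ≤ c‖Q*x‖ for all x. Moreover |(x,z(t))| ≤ ∫ ‖v(t-σ)‖ ‖K e^{A*σ}x‖
dσ (`enorm_inner_mild_le`). So everything reduces to bounding K e^{A*σ}x = F(σ)R*x + G(σ)R*x by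
‖R*x‖ or, for claim 5, by ‖Q*x‖ with Q = R(-A)^{-ε}. Such bounds are needed only on a finite
interval. The decay of the semigroup carries them to the half-line with an exponential weight
(`exists_pointwise_decay`, `exists_lintegral_decay`).

For L^p to L^r bounds, the singular part F is a truncated fractional integral of order 1-γ, handled
by the Hardy-Littlewood-Sobolev inequality (`exists_lintegral_fracInt_le`). The part G and the tail
lie in a weighted L^{p'} and are handled by Hölder and Young (`exists_memLp_preimage_of_singular`).
All finite r in claims 2-4 follow from the single condition 1/p - 1/r ≤ 1-γ.

For bounds into C_b, the observation is in L^s near zero with s dual to an exponent at most that of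
the control. Hölder then bounds w(t), and continuity of translations gives continuity
(`exists_boundedContinuousFunction_preimage`). In claim 4 the L^s bound holds because γs < 1; in
claim 5 it is the assumed L^q estimate, and the factor (-A)^{-ε} in Q puts the state in D((-A)^ε).

For claim 1 the smoothing by (-A*)^{-ε} makes G pointwise bounded, so the observation is dominated
by a kernel in L^r and Young's inequality applies. -/

namespace StableSemigroup

/-! ### The inverses of the generator and of its adjoint. -/

variable {Y : Type*} [NormedAddCommGroup Y] [InnerProductSpace ℂ Y] (S : StableSemigroup Y)

theorem apply_add (s t : ℝ≥0) (x : Y) : S (s + t) x = S s (S t x) :=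
  DFunLike.congr_fun (S.map_add' s t) x

theorem apply_comm (s t : ℝ≥0) (x : Y) : S s (S t x) = S t (S s x) := by
  rw [← S.apply_add, add_comm, S.apply_add]

theorem apply_zero (x : Y) : S 0 x = x := by simp [S.map_zero']

/-- The orbit map is jointly continuous. -/
theorem continuous_uncurry : Continuous fun p : ℝ≥0 × Y => S p.1 p.2 := by
  obtain ⟨K, hK0, hK⟩ := S.exists_bound
  rw [continuous_iff_continuousAt]
  rintro ⟨t, x⟩
  rw [ContinuousAt, tendsto_iff_norm_sub_tendsto_zero]
  have h1 : Tendsto (fun p : ℝ≥0 × Y => K * ‖p.2 - x‖ + ‖S p.1 x - S t x‖) (𝓝 (t, x)) (𝓝 0) := by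
    have c : Continuous fun p : ℝ≥0 × Y => K * ‖p.2 - x‖ + ‖S p.1 x - S t x‖ := by
      have := (S.continuous' x).comp (continuous_fst (X := ℝ≥0) (Y := Y))
      exact ((continuous_snd.sub continuous_const).norm.const_mul K |>.add
        (this.sub continuous_const).norm)
    simpa using c.tendsto (t, x)
  refine squeeze_zero (fun _ => norm_nonneg _) (fun p => ?_) h1
  have e : S p.1 p.2 - S t x = S p.1 (p.2 - x) + (S p.1 x - S t x) := by
    rw [map_sub]; abel
  rw [e]
  exact (norm_add_le _ _).trans (by gcongr; exact (S p.1).le_of_opNorm_le (hK _) _)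

section Complete

variable [CompleteSpace Y]

theorem negPow_map_of_commute (α : ℝ) (hα : 0 < α) (T : Y →L[ℂ] Y)
    (hT : ∀ t x, S t (T x) = T (S t x)) (x : Y) :
    S.negPow α hα (T x) = T (S.negPow α hα x) := by
  rw [negPow_apply, negPow_apply, T.map_smul_of_tower, ← T.integral_comp_comm
    (S.integrableOn_orbit α hα x)]
  simp only [hT, T.map_smul_of_tower]

theorem negPow_apply_comm (α : ℝ) (hα : 0 < α) (h : ℝ≥0) (x : Y) :
    S.negPow α hα (S h x) = S h (S.negPow α hα x) :=
  S.negPow_map_of_commute α hα (S h) (fun t x => S.apply_comm t h x) x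

theorem negPow_negPow_comm (α β : ℝ) (hα : 0 < α) (hβ : 0 < β) (x : Y) :
    S.negPow α hα (S.negPow β hβ x) = S.negPow β hβ (S.negPow α hα x) :=
  S.negPow_map_of_commute α hα _ (fun t x => (S.negPow_apply_comm β hβ t x).symm) x

theorem tendsto_average (x : Y) :
    Tendsto (fun h : ℝ≥0 => ((h : ℝ)⁻¹ : ℝ) • ∫ t in (0 : ℝ)..h, S t.toNNReal x)
      (𝓝[>] 0) (𝓝 x) := by
  have hd : HasDerivAt (fun u : ℝ => ∫ t in (0 : ℝ)..u, S t.toNNReal x)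
      (S (0 : ℝ).toNNReal x) 0 :=
    intervalIntegral.integral_hasDerivAt_right
      ((S.continuous_orbit x).intervalIntegrable _ _)
      ((S.continuous_orbit x).stronglyMeasurableAtFilter _ _)
      (S.continuous_orbit x).continuousAt
  have h1 := (hasDerivAt_iff_tendsto_slope_zero.1 hd)
  have h2 : Tendsto (fun h : ℝ≥0 => (h : ℝ)) (𝓝[>] 0) (𝓝[≠] 0) := by
    refine tendsto_nhdsWithin_iff.2 ⟨?_, ?_⟩
    · exact (NNReal.continuous_coe.tendsto 0).mono_left nhdsWithin_le_nhds
    · filter_upwards [self_mem_nhdsWithin] with h hh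
      exact (NNReal.coe_pos.2 hh).ne'
  simpa [Function.comp_def, S.apply_zero] using h1.comp h2

/-- A(-A)⁻¹ = -1 as a limit of difference quotients. Besides locating the domain of the generator,
this recovers x from (-A)⁻¹x by bounded operators, which later gives measurability of preimages. -/
theorem tendsto_negPow_one (x : Y) :
    Tendsto (fun h : ℝ≥0 => ((h : ℝ)⁻¹ : ℝ) • (S h (S.negPow 1 one_pos x) - S.negPow 1 one_pos x))
      (𝓝[>] 0) (𝓝 (-x)) := by
  refine (S.tendsto_average x).neg.congr fun h => ?_
  rw [← negPow_apply_comm, negPow_one_shift, ← smul_neg]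
  congr 1
  abel

theorem negPow_one_mem_graph (x : Y) : (S.negPow 1 one_pos x, -x) ∈ S.generatorGraph :=
  S.tendsto_negPow_one x

theorem negPow_one_mem (x : Y) : S.negPow 1 one_pos x ∈ S.generator.domain :=
  ⟨_, S.negPow_one_mem_graph x, rfl⟩

theorem generator_negPow_one (x : Y) :
    S.generator ⟨S.negPow 1 one_pos x, S.negPow_one_mem x⟩ = -x := by
  have h4 := Submodule.mem_graph_toLinearPMap S.generatorGraph_functional
    ⟨S.negPow 1 one_pos x, S.negPow_one_mem x⟩
  have h5 := S.generatorGraph.sub_mem h4 (S.negPow_one_mem_graph x)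
  exact sub_eq_zero.1 (S.generatorGraph_functional _ h5 (by simp))

theorem negPow_one_generator (z : S.generator.domain) :
    S.negPow 1 one_pos (S.generator z) = -(z : Y) := by
  have h1 : Tendsto (fun r : ℝ≥0 => ((r : ℝ)⁻¹ : ℝ) • (S r z - z)) (𝓝[>] 0)
    (𝓝 (S.generator z)) := Submodule.mem_graph_toLinearPMap S.generatorGraph_functional z
  have h2 := ((S.negPow 1 one_pos).continuous.tendsto _).comp h1
  refine tendsto_nhds_unique h2 ((S.tendsto_negPow_one (z : Y)).congr fun h => ?_)
  rw [Function.comp, (S.negPow 1 one_pos).map_smul_of_tower, map_sub, negPow_apply_comm]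

theorem adjointSemigroup_apply (t : ℝ≥0) : S.adjointSemigroup t = (S t).adjoint := rfl

theorem inner_negPow (α : ℝ) (hα : 0 < α) (x y : Y) :
    inner ℂ x (S.negPow α hα y) =
      (Real.Gamma α)⁻¹ • ∫ t in Ioi (0 : ℝ), (t ^ (α - 1)) • inner ℂ x (S t.toNNReal y) := by
  rw [negPow_apply, inner_smul_right_eq_smul, ← integral_inner (S.integrableOn_orbit α hα y)]
  simp only [inner_smul_right_eq_smul]

theorem adjoint_negPow (α : ℝ) (hα : 0 < α) :
    (S.negPow α hα).adjoint = S.adjointSemigroup.negPow α hα := by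
  refine ((ContinuousLinearMap.eq_adjoint_iff _ _).2 fun x y => ?_).symm
  rw [← inner_conj_symm, inner_negPow, inner_negPow, RCLike.conj_smul, ← integral_conj]
  simp only [RCLike.conj_smul, inner_conj_symm, adjointSemigroup_apply,
    ContinuousLinearMap.adjoint_inner_left]

/-- The orthogonal complement of the range is the kernel of the adjoint. The adjoint is the same
integral for the adjoint semigroup, hence injective. -/
theorem dense_range_negPow_one : DenseRange (S.negPow 1 one_pos) := by
  change Dense (LinearMap.range (S.negPow 1 one_pos : Y →ₗ[ℂ] Y) : Set Y)
  rw [Submodule.dense_iff_topologicalClosure_eq_top,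
    Submodule.topologicalClosure_eq_top_iff, Submodule.eq_bot_iff]
  intro z hz
  apply S.adjointSemigroup.negPow_one_injective
  rw [← adjoint_negPow]
  refine ext_inner_left ℂ fun w => ?_
  have := (Submodule.mem_orthogonal _ _).1 hz (S.negPow 1 one_pos w) ⟨w, rfl⟩
  rw [ContinuousLinearMap.adjoint_inner_right]
  simpa using this

theorem dense_generator_domain : Dense (S.generator.domain : Set Y) :=
  S.dense_range_negPow_one.mono (by rintro _ ⟨x, rfl⟩; exact S.negPow_one_mem x)

theorem adjoint_negPow_one_mem (x : Y) :
    S.adjointSemigroup.negPow 1 one_pos x ∈ S.adjGen.domain := by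
  refine LinearPMap.mem_adjoint_domain_of_exists _ ⟨-x, fun z => ?_⟩
  rw [← adjoint_negPow, ContinuousLinearMap.adjoint_inner_left, negPow_one_generator]
  simp

theorem adjGen_negPow_one (x : Y) :
    S.adjGen ⟨S.adjointSemigroup.negPow 1 one_pos x, S.adjoint_negPow_one_mem x⟩ = -x := by
  refine LinearPMap.adjoint_apply_eq S.dense_generator_domain _ fun z => ?_
  change inner ℂ (-x) (z : Y) = inner ℂ (S.adjointSemigroup.negPow 1 one_pos x) (S.generator z)
  rw [← adjoint_negPow, ContinuousLinearMap.adjoint_inner_left, negPow_one_generator]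
  simp

/-- With `adjGen_negPow_one` this makes (-A*)⁻¹ a two-sided inverse, so that D(A*) is exactly its
range. -/
theorem negPow_one_adjGen (x : S.adjGen.domain) :
    S.adjointSemigroup.negPow 1 one_pos (S.adjGen x) = -(x : Y) := by
  refine ext_inner_right ℂ fun y => ?_
  have h := LinearPMap.adjoint_isFormalAdjoint S.dense_generator_domain x
    ⟨S.negPow 1 one_pos y, S.negPow_one_mem y⟩
  rw [generator_negPow_one] at h
  rw [← adjoint_negPow, ContinuousLinearMap.adjoint_inner_left]
  change inner ℂ (S.adjGen x) _ = _ at h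
  rw [h, inner_neg_right, inner_neg_left]

/-- The bounded map `a ↦ (-A*)⁻¹ a` from `Y` onto `D(A*)`. -/
noncomputable def toAdjDom : Y →L[ℂ] GraphDom S.adjGen :=
  LinearMap.mkContinuous
    { toFun := fun x => GraphDom.mk _ (S.adjoint_negPow_one_mem x)
      map_add' := fun x y => Subtype.ext (map_add (S.adjointSemigroup.negPow 1 one_pos) x y)
      map_smul' := fun c x => Subtype.ext (map_smul (S.adjointSemigroup.negPow 1 one_pos) c x) }
    (‖S.adjointSemigroup.negPow 1 one_pos‖ + 1) (by
      intro x
      refine le_of_sq_le_sq ?_ (by positivity)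
      rw [GraphDom.norm_sq]
      have h1 : ‖S.adjointSemigroup.negPow 1 one_pos x‖ ≤ _ :=
        ContinuousLinearMap.le_opNorm _ x
      have h2 : (GraphDom.mk _ (S.adjoint_negPow_one_mem x) : GraphDom S.adjGen).app = -x :=
        S.adjGen_negPow_one x
      change ‖S.adjointSemigroup.negPow 1 one_pos x‖ ^ 2 +
        ‖(GraphDom.mk _ (S.adjoint_negPow_one_mem x) : GraphDom S.adjGen).app‖ ^ 2 ≤ _
      rw [h2, norm_neg]
      have h3 := pow_le_pow_left₀ (norm_nonneg _) h1 2
      have h4 : 0 ≤ ‖S.adjointSemigroup.negPow 1 one_pos‖ * ‖x‖ ^ 2 := by positivity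
      nlinarith)

theorem toAdjDom_val (x : Y) : (S.toAdjDom x).val = S.adjointSemigroup.negPow 1 one_pos x := rfl

theorem toAdjDom_neg_app (x : GraphDom S.adjGen) : S.toAdjDom (-x.app) = x := by
  refine Subtype.ext ?_
  change S.adjointSemigroup.negPow 1 one_pos (-x.app) = x.val
  rw [map_neg]
  exact neg_eq_iff_eq_neg.2 (S.negPow_one_adjGen x)

theorem adjDom_toAdjDom (t : ℝ≥0) (x : Y) :
    S.adjDom t (S.toAdjDom x) = S.toAdjDom (S.adjointSemigroup t x) :=
  Subtype.ext (S.adjointSemigroup.negPow_apply_comm 1 one_pos t x).symm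

/-! #### Injectivity of the fractional integrals -/

/-- The Beta integral in its form on the half-line: comparable to u^{b-1} near 0 and dominated by
u^{-a-1} at infinity. -/
theorem integrableOn_rpow_mul_one_add_rpow (a b : ℝ) (ha : 0 < a) (hb : 0 < b) :
    IntegrableOn (fun u : ℝ => u ^ (b - 1) * (1 + u) ^ (-(a + b))) (Ioi 0) := by
  have hm : AEStronglyMeasurable (fun u : ℝ => u ^ (b - 1) * (1 + u) ^ (-(a + b))) volume :=
    (by fun_prop : Measurable _).aestronglyMeasurable
  rw [← Ioc_union_Ioi_eq_Ioi zero_le_one, integrableOn_union]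
  constructor
  · have h1 : IntegrableOn (fun u : ℝ => u ^ (b - 1)) (Ioc 0 1) := by
      rw [← intervalIntegrable_iff_integrableOn_Ioc_of_le zero_le_one]
      exact intervalIntegral.intervalIntegrable_rpow' (by linarith)
    refine h1.mono' hm.restrict ((ae_restrict_iff' measurableSet_Ioc).2
      (Eventually.of_forall fun u hu => ?_))
    have hu0 : 0 < u := hu.1
    rw [Real.norm_of_nonneg (by positivity)]
    exact mul_le_of_le_one_right (by positivity)
      (Real.rpow_le_one_of_one_le_of_nonpos (by linarith) (by linarith))
  · have h1 : IntegrableOn (fun u : ℝ => u ^ (-a - 1)) (Ioi 1) :=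
      integrableOn_Ioi_rpow_of_lt (by linarith) one_pos
    refine h1.mono' hm.restrict ((ae_restrict_iff' measurableSet_Ioi).2
      (Eventually.of_forall fun u hu => ?_))
    have hu1 : (1 : ℝ) < u := hu
    have hu0 : 0 < u := by linarith
    rw [Real.norm_of_nonneg (by positivity)]
    have e : u ^ (-a - 1) = u ^ (b - 1) * u ^ (-(a + b)) := by
      rw [← Real.rpow_add hu0]; ring_nf
    rw [e]
    gcongr ?_ * ?_
    exact Real.rpow_le_rpow_of_nonpos hu0 (by linarith) (by linarith)

theorem integral_rpow_smul_comp_mul_one_add {E : Type*} [NormedAddCommGroup E] [NormedSpace ℝ E]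
    (a b u : ℝ) (hu : 0 < u) (f : ℝ → E) :
    ∫ s in Ioi (0 : ℝ), (u ^ (b - 1) * s ^ (a + b - 1)) • f (s * (1 + u)) =
      (u ^ (b - 1) * (1 + u) ^ (-(a + b))) • ∫ t in Ioi (0 : ℝ), t ^ (a + b - 1) • f t := by
  have hu1 : 0 < 1 + u := by linarith
  have := integral_comp_mul_right_Ioi (fun t => t ^ (a + b - 1) • f t) 0 hu1
  rw [zero_mul] at this
  have e : (1 + u) ^ (-(a + b)) = (1 + u) ^ (-(a + b - 1)) * (1 + u)⁻¹ := by
    rw [← Real.rpow_neg_one, ← Real.rpow_add hu1]; ring_nf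
  rw [e, mul_smul, mul_smul, ← this, ← integral_smul, ← integral_smul]
  refine setIntegral_congr_fun measurableSet_Ioi fun s hs => ?_
  have hs0 : (0 : ℝ) < s := hs
  simp only [smul_smul]
  congr 1
  rw [Real.mul_rpow hs0.le hu1.le, Real.rpow_neg hu1.le]
  field_simp

/-- The semigroup law of the fractional integrals, up to a nonzero constant. -/
theorem exists_integral_integral_orbit (a b : ℝ) (ha : 0 < a) (hb : 0 < b) :
    ∃ c : ℝ, c ≠ 0 ∧ ∀ x : Y,
      ∫ s in Ioi (0 : ℝ), s ^ (a - 1) • S s.toNNReal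
        (∫ t in Ioi (0 : ℝ), t ^ (b - 1) • S t.toNNReal x) =
      c • ∫ t in Ioi (0 : ℝ), t ^ (a + b - 1) • S t.toNNReal x := by
  have hab : 0 < a + b := by linarith
  have hki := integrableOn_rpow_mul_one_add_rpow a b ha hb
  refine ⟨∫ u in Ioi (0 : ℝ), u ^ (b - 1) * (1 + u) ^ (-(a + b)), ?_, fun x => ?_⟩
  · refine ne_of_gt ?_
    rw [setIntegral_pos_iff_support_of_nonneg_ae ((ae_restrict_iff' measurableSet_Ioi).2
      (Eventually.of_forall fun u hu => ?_)) hki]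
    · refine lt_of_lt_of_le (b := volume (Ioi (0 : ℝ))) (by simp) (measure_mono fun u hu => ?_)
      have hu0 : (0 : ℝ) < u := hu
      exact ⟨by simp only [Function.mem_support]; positivity, hu⟩
    · have hu0 : (0 : ℝ) < u := hu
      change 0 ≤ u ^ (b - 1) * (1 + u) ^ (-(a + b))
      positivity
  -- Substituting t = su in the inner integral gives the integrand H. Integrating in s first, the
  -- scaling s(1+u) factors out the weight u^{b-1}(1+u)^{-(a+b)}, whose integral is the constant c.
  set H : ℝ → ℝ → Y := fun s u => (u ^ (b - 1) * s ^ (a + b - 1)) • S (s * (1 + u)).toNNReal x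
    with hH
  have scale := fun (u : ℝ) (hu : 0 < u) =>
    integral_rpow_smul_comp_mul_one_add a b u hu (fun t : ℝ => S t.toNNReal x)
  have e1 : ∀ s ∈ Ioi (0 : ℝ), s ^ (a - 1) • S s.toNNReal
      (∫ t in Ioi (0 : ℝ), t ^ (b - 1) • S t.toNNReal x) = ∫ u in Ioi (0 : ℝ), H s u := by
    intro s hs
    have hs0 : (0 : ℝ) < s := hs
    rw [← (S s.toNNReal).integral_comp_comm (S.integrableOn_orbit b hb x)]
    have h3 := integral_comp_mul_left_Ioi
      (fun t : ℝ => S s.toNNReal (t ^ (b - 1) • S t.toNNReal x)) 0 hs0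
    rw [mul_zero] at h3
    rw [← smul_inv_smul₀ hs0.ne' (∫ t in Ioi (0 : ℝ), S s.toNNReal (t ^ (b - 1) • S t.toNNReal x)),
      ← h3, smul_smul, ← integral_smul]
    refine setIntegral_congr_fun measurableSet_Ioi fun u hu => ?_
    have hu0 : (0 : ℝ) < u := hu
    simp only [hH]
    rw [(S s.toNNReal).map_smul_of_tower, smul_smul, ← S.apply_add,
      ← Real.toNNReal_add hs0.le (by positivity)]
    have e2 : s + s * u = s * (1 + u) := by ring
    rw [e2]
    congr 1
    · rw [Real.mul_rpow hs0.le hu0.le]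
      have e : s ^ (a + b - 1) = s ^ (a - 1) * s * s ^ (b - 1) := by
        rw [← Real.rpow_add_one hs0.ne', ← Real.rpow_add hs0]; ring_nf
      rw [e]; ring
  rw [setIntegral_congr_fun measurableSet_Ioi e1]
  have hmeas : AEStronglyMeasurable (Function.uncurry H)
      ((volume.restrict (Ioi 0)).prod (volume.restrict (Ioi 0))) := by
    have m1 : Measurable fun p : ℝ × ℝ => p.2 ^ (b - 1) * p.1 ^ (a + b - 1) := by fun_prop
    have m2 : Continuous fun p : ℝ × ℝ => S (p.1 * (1 + p.2)).toNNReal x :=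
      (S.continuous_orbit x).comp (by fun_prop)
    exact m1.aestronglyMeasurable.smul m2.aestronglyMeasurable
  have hint : Integrable (Function.uncurry H)
      ((volume.restrict (Ioi 0)).prod (volume.restrict (Ioi 0))) := by
    rw [integrable_prod_iff' hmeas]
    constructor
    · refine (ae_restrict_iff' measurableSet_Ioi).2 (Eventually.of_forall fun u hu => ?_)
      have hu0 : (0 : ℝ) < u := hu
      have hu1 : 0 < 1 + u := by linarith
      have h1 := (integrableOn_Ioi_comp_mul_right_iff
        (fun t : ℝ => t ^ (a + b - 1) • S t.toNNReal x) 0 hu1).2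
        (by rw [zero_mul]; exact S.integrableOn_orbit (a + b) hab x)
      refine (h1.smul (u ^ (b - 1) * (1 + u) ^ (-(a + b - 1)))).congr
        ((ae_restrict_iff' measurableSet_Ioi).2 (Eventually.of_forall fun s hs => ?_))
      have hs0 : (0 : ℝ) < s := hs
      simp only [Function.uncurry, hH, Pi.smul_apply, smul_smul]
      congr 1
      rw [Real.mul_rpow hs0.le hu1.le, Real.rpow_neg hu1.le]
      field_simp
    · refine (hki.mul_const (∫ t in Ioi (0 : ℝ), t ^ (a + b - 1) • ‖S t.toNNReal x‖)).congr
        ((ae_restrict_iff' measurableSet_Ioi).2 (Eventually.of_forall fun u hu => ?_))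
      have hu0 : (0 : ℝ) < u := hu
      have := integral_rpow_smul_comp_mul_one_add a b u hu0 (fun t : ℝ => ‖S t.toNNReal x‖)
      change _ * _ = ∫ s in Ioi (0 : ℝ), ‖H s u‖
      rw [smul_eq_mul] at this
      rw [← this]
      refine setIntegral_congr_fun measurableSet_Ioi fun s hs => ?_
      have hs0 : (0 : ℝ) < s := hs
      simp only [hH, norm_smul, smul_eq_mul]
      rw [Real.norm_of_nonneg (by positivity)]
  rw [integral_integral_swap hint, ← integral_smul_const]
  refine setIntegral_congr_fun measurableSet_Ioi fun u hu => ?_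
  exact scale u hu

omit [CompleteSpace Y] in
theorem negPow_eq_zero_iff (α : ℝ) (hα : 0 < α) (x : Y) :
    S.negPow α hα x = 0 ↔ ∫ t in Ioi (0 : ℝ), t ^ (α - 1) • S t.toNNReal x = 0 := by
  rw [negPow_apply, smul_eq_zero, or_iff_right (inv_ne_zero (Real.Gamma_pos_of_pos hα).ne')]

/-- Only kernels are compared, so the Beta constant need not be identified with Γ(a)Γ(b)/Γ(a+b). -/
theorem negPow_add_eq_zero (a b : ℝ) (ha : 0 < a) (hb : 0 < b) (x : Y) :
    S.negPow (a + b) (add_pos ha hb) x = 0 ↔ S.negPow a ha (S.negPow b hb x) = 0 := by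
  obtain ⟨c, hc, h⟩ := S.exists_integral_integral_orbit a b ha hb
  have h1 := h x
  rw [negPow_eq_zero_iff, negPow_apply S b, (S.negPow a ha).map_smul_of_tower, smul_eq_zero,
    or_iff_right (inv_ne_zero (Real.Gamma_pos_of_pos hb).ne'), negPow_eq_zero_iff, h1,
    smul_eq_zero, or_iff_right hc]

theorem negPow_natCast_injective (n : ℕ) (x : Y)
    (hx : S.negPow (n + 1 : ℝ) (by positivity) x = 0) : x = 0 := by
  induction n generalizing x with
  | zero => exact S.negPow_one_injective x (by simpa using hx)
  | succ n ih =>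
    have h := (S.negPow_add_eq_zero (n + 1 : ℝ) 1 (by positivity) one_pos x).1 (by simpa using hx)
    exact S.negPow_one_injective x (ih _ h)

/-- Composing with (-A)^{-β}, where α + β is a positive integer, reduces to integer powers, which
are iterates of the injective (-A)⁻¹ as far as kernels are concerned. -/
theorem negPow_injective (α : ℝ) (hα : 0 < α) : Function.Injective (S.negPow α hα) := by
  rw [injective_iff_map_eq_zero]
  intro x hx
  obtain ⟨n, hn⟩ := exists_nat_gt α
  have hβ : 0 < (n + 1 : ℝ) - α := by linarith
  refine S.negPow_natCast_injective n x ?_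
  have := (S.negPow_add_eq_zero ((n + 1 : ℝ) - α) α hβ hα x).2 (by rw [hx, map_zero])
  simpa using this

omit [CompleteSpace Y] in
theorem negPow_mem_fracPow (α : ℝ) (hα : 0 < α) (x : Y) :
    S.negPow α hα x ∈ (S.fracPow α hα).domain := by
  rw [fracPow, LinearPMap.inverse_domain]
  exact ⟨⟨x, trivial⟩, rfl⟩

theorem fracPow_negPow (α : ℝ) (hα : 0 < α) (x : Y) :
    S.fracPow α hα ⟨S.negPow α hα x, S.negPow_mem_fracPow α hα x⟩ = x := by
  refine LinearPMap.inverse_apply_eq (f := (S.negPow α hα : Y →ₗ[ℂ] Y).toPMap ⊤)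
    (x := ⟨x, trivial⟩) ?_ rfl
  rw [LinearMap.ker_eq_bot]
  intro a b h
  exact Subtype.ext (S.negPow_injective α hα h)

/-- The bounded map `a ↦ (-A)^{-α} a` from `Y` onto `D((-A)^α)`. -/
noncomputable def toFracDom (α : ℝ) (hα : 0 < α) : Y →L[ℂ] GraphDom (S.fracPow α hα) :=
  LinearMap.mkContinuous
    { toFun := fun x => GraphDom.mk _ (S.negPow_mem_fracPow α hα x)
      map_add' := fun x y => Subtype.ext (map_add (S.negPow α hα) x y)
      map_smul' := fun c x => Subtype.ext (map_smul (S.negPow α hα) c x) }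
    (‖S.negPow α hα‖ + 1) (by
      intro x
      refine le_of_sq_le_sq ?_ (by positivity)
      rw [GraphDom.norm_sq]
      have h1 : ‖S.negPow α hα x‖ ≤ _ := ContinuousLinearMap.le_opNorm _ x
      have h2 : (GraphDom.mk _ (S.negPow_mem_fracPow α hα x) : GraphDom (S.fracPow α hα)).app = x :=
        S.fracPow_negPow α hα x
      change ‖S.negPow α hα x‖ ^ 2 +
        ‖(GraphDom.mk _ (S.negPow_mem_fracPow α hα x) : GraphDom (S.fracPow α hα)).app‖ ^ 2 ≤ _
      rw [h2]
      have h3 := pow_le_pow_left₀ (norm_nonneg _) h1 2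
      have h4 : 0 ≤ ‖S.negPow α hα‖ * ‖x‖ ^ 2 := by positivity
      nlinarith)

theorem toFracDom_val (α : ℝ) (hα : 0 < α) (x : Y) :
    (S.toFracDom α hα x).val = S.negPow α hα x := rfl

theorem toFracDom_app (α : ℝ) (hα : 0 < α) (x : Y) : (S.toFracDom α hα x).app = x :=
  S.fracPow_negPow α hα x

theorem toFracDom_app_self (α : ℝ) (hα : 0 < α) (x : GraphDom (S.fracPow α hα)) :
    S.toFracDom α hα x.app = x := by
  have hx : x.val ∈ (S.fracPow α hα).domain := (show (S.fracPow α hα).domain from x).2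
  have hx' : x.val ∈ LinearMap.range ((S.negPow α hα : Y →ₗ[ℂ] Y).toPMap ⊤).toFun := by
    rw [← LinearPMap.inverse_domain]; exact hx
  obtain ⟨⟨y, _⟩, hy⟩ := hx'
  have hy' : S.negPow α hα y = x.val := hy
  have e : S.toFracDom α hα y = x := Subtype.ext hy'
  rw [← e, toFracDom_app]

end Complete
end StableSemigroup

/-! ### Convolution inequalities on the line: Young and Hardy-Littlewood-Sobolev. -/

theorem lintegral_Ioo_rpow_sub_one {s b : ℝ} (hs : 0 < s) (hb : 0 ≤ b) :
    ∫⁻ x in Ioo 0 b, ENNReal.ofReal (x ^ (s - 1)) = ENNReal.ofReal (b ^ s / s) := by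
  have hi : IntegrableOn (fun x : ℝ => x ^ (s - 1)) (Ioc 0 b) := by
    rw [← intervalIntegrable_iff_integrableOn_Ioc_of_le hb]
    exact intervalIntegral.intervalIntegrable_rpow' (by linarith)
  rw [restrict_Ioo_eq_restrict_Ioc, ← ofReal_integral_eq_lintegral_ofReal hi
    ((ae_restrict_iff' measurableSet_Ioc).2 (Eventually.of_forall fun x hx =>
      Real.rpow_nonneg hx.1.le _)), ← intervalIntegral.integral_of_le hb,
    integral_rpow (Or.inl (by linarith))]
  simp [Real.zero_rpow hs.ne']

theorem lintegral_Ioi_rpow_of_lt {a ρ : ℝ} (ha : 1 < a) (hρ : 0 < ρ) :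
    ∫⁻ x in Ioi ρ, ENNReal.ofReal (x ^ (-a)) = ENNReal.ofReal (ρ ^ (1 - a) / (a - 1)) := by
  have hi : IntegrableOn (fun x : ℝ => x ^ (-a)) (Ioi ρ) :=
    integrableOn_Ioi_rpow_of_lt (by linarith) hρ
  rw [← ofReal_integral_eq_lintegral_ofReal hi
    ((ae_restrict_iff' measurableSet_Ioi).2 (Eventually.of_forall fun x hx =>
      Real.rpow_nonneg (hρ.le.trans (le_of_lt hx)) _)),
    integral_Ioi_rpow_of_lt (by linarith) hρ]
  congr 1
  rw [show -a + 1 = 1 - a by ring, ← neg_sub a 1, neg_div_neg_eq]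

/-- The layer cake formula for a single value in `[0, ∞]`. -/
theorem lintegral_indicator_rpow_sub_one {s : ℝ} (hs : 0 < s) (b : ℝ≥0∞) :
    ∫⁻ x in Ioi (0 : ℝ), {x : ℝ | ENNReal.ofReal x < b}.indicator
      (fun x => ENNReal.ofReal (x ^ (s - 1))) x = b ^ s / ENNReal.ofReal s := by
  have hm : ∀ b : ℝ≥0∞, MeasurableSet {x : ℝ | ENNReal.ofReal x < b} := fun b =>
    measurableSet_lt ENNReal.measurable_ofReal measurable_const
  have fin : ∀ b : ℝ≥0, ∫⁻ x in Ioi (0 : ℝ), {x : ℝ | ENNReal.ofReal x < b}.indicator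
      (fun x => ENNReal.ofReal (x ^ (s - 1))) x = (b : ℝ≥0∞) ^ s / ENNReal.ofReal s := by
    intro b
    have e : {x : ℝ | ENNReal.ofReal x < b} ∩ Ioi 0 = Ioo 0 (b : ℝ) := by
      ext x
      rw [mem_inter_iff, mem_Ioo, and_comm]
      refine and_congr_right fun hx : 0 < x => ?_
      change ENNReal.ofReal x < b ↔ _
      rw [← ENNReal.ofReal_coe_nnreal, ENNReal.ofReal_lt_ofReal_iff_of_nonneg hx.le]
    rw [lintegral_indicator (hm _), Measure.restrict_restrict (hm _), e,
      lintegral_Ioo_rpow_sub_one hs b.coe_nonneg, ENNReal.ofReal_div_of_pos hs]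
    congr 1
    rw [← ENNReal.ofReal_coe_nnreal, ENNReal.ofReal_rpow_of_nonneg b.coe_nonneg hs.le]
  induction b with
  | coe b => exact fin b
  | top =>
    rw [ENNReal.top_rpow_of_pos hs, ENNReal.top_div_of_ne_top ENNReal.ofReal_ne_top]
    refine ENNReal.eq_top_of_forall_nnreal_le fun c => ?_
    -- The finite level at which the integral equals c; the integral with infinite level dominates
    -- it.
    set b : ℝ≥0 := (c * s.toNNReal) ^ (s⁻¹) with hb
    have h1 := fin b
    have h2 : (b : ℝ≥0∞) ^ s / ENNReal.ofReal s = c := by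
      rw [hb, ← ENNReal.coe_rpow_of_nonneg _ hs.le, ← NNReal.rpow_mul, inv_mul_cancel₀ hs.ne',
        NNReal.rpow_one, ENNReal.coe_mul]
      exact ENNReal.mul_div_cancel_right (by simpa using hs) ENNReal.coe_ne_top
    rw [← h2, ← h1]
    refine lintegral_mono fun x => ?_
    exact indicator_le_indicator_of_subset (fun x hx => (by simp)) (fun _ => zero_le) x

theorem measurable_lintegral_mul_comp_sub {k f : ℝ → ℝ≥0∞} (hk : Measurable k)
    (hf : Measurable f) (μ : Measure ℝ) [SFinite μ] :
    Measurable fun t => ∫⁻ σ, k σ * f (t - σ) ∂μ :=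
  Measurable.lintegral_prod_right' (f := fun z : ℝ × ℝ => k z.2 * f (z.1 - z.2)) (by fun_prop)

theorem lintegral_lintegral_mul_comp_sub {k f : ℝ → ℝ≥0∞} (hk : Measurable k)
    (hf : Measurable f) (μ : Measure ℝ) [SFinite μ] :
    ∫⁻ t, ∫⁻ σ, k σ * f (t - σ) ∂μ = (∫⁻ σ, k σ ∂μ) * ∫⁻ t, f t := by
  rw [lintegral_lintegral_swap (by fun_prop)]
  rw [← lintegral_mul_const _ hk]
  refine lintegral_congr fun σ => ?_
  rw [lintegral_const_mul _ (by fun_prop), lintegral_sub_right_eq_self]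

/-- Jensen's inequality for a power and the measure with density `g`. -/
theorem rpow_lintegral_mul_le {α : Type*} [MeasurableSpace α] (μ : Measure α) {ρ : ℝ} (hρ : 1 ≤ ρ)
    {h g : α → ℝ≥0∞} (hh : Measurable h) (hg : Measurable g) :
    (∫⁻ x, h x * g x ∂μ) ^ ρ ≤ (∫⁻ x, h x ^ ρ * g x ∂μ) * (∫⁻ x, g x ∂μ) ^ (ρ - 1) := by
  rcases hρ.eq_or_lt with rfl | hρ
  · simp
  have hc := Real.HolderConjugate.conjExponent hρ
  set ρ' := ρ.conjExponent
  have e : ∀ u : α → ℝ≥0∞, Measurable u → ∫⁻ x, u x * g x ∂μ = ∫⁻ x, u x ∂(μ.withDensity g) := by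
    intro u hu
    rw [lintegral_withDensity_eq_lintegral_mul _ hg hu]
    simp only [Pi.mul_apply, mul_comm]
  -- Hölder against the constant 1 in the measure g dμ.
  have h1 := ENNReal.lintegral_mul_le_Lp_mul_Lq (μ.withDensity g) hc hh.aemeasurable
    (g := fun _ => 1) aemeasurable_const
  simp only [Pi.mul_apply, mul_one, ENNReal.one_rpow, lintegral_one, withDensity_apply _
    MeasurableSet.univ, Measure.restrict_univ] at h1
  rw [e h hh, e _ (hh.pow_const ρ)]
  refine (ENNReal.rpow_le_rpow h1 hc.nonneg).trans (le_of_eq ?_)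
  rw [ENNReal.mul_rpow_of_nonneg _ _ hc.nonneg, ← ENNReal.rpow_mul, ← ENNReal.rpow_mul,
    one_div_mul_cancel hc.ne_zero, ENNReal.rpow_one]
  congr 2
  have := hc.sub_one_mul_conj
  rw [one_div, inv_mul_eq_div, div_eq_iff hc.symm.ne_zero]
  linarith

/-- Young's inequality `L^ρ * L^1 ⊆ L^ρ`. -/
theorem lintegral_rpow_lintegral_mul_comp_sub_le {ρ : ℝ} (hρ : 1 ≤ ρ) {k f : ℝ → ℝ≥0∞}
    (hk : Measurable k) (hf : Measurable f) (s : Set ℝ) :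
    ∫⁻ t, (∫⁻ σ in s, k σ * f (t - σ)) ^ ρ ≤ (∫⁻ σ in s, k σ ^ ρ) * (∫⁻ t, f t) ^ ρ := by
  -- Jensen with density f(t-·), whose mass on s is at most ∫ f.
  have h1 : ∀ t, (∫⁻ σ in s, k σ * f (t - σ)) ^ ρ ≤
      (∫⁻ σ in s, k σ ^ ρ * f (t - σ)) * (∫⁻ t, f t) ^ (ρ - 1) := fun t => by
    refine (rpow_lintegral_mul_le _ hρ hk (by fun_prop)).trans ?_
    exact mul_le_mul' le_rfl (ENNReal.rpow_le_rpow ((setLIntegral_le_lintegral _ _).trans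
      (lintegral_sub_left_eq_self f t).le) (by linarith))
  refine (lintegral_mono h1).trans ?_
  rw [lintegral_mul_const _ (measurable_lintegral_mul_comp_sub (hk.pow_const _) hf _),
    lintegral_lintegral_mul_comp_sub (hk.pow_const _) hf, mul_assoc]
  gcongr
  rcases hρ.eq_or_lt with rfl | hρ
  · simp
  conv_lhs => rw [← ENNReal.rpow_one (∫⁻ t, f t), ← ENNReal.rpow_mul, one_mul]
  rw [← ENNReal.rpow_add_of_nonneg _ _ zero_le_one (by linarith)]
  simp

/-- Young's inequality `L^1 * L^p ⊆ L^p`. -/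
theorem lintegral_rpow_lintegral_mul_comp_sub_le' {p : ℝ} (hp : 1 ≤ p) {k f : ℝ → ℝ≥0∞}
    (hk : Measurable k) (hf : Measurable f) (s : Set ℝ) :
    ∫⁻ t, (∫⁻ σ in s, k σ * f (t - σ)) ^ p ≤ (∫⁻ σ in s, k σ) ^ p * ∫⁻ t, f t ^ p := by
  -- Here the kernel k plays the role of the density.
  have h1 : ∀ t, (∫⁻ σ in s, k σ * f (t - σ)) ^ p ≤
      (∫⁻ σ in s, k σ * f (t - σ) ^ p) * (∫⁻ σ in s, k σ) ^ (p - 1) := fun t => by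
    have := rpow_lintegral_mul_le (volume.restrict s) hp (h := fun σ => f (t - σ)) (g := k)
      (by fun_prop) hk
    simpa only [mul_comm] using this
  refine (lintegral_mono h1).trans ?_
  rw [lintegral_mul_const _ (measurable_lintegral_mul_comp_sub hk (hf.pow_const _) _),
    lintegral_lintegral_mul_comp_sub hk (hf.pow_const _), mul_right_comm]
  gcongr
  conv_lhs => rw [← ENNReal.rpow_one (∫⁻ σ in s, k σ), ← ENNReal.rpow_mul, one_mul]
  rw [← ENNReal.rpow_add_of_nonneg _ _ zero_le_one (by linarith)]
  simp

/-- The one-sided fractional integral of order `1 - γ`, without its normalizing constant. -/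
noncomputable def fracInt (γ : ℝ) (f : ℝ → ℝ≥0∞) (t : ℝ) : ℝ≥0∞ :=
  ∫⁻ σ in Ioi (0 : ℝ), ENNReal.ofReal (σ ^ (-γ)) * f (t - σ)

theorem measurable_ofReal_rpow (γ : ℝ) : Measurable fun σ : ℝ => ENNReal.ofReal (σ ^ (-γ)) := by
  fun_prop

theorem measurable_fracInt (γ : ℝ) {f : ℝ → ℝ≥0∞} (hf : Measurable f) : Measurable (fracInt γ f) :=
  measurable_lintegral_mul_comp_sub (measurable_ofReal_rpow γ) hf _

/-- The weak-type estimate for the fractional integral with a truncation adapted to the level. -/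
theorem exists_volume_fracInt_le {γ p r : ℝ} (hp : 1 < p) (hpr : p < r)
    (hγ : 1 - γ = 1 / p - 1 / r) :
    ∃ c : ℝ, 0 < c ∧ ∀ f : ℝ → ℝ≥0∞, Measurable f → ∫⁻ t, f t ^ p ≤ 1 → ∀ l : ℝ, 0 < l →
      volume {t | ENNReal.ofReal (3 * l) < fracInt γ f t} ≤
        (ENNReal.ofReal (c * l ^ (r / p)))⁻¹ *
          ∫⁻ x, {x | ENNReal.ofReal (c * l ^ (r / p)) < f x}.indicator f x := by
  have hp0 : 0 < p := by linarith
  have hr0 : 0 < r := by linarith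
  have hγ1 : γ < 1 := by
    have := one_div_lt_one_div_of_lt hp0 hpr
    linarith
  have hc := Real.HolderConjugate.conjExponent hp
  set p' := p.conjExponent
  have hp'0 : 0 < p' := hc.symm.pos
  have hinv : 1 / p + 1 / p' = 1 := by simpa using hc.inv_add_inv_eq_one
  have hγp' : 1 < γ * p' := by
    have h1 : γ = 1 / p' + 1 / r := by linarith
    rw [h1, add_mul, one_div_mul_cancel hp'0.ne']
    have : 0 < 1 / r * p' := by positivity
    linarith
  set A : ℝ := (1 / (γ * p' - 1)) ^ (1 / p') with hA
  have hA0 : 0 < A := Real.rpow_pos_of_pos (one_div_pos.2 (by linarith)) _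
  have h1γ : 0 < 1 - γ := by linarith
  refine ⟨(1 - γ) * A ^ (-(r * (1 - γ))), by positivity, fun f hf hf1 l hl => ?_⟩
  -- The cut ρ makes the L^{p'} norm of the kernel on (ρ,∞) equal to l, so for ‖f‖_p ≤ 1 the far
  -- part never exceeds l. The height a is l divided by the kernel mass on (0,ρ], so the values of f
  -- below a also contribute at most l.
  set ρ : ℝ := (A / l) ^ r with hρ
  have hρ0 : 0 < ρ := by positivity
  set a : ℝ := (1 - γ) * A ^ (-(r * (1 - γ))) * l ^ (r / p) with ha
  have ha0 : 0 < a := by positivity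
  have hkern : ∫⁻ σ in Ioc 0 ρ, ENNReal.ofReal (σ ^ (-γ)) = ENNReal.ofReal (l / a) := by
    have := lintegral_Ioo_rpow_sub_one h1γ hρ0.le
    rw [restrict_Ioo_eq_restrict_Ioc, show 1 - γ - 1 = -γ by ring] at this
    rw [this]
    congr 1
    rw [ha, hρ, ← Real.rpow_mul (by positivity), Real.div_rpow hA0.le hl.le, Real.rpow_neg hA0.le]
    have e : l ^ (r / p) = l * l ^ (r * (1 - γ)) := by
      rw [← Real.rpow_one_add' hl.le (by positivity)]
      congr 1
      rw [hγ]; field_simp; ring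
    rw [e]
    field_simp
  -- the far part of the kernel
  have far : ∀ t, ∫⁻ σ in Ioi ρ, ENNReal.ofReal (σ ^ (-γ)) * f (t - σ) ≤ ENNReal.ofReal l := by
    intro t
    have h1 := ENNReal.lintegral_mul_le_Lp_mul_Lq (volume.restrict (Ioi ρ)) hc.symm
      (measurable_ofReal_rpow γ).aemeasurable (g := fun σ => f (t - σ)) (by fun_prop)
    simp only [Pi.mul_apply] at h1
    refine h1.trans ?_
    have h2 : ∫⁻ σ in Ioi ρ, f (t - σ) ^ p ≤ 1 :=
      (setLIntegral_le_lintegral _ _).trans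
        ((lintegral_sub_left_eq_self (fun x => f x ^ p) t).le.trans hf1)
    have h3 : ∫⁻ σ in Ioi ρ, ENNReal.ofReal (σ ^ (-γ)) ^ p' =
        ENNReal.ofReal (ρ ^ (1 - γ * p') / (γ * p' - 1)) := by
      rw [← lintegral_Ioi_rpow_of_lt hγp' hρ0]
      refine setLIntegral_congr_fun measurableSet_Ioi fun σ hσ => ?_
      have hσ0 : 0 < σ := hρ0.trans hσ
      change ENNReal.ofReal (σ ^ (-γ)) ^ p' = _
      rw [ENNReal.ofReal_rpow_of_nonneg (by positivity) hp'0.le, ← Real.rpow_mul hσ0.le]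
      congr 2; ring
    have h4 : (∫⁻ σ in Ioi ρ, f (t - σ) ^ p) ^ (1 / p) ≤ 1 := ENNReal.rpow_le_one h2 (by positivity)
    refine (mul_le_mul' le_rfl h4).trans ?_
    rw [mul_one, h3, ENNReal.ofReal_rpow_of_nonneg
      (div_nonneg (by positivity) (by linarith)) (by positivity)]
    refine ENNReal.ofReal_le_ofReal (le_of_eq ?_)
    rw [div_eq_mul_one_div, Real.mul_rpow (by positivity)
      (one_div_nonneg.2 (by linarith)), ← hA, ← Real.rpow_mul hρ0.le, hρ,
      ← Real.rpow_mul (by positivity)]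
    have e : r * ((1 - γ * p') * (1 / p')) = -1 := by
      have h5 : (1 - γ * p') * (1 / p') = 1 / p' - γ := by field_simp
      rw [h5, show 1 / p' - γ = -(1 / r) by linarith]
      field_simp
    rw [e, Real.rpow_neg_one]
    field_simp
  set f₁ : ℝ → ℝ≥0∞ := {x | ENNReal.ofReal a < f x}.indicator f with hf₁
  have hfs : MeasurableSet {x | ENNReal.ofReal a < f x} := measurableSet_lt measurable_const hf
  have hf₁m : Measurable f₁ := hf.indicator hfs
  have hle : ∀ x, f x ≤ f₁ x + ENNReal.ofReal a := by
    intro x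
    by_cases hx : ENNReal.ofReal a < f x
    · have : f₁ x = f x := indicator_of_mem (s := {x | ENNReal.ofReal a < f x}) hx f
      rw [this]; exact le_self_add
    · exact (not_lt.1 hx).trans le_add_self
  have near : ∀ t, ∫⁻ σ in Ioc 0 ρ, ENNReal.ofReal (σ ^ (-γ)) * f (t - σ) ≤
      (∫⁻ σ in Ioc 0 ρ, ENNReal.ofReal (σ ^ (-γ)) * f₁ (t - σ)) + ENNReal.ofReal l := by
    intro t
    calc _ ≤ ∫⁻ σ in Ioc 0 ρ, (ENNReal.ofReal (σ ^ (-γ)) * f₁ (t - σ) +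
          ENNReal.ofReal (σ ^ (-γ)) * ENNReal.ofReal a) := by
          refine lintegral_mono fun σ => ?_
          rw [← mul_add]
          exact mul_le_mul' le_rfl (hle _)
      _ = _ := by
          rw [lintegral_add_left (by fun_prop), lintegral_mul_const _ (measurable_ofReal_rpow γ),
            hkern, ← ENNReal.ofReal_mul (by positivity), div_mul_cancel₀ _ ha0.ne']
  -- Of the three pieces, two are at most l. Above level 3l the near part of f₁, the portion of f
  -- exceeding a, must therefore be at least l, and Chebyshev applies to it.
  have hsub : {t | ENNReal.ofReal (3 * l) < fracInt γ f t} ⊆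
      {t | ENNReal.ofReal l ≤ ∫⁻ σ in Ioc 0 ρ, ENNReal.ofReal (σ ^ (-γ)) * f₁ (t - σ)} := by
    intro t ht
    change ENNReal.ofReal l ≤ _
    by_contra hlt
    rw [not_le] at hlt
    refine absurd (show ENNReal.ofReal (3 * l) < fracInt γ f t from ht) (not_lt.2 ?_)
    rw [fracInt, ← Ioc_union_Ioi_eq_Ioi hρ0.le,
      lintegral_union measurableSet_Ioi Ioc_disjoint_Ioi_same]
    calc _ ≤ (ENNReal.ofReal l + ENNReal.ofReal l) + ENNReal.ofReal l :=
          add_le_add ((near t).trans (add_le_add hlt.le le_rfl)) (far t)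
      _ = _ := by
          rw [← ENNReal.ofReal_add hl.le hl.le, ← ENNReal.ofReal_add (by positivity) hl.le]
          congr 1; ring
  refine (measure_mono hsub).trans ?_
  refine (meas_ge_le_lintegral_div (measurable_lintegral_mul_comp_sub
    (measurable_ofReal_rpow γ) hf₁m _).aemeasurable (by simpa using hl)
    ENNReal.ofReal_ne_top).trans (le_of_eq ?_)
  rw [lintegral_lintegral_mul_comp_sub (measurable_ofReal_rpow γ) hf₁m, hkern,
    ENNReal.ofReal_div_of_pos ha0, mul_comm, mul_div_assoc, mul_comm, ENNReal.div_right_comm,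
    ENNReal.div_self (by simpa using hl) ENNReal.ofReal_ne_top, one_div]

/-- The weak-type bound is integrated against l^{r-1}dl. Since the truncation height is c·l^{r/p},
exchanging integrals leaves at each point f times the integral of l^{s-1} up to (f/c)^{p/r}, with s
= r - r/p. This is a multiple of f·f^{p-1}, so the strong type follows without an interpolation
theorem. -/
theorem exists_lintegral_fracInt_le_of_le_one {γ p r : ℝ} (hp : 1 < p) (hpr : p < r)
    (hγ : 1 - γ = 1 / p - 1 / r) :
    ∃ C : ℝ≥0, ∀ f : ℝ → ℝ≥0∞, Measurable f → ∫⁻ t, f t ^ p ≤ 1 →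
      ∫⁻ t, fracInt γ f t ^ r ≤ C := by
  obtain ⟨c, hc, H⟩ := exists_volume_fracInt_le hp hpr hγ
  have hp0 : 0 < p := by linarith
  have hr0 : 0 < r := by linarith
  set α := r / p with hα
  have hα0 : 0 < α := by positivity
  set s := r - α with hs
  have hs0 : 0 < s := by
    have : α < r := div_lt_self hr0 hp
    linarith
  set D : ℝ≥0∞ := ENNReal.ofReal r * ENNReal.ofReal 3 ^ r * (ENNReal.ofReal c)⁻¹ *
    (((ENNReal.ofReal c)⁻¹) ^ (p - 1) / ENNReal.ofReal s) with hD
  have hcinv : (ENNReal.ofReal c)⁻¹ ≠ ⊤ := by simpa using hc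
  have hDtop : D ≠ ⊤ := by
    refine ENNReal.mul_ne_top (ENNReal.mul_ne_top (ENNReal.mul_ne_top ENNReal.ofReal_ne_top
      (ENNReal.rpow_ne_top_of_nonneg hr0.le ENNReal.ofReal_ne_top)) hcinv)
      (ENNReal.div_ne_top (ENNReal.rpow_ne_top_of_nonneg (by linarith) hcinv) ?_)
    simpa using hs0
  refine ⟨D.toNNReal, fun f hf hf1 => ?_⟩
  rw [ENNReal.coe_toNNReal hDtop]
  set I := fracInt γ f with hI
  have hIm : Measurable I := measurable_fracInt γ hf
  set J : ℝ → ℝ≥0∞ := fun t => I t / ENNReal.ofReal 3 with hJ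
  have hJm : Measurable J := hIm.div_const _
  have h3 : ENNReal.ofReal 3 ≠ 0 := by simp
  have e1 : ∀ t, I t ^ r = ENNReal.ofReal r * ENNReal.ofReal 3 ^ r *
      ∫⁻ l in Ioi (0 : ℝ), {l : ℝ | ENNReal.ofReal l < J t}.indicator
        (fun l => ENNReal.ofReal (l ^ (r - 1))) l := by
    intro t
    rw [lintegral_indicator_rpow_sub_one hr0, mul_right_comm, ENNReal.mul_div_cancel
      (by simpa using hr0) ENNReal.ofReal_ne_top, hJ, ← ENNReal.mul_rpow_of_nonneg _ _ hr0.le,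
      ENNReal.div_mul_cancel h3 ENNReal.ofReal_ne_top]
  have hset1 : MeasurableSet {q : ℝ × ℝ | ENNReal.ofReal q.2 < J q.1} :=
    measurableSet_lt (by fun_prop) (by fun_prop)
  have hmeas1 : Measurable (Function.uncurry fun t l : ℝ =>
      {l : ℝ | ENNReal.ofReal l < J t}.indicator (fun l => ENNReal.ofReal (l ^ (r - 1))) l) :=
    (show Measurable fun q : ℝ × ℝ => ENNReal.ofReal (q.2 ^ (r - 1)) by fun_prop).indicator hset1
  have hset2 : MeasurableSet {q : ℝ × ℝ | ENNReal.ofReal (c * q.1 ^ α) < f q.2} :=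
    measurableSet_lt (by fun_prop) (by fun_prop)
  have hmeas2 : Measurable (Function.uncurry fun l x : ℝ => ENNReal.ofReal (l ^ (s - 1)) *
      {x | ENNReal.ofReal (c * l ^ α) < f x}.indicator f x) :=
    (show Measurable fun q : ℝ × ℝ => ENNReal.ofReal (q.1 ^ (s - 1)) by fun_prop).mul
      ((show Measurable fun q : ℝ × ℝ => f q.2 by fun_prop).indicator hset2)
  simp_rw [e1]
  rw [lintegral_const_mul _ hmeas1.lintegral_prod_right, lintegral_lintegral_swap hmeas1.aemeasurable]
  have e2 : ∀ l ∈ Ioi (0 : ℝ), ∫⁻ t, {l : ℝ | ENNReal.ofReal l < J t}.indicator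
        (fun l => ENNReal.ofReal (l ^ (r - 1))) l ≤ (ENNReal.ofReal c)⁻¹ *
        ∫⁻ x, ENNReal.ofReal (l ^ (s - 1)) *
          {x | ENNReal.ofReal (c * l ^ α) < f x}.indicator f x := by
    intro l hl
    have hl0 : (0 : ℝ) < l := hl
    have hms : MeasurableSet {t | ENNReal.ofReal l < J t} := measurableSet_lt (by fun_prop) hJm
    have h1 : ∫⁻ t, {l : ℝ | ENNReal.ofReal l < J t}.indicator
        (fun l => ENNReal.ofReal (l ^ (r - 1))) l =
        ∫⁻ t, {t | ENNReal.ofReal l < J t}.indicator (fun _ => ENNReal.ofReal (l ^ (r - 1))) t :=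
      rfl
    have h2 : {t | ENNReal.ofReal l < J t} = {t | ENNReal.ofReal (3 * l) < I t} := by
      ext t
      change ENNReal.ofReal l < I t / ENNReal.ofReal 3 ↔ ENNReal.ofReal (3 * l) < I t
      rw [ENNReal.lt_div_iff_mul_lt (Or.inl h3) (Or.inl ENNReal.ofReal_ne_top),
        ← ENNReal.ofReal_mul hl0.le, mul_comm]
    rw [h1, lintegral_indicator_const hms, h2]
    refine (mul_le_mul' le_rfl (H f hf hf1 l hl0)).trans (le_of_eq ?_)
    rw [← mul_assoc, lintegral_const_mul _ (hf.indicator (measurableSet_lt measurable_const hf)),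
      ← mul_assoc]
    congr 1
    rw [ENNReal.ofReal_mul hc.le, ENNReal.mul_inv (Or.inr ENNReal.ofReal_ne_top)
      (Or.inl ENNReal.ofReal_ne_top), ← mul_assoc, mul_comm (ENNReal.ofReal (l ^ (r - 1))),
      mul_assoc, ← ENNReal.ofReal_inv_of_pos (Real.rpow_pos_of_pos hl0 α),
      ← ENNReal.ofReal_mul (by positivity), ← Real.rpow_neg hl0.le, ← Real.rpow_add hl0]
    congr 3
    rw [hs]; ring
  refine (mul_le_mul' le_rfl (setLIntegral_mono' measurableSet_Ioi e2)).trans ?_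
  rw [lintegral_const_mul _ hmeas2.lintegral_prod_right,
    lintegral_lintegral_swap hmeas2.aemeasurable]
  have e3 : ∀ x, ∫⁻ l in Ioi (0 : ℝ), ENNReal.ofReal (l ^ (s - 1)) *
      {x | ENNReal.ofReal (c * l ^ α) < f x}.indicator f x =
      (((ENNReal.ofReal c)⁻¹) ^ (p - 1) / ENNReal.ofReal s) * f x ^ p := by
    intro x
    set b : ℝ≥0∞ := (f x / ENNReal.ofReal c) ^ (1 / α) with hb
    have h1 : ∀ l ∈ Ioi (0 : ℝ), ENNReal.ofReal (l ^ (s - 1)) *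
        {x | ENNReal.ofReal (c * l ^ α) < f x}.indicator f x =
        {l : ℝ | ENNReal.ofReal l < b}.indicator
          (fun l => ENNReal.ofReal (l ^ (s - 1))) l * f x := by
      intro l hl
      have hl0 : (0 : ℝ) < l := hl
      have hiff : ENNReal.ofReal (c * l ^ α) < f x ↔ ENNReal.ofReal l < b := by
        rw [hb, one_div, ENNReal.lt_rpow_inv_iff hα0, ENNReal.lt_div_iff_mul_lt
          (Or.inl (by simpa using hc)) (Or.inl ENNReal.ofReal_ne_top),
          ENNReal.ofReal_rpow_of_nonneg hl0.le hα0.le, ← ENNReal.ofReal_mul (by positivity),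
          mul_comm]
      by_cases hx : ENNReal.ofReal (c * l ^ α) < f x
      · rw [indicator_of_mem (s := {x | ENNReal.ofReal (c * l ^ α) < f x}) hx,
          indicator_of_mem (s := {l : ℝ | ENNReal.ofReal l < b}) (hiff.1 hx)]
      · rw [indicator_of_notMem (s := {x | ENNReal.ofReal (c * l ^ α) < f x}) hx,
          indicator_of_notMem (s := {l : ℝ | ENNReal.ofReal l < b}) (fun h => hx (hiff.2 h)),
          mul_zero, zero_mul]
    rw [setLIntegral_congr_fun measurableSet_Ioi h1, lintegral_mul_const _
      ((show Measurable fun l : ℝ => ENNReal.ofReal (l ^ (s - 1)) by fun_prop).indicator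
        (measurableSet_lt (by fun_prop) measurable_const)), lintegral_indicator_rpow_sub_one hs0, hb,
      ← ENNReal.rpow_mul]
    have e : 1 / α * s = p - 1 := by
      rw [hs, hα]; field_simp
    rw [e, div_eq_mul_inv (f x), ENNReal.mul_rpow_of_nonneg _ _ (by linarith : 0 ≤ p - 1),
      div_eq_mul_inv, div_eq_mul_inv]
    have e' : f x ^ p = f x ^ (p - 1) * f x := by
      conv_rhs => rw [← ENNReal.rpow_one (f x), ← ENNReal.rpow_mul, one_mul]
      rw [← ENNReal.rpow_add_of_nonneg _ _ (by linarith) zero_le_one]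
      simp
    rw [e']
    ring
  simp_rw [e3]
  rw [lintegral_const_mul _ (hf.pow_const _), ← mul_assoc, ← mul_assoc, ← hD]
  exact (mul_le_mul' le_rfl hf1).trans (mul_one D).le

/-- The Hardy-Littlewood-Sobolev inequality on the line. -/
theorem exists_lintegral_fracInt_le {γ p r : ℝ} (hp : 1 < p) (hpr : p < r)
    (hγ : 1 - γ = 1 / p - 1 / r) :
    ∃ C : ℝ≥0, ∀ f : ℝ → ℝ≥0∞, Measurable f → ∫⁻ t, f t ^ p ≠ ⊤ →
      ∫⁻ t, fracInt γ f t ^ r ≤ C * (∫⁻ t, f t ^ p) ^ (r / p) := by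
  obtain ⟨C, H⟩ := exists_lintegral_fracInt_le_of_le_one hp hpr hγ
  have hp0 : 0 < p := by linarith
  have hr0 : 0 < r := by linarith
  refine ⟨C, fun f hf hft => ?_⟩
  set N := ∫⁻ t, f t ^ p with hN
  by_cases h0 : N = 0
  · have h1 : f =ᵐ[volume] 0 := by
      have := (lintegral_eq_zero_iff (hf.pow_const p)).1 h0
      filter_upwards [this] with t ht
      simpa [hp0, hp0.le, hp0.not_gt] using ht
    have h2 : ∀ t, fracInt γ f t = 0 := by
      intro t
      have := (quasiMeasurePreserving_sub_left_of_right_invariant volume t).ae_eq_comp h1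
      have h3 : fracInt γ f t = ∫⁻ σ in Ioi (0 : ℝ), 0 := by
        refine lintegral_congr_ae (ae_restrict_of_ae ?_)
        filter_upwards [this] with σ hσ
        have : f (t - σ) = 0 := hσ
        rw [this, mul_zero]
      simpa using h3
    simp [h2, hr0]
  -- Homogeneity: f is divided by its L^p norm m.
  set m : ℝ≥0∞ := N ^ (1 / p) with hm
  have hm0 : m ≠ 0 := by simp [hm, h0, hft]
  have hmt : m ≠ ⊤ := ENNReal.rpow_ne_top_of_nonneg (by positivity) hft
  have h1 := H (fun t => m⁻¹ * f t) (by fun_prop) (by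
    simp_rw [ENNReal.mul_rpow_of_nonneg _ _ hp0.le]
    rw [lintegral_const_mul _ (hf.pow_const p), ← hN, ENNReal.inv_rpow, hm, ← ENNReal.rpow_mul,
      one_div_mul_cancel hp0.ne', ENNReal.rpow_one, ENNReal.inv_mul_cancel h0 hft])
  have h2 : ∀ t, fracInt γ (fun t => m⁻¹ * f t) t = m⁻¹ * fracInt γ f t := by
    intro t
    rw [fracInt, fracInt, ← lintegral_const_mul _ (by fun_prop)]
    exact lintegral_congr fun σ => by ring
  simp_rw [h2, ENNReal.mul_rpow_of_nonneg _ _ hr0.le] at h1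
  rw [lintegral_const_mul _ ((measurable_fracInt γ hf).pow_const r)] at h1
  have h3 : m ^ r = N ^ (r / p) := by
    rw [hm, ← ENNReal.rpow_mul]; congr 1; ring
  rw [← h3]
  calc _ = (m ^ r) * (m⁻¹ ^ r * ∫⁻ t, fracInt γ f t ^ r) := by
        rw [← mul_assoc, ENNReal.inv_rpow, ENNReal.mul_inv_cancel, one_mul]
        · simp [hm0, hmt]
        · simp [hm0, hmt]
    _ ≤ m ^ r * C := mul_le_mul' le_rfl h1
    _ = _ := mul_comm _ _

/-- Douglas' range inclusion lemma for a single vector. -/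
theorem exists_apply_eq_of_norm_inner_le {E : Type*} [NormedAddCommGroup E]
    [InnerProductSpace ℂ E] [CompleteSpace E] (Q : E →L[ℂ] E) (z : E) {c : ℝ} (hc : 0 ≤ c)
    (h : ∀ x, ‖inner ℂ x z‖ ≤ c * ‖Q.adjoint x‖) : ∃ w, ‖w‖ ≤ c ∧ Q w = z := by
  set V := LinearMap.range (Q.adjoint : E →ₗ[ℂ] E) with hV
  choose g hg using fun y : V => y.2
  have hg' : ∀ y : V, Q.adjoint (g y) = y := hg
  have key : ∀ x x' : E, Q.adjoint x = Q.adjoint x' → inner ℂ z x = inner ℂ z x' := by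
    intro x x' hx
    have h1 := h (x - x')
    rw [map_sub, hx, sub_self, norm_zero, mul_zero] at h1
    have h2 := norm_le_zero_iff.1 h1
    rw [← sub_eq_zero, ← inner_sub_right, ← inner_conj_symm, h2, map_zero]
  -- The functional Q*x ↦ (z,x) is well defined and bounded by c thanks to the hypothesis. Its
  -- Hahn-Banach extension is represented by w, and (w,Q*x) = (z,x) says Qw = z.
  let l : V →ₗ[ℂ] ℂ :=
    { toFun := fun y => inner ℂ z (g y)
      map_add' := fun x y => by
        rw [← inner_add_right]
        exact key _ _ (by rw [map_add, hg', hg', hg']; rfl)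
      map_smul' := fun a x => by
        rw [RingHom.id_apply, smul_eq_mul, ← inner_smul_right]
        exact key _ _ (by rw [map_smul, hg', hg']; rfl) }
  have hl : ∀ y : V, ‖l y‖ ≤ c * ‖y‖ := fun y => by
    change ‖inner ℂ z (g y)‖ ≤ _
    rw [norm_inner_symm]
    refine (h (g y)).trans (le_of_eq ?_)
    rw [hg']; rfl
  obtain ⟨f, hf, hfn⟩ := exists_extension_norm_eq V (l.mkContinuous c hl)
  refine ⟨(InnerProductSpace.toDual ℂ E).symm f, ?_, ?_⟩
  · rw [LinearIsometryEquiv.norm_map, hfn]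
    exact l.mkContinuous_norm_le hc _
  · refine ext_inner_right ℂ fun x => ?_
    rw [← ContinuousLinearMap.adjoint_inner_right, InnerProductSpace.toDual_symm_apply]
    have h1 := hf ⟨Q.adjoint x, ⟨x, rfl⟩⟩
    refine h1.trans ?_
    exact key _ _ (hg' _)

theorem exists_nat_mem_Ioc {a τ σ : ℝ} (hτ : 0 < τ) (hσ : a < σ) :
    ∃ n : ℕ, σ ∈ Ioc (a + n * τ) (a + (n + 1) * τ) := by
  have h0 : 0 < (σ - a) / τ := div_pos (by linarith) hτ
  have h1 : 0 < ⌈(σ - a) / τ⌉₊ := Nat.ceil_pos.2 h0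
  refine ⟨⌈(σ - a) / τ⌉₊ - 1, ?_, ?_⟩ <;> rw [Nat.cast_sub (by omega), Nat.cast_one]
  · have := (lt_div_iff₀ hτ).1 (sub_lt_iff_lt_add.2 (Nat.ceil_lt_add_one h0.le))
    linarith
  · have := (div_le_iff₀ hτ).1 (Nat.le_ceil ((σ - a) / τ))
    linarith

/-! ### Regularized states and observations: duality, measurable preimages, decay. -/

namespace StableSemigroup

variable {Y U : Type*} [NormedAddCommGroup Y] [InnerProductSpace ℂ Y]
  [NormedAddCommGroup U] [InnerProductSpace ℂ U] (S : StableSemigroup Y)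

/-- The state `∫₀^∞ S(σ) D u(σ) dσ` reached from the input history `u`. -/
noncomputable def mild (D : U →L[ℂ] Y) (u : ℝ → U) : Y :=
  ∫ σ in Ioi (0 : ℝ), S σ.toNNReal (D (u σ))

theorem continuous_mildKernel (D : U →L[ℂ] Y) :
    Continuous fun p : ℝ × U => S p.1.toNNReal (D p.2) :=
  S.continuous_uncurry.comp ((continuous_real_toNNReal.comp continuous_fst).prodMk
    (D.continuous.comp continuous_snd))

section Complete

variable [CompleteSpace Y] [CompleteSpace U]

omit [CompleteSpace U] in
theorem map_mild (D : U →L[ℂ] Y) (R : Y →L[ℂ] Y) (hR : ∀ t x, S t (R x) = R (S t x)) (u : ℝ → U)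
    (hu : IntegrableOn (fun σ => S σ.toNNReal (D (u σ))) (Ioi 0)) :
    S.mild (R ∘L D) u = R (S.mild D u) := by
  rw [mild, mild, ← R.integral_comp_comm hu]
  simp [hR]

/-- Adjoints move e^{Aσ}K* onto x, so estimates for the state become estimates for the observation K
e^{A*σ}x. If the integrand is not integrable, the state is zero by convention and the bound is
trivial. -/
theorem enorm_inner_mild_le (K : Y →L[ℂ] U) (u : ℝ → U) (x : Y) :
    ‖inner ℂ x (S.mild K.adjoint u)‖ₑ ≤
      ∫⁻ σ in Ioi (0 : ℝ), ‖u σ‖ₑ * ‖K (S.adjointSemigroup σ.toNNReal x)‖ₑ := by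
  by_cases hi : IntegrableOn (fun σ => S σ.toNNReal (K.adjoint (u σ))) (Ioi 0)
  · rw [mild, ← integral_inner hi]
    refine (enorm_integral_le_lintegral_enorm _).trans (lintegral_mono fun σ => ?_)
    have e : inner ℂ x (S σ.toNNReal (K.adjoint (u σ))) =
        inner ℂ (K (S.adjointSemigroup σ.toNNReal x)) (u σ) := by
      rw [adjointSemigroup_apply, ← ContinuousLinearMap.adjoint_inner_left,
        ContinuousLinearMap.adjoint_inner_right]
    simp only [e]
    rw [mul_comm]
    simp only [← ofReal_norm]
    rw [← ENNReal.ofReal_mul (norm_nonneg _)]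
    exact ENNReal.ofReal_le_ofReal (norm_inner_le_norm _ _)
  · rw [mild, integral_undef hi]
    simp

/-- If `ζ` takes values in the domain of the generator, then its preimage under `(-A)⁻¹` is a
limit of difference quotients, hence measurable. -/
theorem exists_measurable_preimage {α : Type*} [MeasurableSpace α] (ζ : α → Y)
    (hζ : StronglyMeasurable ζ) (c : α → ℝ≥0∞) (hc : Measurable c)
    (h : ∀ t x, ‖inner ℂ x (ζ t)‖ₑ ≤ c t * ‖(S.negPow 1 one_pos).adjoint x‖ₑ) :
    ∃ w : α → Y, StronglyMeasurable w ∧ (∀ t, c t ≠ ⊤ → S.negPow 1 one_pos (w t) = ζ t) ∧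
      ∀ t, ‖w t‖ₑ ≤ c t := by
  have h1 : ∀ t, c t ≠ ⊤ → ∃ w, ‖w‖ₑ ≤ c t ∧ S.negPow 1 one_pos w = ζ t := by
    intro t ht
    obtain ⟨w, hw, hw'⟩ := exists_apply_eq_of_norm_inner_le (S.negPow 1 one_pos) (ζ t)
      (c := (c t).toReal) ENNReal.toReal_nonneg (fun x => by
        have := ENNReal.toReal_mono (ENNReal.mul_ne_top ht enorm_ne_top) (h t x)
        rwa [ENNReal.toReal_mul, toReal_enorm, toReal_enorm] at this)
    refine ⟨w, ?_, hw'⟩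
    rw [← ofReal_norm, ← ENNReal.ofReal_toReal ht]
    exact ENNReal.ofReal_le_ofReal hw
  -- Where c is infinite the value 0 is prescribed, so that w is everywhere the limit of the
  -- difference quotients cut off to the measurable set {c ≠ ∞}.
  have h2 : ∀ t, ∃ w, ‖w‖ₑ ≤ c t ∧ (c t ≠ ⊤ → S.negPow 1 one_pos w = ζ t) ∧
      (c t = ⊤ → w = 0) := by
    intro t
    by_cases ht : c t = ⊤
    · exact ⟨0, by simp, fun h => absurd ht h, fun _ => rfl⟩
    · obtain ⟨w, hw, hw'⟩ := h1 t ht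
      exact ⟨w, hw, fun _ => hw', fun h => absurd h ht⟩
  choose w hw1 hw2 hw3 using h2
  refine ⟨w, ?_, hw2, hw1⟩
  obtain ⟨θ, -, hθpos, hθlim⟩ := exists_seq_strictAnti_tendsto (0 : ℝ≥0)
  replace hθlim : Tendsto θ atTop (𝓝[>] 0) :=
    tendsto_nhdsWithin_iff.2 ⟨hθlim, Eventually.of_forall hθpos⟩
  refine stronglyMeasurable_of_tendsto atTop
    (f := fun n => {t | c t ≠ ⊤}.indicator
      fun t => -(((θ n : ℝ)⁻¹ : ℝ) • (S (θ n) (ζ t) - ζ t))) (fun n => ?_) ?_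
  · refine StronglyMeasurable.indicator ?_ (hc (measurableSet_singleton ⊤).compl)
    exact ((((S (θ n)).continuous.comp_stronglyMeasurable hζ).sub hζ).const_smul _).neg
  · rw [tendsto_pi_nhds]
    intro t
    by_cases ht : c t = ⊤
    · have : ∀ n, {t | c t ≠ ⊤}.indicator
          (fun t => -(((θ n : ℝ)⁻¹ : ℝ) • (S (θ n) (ζ t) - ζ t))) t = 0 := fun n =>
        indicator_of_notMem (s := {t | c t ≠ ⊤}) (fun h : c t ≠ ⊤ => h ht) _
      simp only [this, hw3 t ht]
      exact tendsto_const_nhds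
    · have : ∀ n, {t | c t ≠ ⊤}.indicator
          (fun t => -(((θ n : ℝ)⁻¹ : ℝ) • (S (θ n) (ζ t) - ζ t))) t =
          -(((θ n : ℝ)⁻¹ : ℝ) • (S (θ n) (ζ t) - ζ t)) := fun n =>
        indicator_of_mem (s := {t | c t ≠ ⊤}) ht _
      simp only [this]
      have := ((S.tendsto_negPow_one (w t)).comp hθlim).neg
      rw [hw2 t ht, neg_neg] at this
      exact this

/-! #### Propagating bounds along the semigroup -/

variable {S}

/-- Q* commutes with the adjoint semigroup, so the decay holds in the possibly weaker seminorm
‖Q*x‖. This is what lets local bounds by ‖Q*x‖ propagate. -/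
theorem exists_adjoint_decay (Q : Y →L[ℂ] Y) (hQ : ∀ t x, S t (Q x) = Q (S t x)) :
    ∃ M ω : ℝ, 0 < ω ∧ 0 < M ∧ ∀ (t : ℝ≥0) (x : Y), ‖Q.adjoint (S.adjointSemigroup t x)‖ₑ ≤
      ENNReal.ofReal (M * Real.exp (-ω * t)) * ‖Q.adjoint x‖ₑ := by
  obtain ⟨M, ω, hω, hM⟩ := S.stable'
  refine ⟨|M| + 1, ω, hω, by positivity, fun t x => ?_⟩
  have e : Q.adjoint (S.adjointSemigroup t x) = (S t).adjoint (Q.adjoint x) := by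
    have : Q ∘L S t = S t ∘L Q := ContinuousLinearMap.ext fun x => (hQ t x).symm
    have := congrArg ContinuousLinearMap.adjoint this
    rw [ContinuousLinearMap.adjoint_comp, ContinuousLinearMap.adjoint_comp] at this
    exact (DFunLike.congr_fun this x).symm
  rw [e, ← ofReal_norm, ← ofReal_norm, ← ENNReal.ofReal_mul (by positivity)]
  refine ENNReal.ofReal_le_ofReal (ContinuousLinearMap.le_of_opNorm_le _ ?_ _)
  rw [LinearIsometryEquiv.norm_map]
  refine (hM t).trans ?_
  gcongr
  exact (le_abs_self M).trans (by linarith)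

theorem adjointSemigroup_toNNReal_add {σ t : ℝ} (hσ : 0 ≤ σ) (ht : 0 ≤ t) (x : Y) :
    S.adjointSemigroup (σ + t).toNNReal x =
      S.adjointSemigroup σ.toNNReal (S.adjointSemigroup t.toNNReal x) := by
  rw [Real.toNNReal_add hσ ht, apply_add]

omit [CompleteSpace U] in
theorem exists_pointwise_decay (K : Y →L[ℂ] U) (Q : Y →L[ℂ] Y)
    (hQ : ∀ t x, S t (Q x) = Q (S t x)) {a τ : ℝ} (ha : 0 ≤ a) (hτ : 0 < τ) (C : ℝ≥0)
    (hC : ∀ σ ∈ Ioc a (a + τ), ∀ x,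
      ‖K (S.adjointSemigroup σ.toNNReal x)‖ₑ ≤ C * ‖Q.adjoint x‖ₑ) :
    ∃ δ : ℝ, 0 < δ ∧ ∃ C' : ℝ, 0 ≤ C' ∧ ∀ σ, a < σ → ∀ x,
      ‖K (S.adjointSemigroup σ.toNNReal x)‖ₑ ≤
        ENNReal.ofReal (C' * Real.exp (-δ * σ)) * ‖Q.adjoint x‖ₑ := by
  obtain ⟨M, ω, hω, hM0, hM⟩ := exists_adjoint_decay Q hQ
  -- A time σ is moved back by a multiple nτ into the first window, where C applies. Since σ - nτ ≤
  -- a + τ, the factor e^{-ωnτ} is at most e^{ω(a+τ)}e^{-ωσ}.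
  refine ⟨ω, hω, C * (M * Real.exp (ω * (a + τ))), by positivity, fun σ hσ x => ?_⟩
  obtain ⟨n, hn⟩ := exists_nat_mem_Ioc hτ hσ
  have h1 : σ - n * τ ∈ Ioc a (a + τ) := ⟨by linarith [hn.1], by linarith [hn.2]⟩
  have hnτ : 0 ≤ n * τ := by positivity
  have e := adjointSemigroup_toNNReal_add (S := S) (ha.trans h1.1.le) hnτ x
  rw [sub_add_cancel] at e
  rw [e]
  refine (hC _ h1 _).trans ((mul_le_mul' le_rfl (hM _ x)).trans ?_)
  rw [← mul_assoc, ← ENNReal.ofReal_coe_nnreal, ← ENNReal.ofReal_mul (by positivity)]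
  gcongr ENNReal.ofReal ?_ * _
  rw [mul_assoc, mul_assoc, ← Real.exp_add]
  gcongr
  rw [Real.coe_toNNReal _ hnτ]
  nlinarith [hn.2]

-- The half-line is cut into windows of length τ. On the n-th one the observation of x is that of
-- e^{A*nτ}x on the first, which is smaller by e^{-ωnτ}. The weight of rate δ = ω/2 uses up half of
-- this decay, and the rest makes the sum of the s-th powers geometric with ratio e^{-sδτ}.
omit [CompleteSpace U] in
theorem exists_lintegral_decay (K : Y →L[ℂ] U) (Q : Y →L[ℂ] Y)
    (hQ : ∀ t x, S t (Q x) = Q (S t x)) {a τ s : ℝ} (ha : 0 ≤ a) (hτ : 0 < τ) (hs : 0 < s)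
    (C : ℝ≥0)
    (hC : ∀ x, ∫⁻ σ in Ioc a (a + τ), ‖K (S.adjointSemigroup σ.toNNReal x)‖ₑ ^ s ≤
      C * ‖Q.adjoint x‖ₑ ^ s) :
    ∃ δ : ℝ, 0 < δ ∧ ∃ C' : ℝ≥0, ∀ x,
      ∫⁻ σ in Ioi a, (ENNReal.ofReal (Real.exp (δ * σ)) *
        ‖K (S.adjointSemigroup σ.toNNReal x)‖ₑ) ^ s ≤ C' * ‖Q.adjoint x‖ₑ ^ s := by
  obtain ⟨M, ω, hω, hM0, hM⟩ := exists_adjoint_decay Q hQ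
  set δ := ω / 2 with hδ
  have hδ0 : 0 < δ := by positivity
  set θ : ℝ := Real.exp (-(s * δ * τ)) with hθ
  have hθ1 : θ < 1 := Real.exp_lt_one_iff.2 (neg_neg_of_pos (by positivity))
  set B : ℝ := (Real.exp (δ * (a + τ)) * M) ^ s with hB
  have hB0 : 0 ≤ B := by positivity
  have hsum : ∑' n : ℕ, ENNReal.ofReal (B * θ ^ n) * C ≠ ⊤ := by
    rw [ENNReal.tsum_mul_right]
    refine ENNReal.mul_ne_top ?_ ENNReal.coe_ne_top
    exact ((summable_geometric_of_lt_one (Real.exp_pos _).le hθ1).mul_left B).tsum_ofReal_ne_top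
  refine ⟨δ, hδ0, (∑' n : ℕ, ENNReal.ofReal (B * θ ^ n) * C).toNNReal, fun x => ?_⟩
  rw [ENNReal.coe_toNNReal hsum]
  set Φ : ℝ → Y → ℝ≥0∞ := fun σ x => ‖K (S.adjointSemigroup σ.toNNReal x)‖ₑ with hΦ
  have hsub : Ioi a ⊆ ⋃ n : ℕ, Ioc (a + n * τ) (a + (n + 1) * τ) := fun σ hσ =>
    mem_iUnion.2 (exists_nat_mem_Ioc hτ hσ)
  refine (lintegral_mono_set hsub).trans ((lintegral_iUnion_le _ _).trans ?_)
  rw [← ENNReal.tsum_mul_right]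
  refine ENNReal.tsum_le_tsum fun n => ?_
  have hnτ : 0 ≤ n * τ := by positivity
  set t : ℝ≥0 := (n * τ).toNNReal with ht
  have htc : (t : ℝ) = n * τ := Real.coe_toNNReal _ hnτ
  have h1 : ∫⁻ σ in Ioc (a + n * τ) (a + (n + 1) * τ),
      (ENNReal.ofReal (Real.exp (δ * σ)) * Φ σ x) ^ s ≤
      ENNReal.ofReal (Real.exp (δ * (a + (n + 1) * τ))) ^ s *
        ∫⁻ σ in Ioc (a + n * τ) (a + (n + 1) * τ), Φ σ x ^ s := by
    have hfin : ENNReal.ofReal (Real.exp (δ * (a + (n + 1) * τ))) ^ s ≠ ⊤ :=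
      ENNReal.rpow_ne_top_of_nonneg hs.le ENNReal.ofReal_ne_top
    rw [← lintegral_const_mul' _ _ hfin]
    refine setLIntegral_mono' measurableSet_Ioc fun σ hσ => ?_
    rw [← ENNReal.mul_rpow_of_nonneg _ _ hs.le]
    gcongr
    exact hσ.2
  have h2 : ∫⁻ σ in Ioc (a + n * τ) (a + (n + 1) * τ), Φ σ x ^ s =
      ∫⁻ σ in Ioc a (a + τ), Φ σ (S.adjointSemigroup t x) ^ s := by
    have hmp := (measurePreserving_add_right volume (n * τ : ℝ)).setLIntegral_comp_preimage_emb
      (measurableEmbedding_addRight (n * τ : ℝ)) (fun σ => Φ σ x ^ s)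
      (Ioc (a + n * τ) (a + (n + 1) * τ))
    rw [← hmp]
    have e : (fun σ : ℝ => σ + n * τ) ⁻¹' Ioc (a + n * τ) (a + (n + 1) * τ) = Ioc a (a + τ) := by
      ext σ
      simp only [mem_preimage, mem_Ioc]
      constructor <;> rintro ⟨h1, h2⟩ <;> constructor <;> linarith
    rw [e]
    refine setLIntegral_congr_fun measurableSet_Ioc fun σ hσ => ?_
    simp only [hΦ, adjointSemigroup_toNNReal_add (ha.trans hσ.1.le) hnτ x, ht]
  refine h1.trans ?_
  rw [h2]
  have h3 := (hC (S.adjointSemigroup t x)).trans (mul_le_mul' le_rfl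
    (ENNReal.rpow_le_rpow (hM t x) hs.le))
  refine (mul_le_mul' le_rfl h3).trans (le_of_eq ?_)
  rw [ENNReal.mul_rpow_of_nonneg _ _ hs.le, ENNReal.ofReal_rpow_of_nonneg (by positivity) hs.le,
    ENNReal.ofReal_rpow_of_nonneg (by positivity) hs.le]
  have e : B * θ ^ n = Real.exp (δ * (a + (n + 1) * τ)) ^ s * (M * Real.exp (-ω * t)) ^ s := by
    rw [hB, ← Real.mul_rpow (by positivity) (by positivity), hθ, ← Real.exp_nat_mul,
      show (n : ℝ) * -(s * δ * τ) = (-(n * δ * τ)) * s by ring, Real.exp_mul (-(n * δ * τ)) s,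
      ← Real.mul_rpow (by positivity) (by positivity), htc]
    congr 1
    rw [mul_comm _ M, mul_left_comm _ M, mul_assoc, ← Real.exp_add, ← Real.exp_add]
    congr 2
    rw [hδ]; ring
  rw [e, ENNReal.ofReal_mul (by positivity)]
  ring

end Complete
end StableSemigroup

/-! ### Exponential weights and translations in L^p. -/

theorem memLp_exp_neg {δ : ℝ} (hδ : 0 < δ) {q : ℝ≥0∞} (hq : q ≠ 0) :
    MemLp (fun σ : ℝ => Real.exp (-δ * σ)) q (volume.restrict (Ioi 0)) := by
  have hm : AEStronglyMeasurable (fun σ : ℝ => Real.exp (-δ * σ)) (volume.restrict (Ioi 0)) := by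
    fun_prop
  by_cases hq' : q = ⊤
  · rw [hq']
    refine memLp_top_of_bound hm 1 ((ae_restrict_iff' measurableSet_Ioi).2
      (Eventually.of_forall fun σ hσ => ?_))
    have hσ0 : (0 : ℝ) < σ := hσ
    rw [Real.norm_eq_abs, Real.abs_exp, Real.exp_le_one_iff]
    nlinarith
  · rw [← integrable_norm_rpow_iff hm hq hq']
    have hq0 : 0 < q.toReal := ENNReal.toReal_pos hq hq'
    refine (integrableOn_exp_mul_Ioi (a := -(δ * q.toReal)) (by nlinarith) 0).congr_fun
      (fun σ _ => ?_) measurableSet_Ioi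
    simp only [Real.norm_eq_abs, Real.abs_exp, ← Real.exp_mul]
    congr 1; ring

/-- An exponentially weighted `L^s` norm on the half-line is controlled by every `L^p` norm,
`p ≥ s`. -/
theorem exists_lintegral_exp_weight_le {U : Type*} [NormedAddCommGroup U] [NormedSpace ℝ U]
    {δ s : ℝ} (hδ : 0 < δ) (hs : 0 < s) {p : ℝ≥0∞} (hp : ENNReal.ofReal s ≤ p) :
    ∃ A : ℝ≥0, ∀ u : ℝ → U, AEStronglyMeasurable u (volume.restrict (Ioi 0)) →
      (∫⁻ σ in Ioi (0 : ℝ), (ENNReal.ofReal (Real.exp (-δ * σ)) * ‖u σ‖ₑ) ^ s) ^ (1 / s) ≤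
        A * eLpNorm u p (volume.restrict (Ioi 0)) := by
  have hs0 : ENNReal.ofReal s ≠ 0 := by simpa using hs
  -- The Hölder exponent with 1/s = 1/q + 1/p; it is infinite when p = s, where the weight is merely
  -- bounded.
  set q : ℝ≥0∞ := ((ENNReal.ofReal s)⁻¹ - p⁻¹)⁻¹ with hq
  have hq0 : q ≠ 0 := by
    rw [hq, ENNReal.inv_ne_zero]
    exact ne_top_of_le_ne_top (ENNReal.inv_ne_top.2 hs0) tsub_le_self
  have : ENNReal.HolderTriple q p (ENNReal.ofReal s) := ⟨by
    rw [hq, inv_inv, tsub_add_cancel_of_le (ENNReal.inv_le_inv.2 hp)]⟩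
  have hexp := memLp_exp_neg hδ hq0
  refine ⟨(eLpNorm (fun σ : ℝ => Real.exp (-δ * σ)) q (volume.restrict (Ioi 0))).toNNReal,
    fun u hu => ?_⟩
  rw [ENNReal.coe_toNNReal hexp.eLpNorm_ne_top]
  refine le_of_eq_of_le ?_ (eLpNorm_smul_le_mul_eLpNorm hu hexp.1 (r := ENNReal.ofReal s))
  rw [eLpNorm_eq_lintegral_rpow_enorm_toReal hs0 ENNReal.ofReal_ne_top, ENNReal.toReal_ofReal hs.le]
  congr 1
  refine lintegral_congr fun σ => ?_
  rw [Pi.smul_apply', enorm_smul, Real.enorm_of_nonneg (Real.exp_pos _).le]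

/-- Hölder after inserting 1 = e^{-δσ}e^{δσ}: the growing weight is absorbed by the decaying
observation, and the decaying one lets u lie in any L^p with p ≥ s'. -/
theorem lintegral_mul_le_of_exp_weight {U : Type*} [NormedAddCommGroup U]
    {δ s s' a : ℝ} (hs : s.HolderConjugate s') {Φ : ℝ → ℝ≥0∞} (hΦ : AEMeasurable Φ (volume.restrict (Ioi a)))
    {B : ℝ≥0∞} (hB : ∫⁻ σ in Ioi a, (ENNReal.ofReal (Real.exp (δ * σ)) * Φ σ) ^ s ≤ B ^ s)
    {u : ℝ → U} (hu : AEStronglyMeasurable u (volume.restrict (Ioi a))) :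
    ∫⁻ σ in Ioi a, ‖u σ‖ₑ * Φ σ ≤
      (∫⁻ σ in Ioi a, (ENNReal.ofReal (Real.exp (-δ * σ)) * ‖u σ‖ₑ) ^ s') ^ (1 / s') * B := by
  have h1 := ENNReal.lintegral_mul_le_Lp_mul_Lq (volume.restrict (Ioi a)) hs.symm
    (f := fun σ => ENNReal.ofReal (Real.exp (-δ * σ)) * ‖u σ‖ₑ)
    (g := fun σ => ENNReal.ofReal (Real.exp (δ * σ)) * Φ σ)
    ((by fun_prop : Measurable fun σ : ℝ => ENNReal.ofReal (Real.exp (-δ * σ))).aemeasurable.mul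
      hu.enorm)
    ((by fun_prop : Measurable fun σ : ℝ => ENNReal.ofReal (Real.exp (δ * σ))).aemeasurable.mul hΦ)
  have h2 : (∫⁻ σ in Ioi a, (ENNReal.ofReal (Real.exp (δ * σ)) * Φ σ) ^ s) ^ (1 / s) ≤ B := by
    refine (ENNReal.rpow_le_rpow hB (one_div_nonneg.2 hs.nonneg)).trans (le_of_eq ?_)
    rw [← ENNReal.rpow_mul, mul_one_div_cancel hs.ne_zero, ENNReal.rpow_one]
  refine le_of_eq_of_le ?_ (h1.trans (mul_le_mul' le_rfl h2))
  refine lintegral_congr fun σ => ?_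
  rw [Pi.mul_apply, mul_mul_mul_comm, ← ENNReal.ofReal_mul (Real.exp_pos _).le, ← Real.exp_add]
  simp [mul_comm]

/-- Continuity of translations in `L^p`. -/
theorem tendsto_eLpNorm_comp_add_sub {U : Type*} [NormedAddCommGroup U] {p : ℝ≥0∞} (hp1 : 1 ≤ p)
    (hp : p ≠ ⊤) {f : ℝ → U} (hf : MemLp f p volume) :
    Tendsto (fun h : ℝ => eLpNorm (fun x => f (x + h) - f x) p volume) (𝓝 0) (𝓝 0) := by
  have : Fact (1 ≤ p) := ⟨hp1⟩
  set g : C(ℝ, C(ℝ, ℝ)) := ContinuousMap.curry ⟨fun a : ℝ × ℝ => a.2 + a.1, by fun_prop⟩ with hg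
  have hmp : ∀ h, MeasurePreserving (g h) volume volume := fun h =>
    measurePreserving_add_right volume h
  have h1 := Filter.Tendsto.compMeasurePreservingLp (l := 𝓝 (0 : ℝ))
    (tendsto_const_nhds (x := hf.toLp f)) (g.continuous.tendsto 0) hmp (hmp 0) hp
  have h2 := (tendsto_iff_edist_tendsto_0).1 h1
  refine h2.congr fun h => ?_
  rw [Lp.toLp_compMeasurePreserving, Lp.toLp_compMeasurePreserving, Lp.edist_toLp_toLp]
  congr 1
  ext x
  change f (x + h) - f (x + 0) = _
  rw [add_zero]

theorem eLpNorm_comp_sub_left_le {U : Type*} [NormedAddCommGroup U] (p : ℝ≥0∞) {v : ℝ → U}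
    (hv : AEStronglyMeasurable v volume) (t : ℝ) (s : Set ℝ) :
    eLpNorm (fun σ => v (t - σ)) p (volume.restrict s) ≤ eLpNorm v p volume :=
  (eLpNorm_mono_measure _ Measure.restrict_le_self).trans
    (eLpNorm_comp_measurePreserving hv (Measure.measurePreserving_sub_left volume t)).le

/-! ### States depending continuously on time. -/

namespace StableSemigroup

variable {Y U : Type*} [NormedAddCommGroup Y] [InnerProductSpace ℂ Y]
  [NormedAddCommGroup U] [InnerProductSpace ℂ U] (S : StableSemigroup Y)

/-- For σ > 0 the state at time t sees only v on (-∞,t), so integrability of the past suffices and v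
may be merely bounded at infinity. -/
theorem integrableOn_mildKernel (D : U →L[ℂ] Y) {v : ℝ → U} (hv : StronglyMeasurable v) {t : ℝ}
    (hvt : Integrable ((Iic t).indicator v)) :
    IntegrableOn (fun σ => S σ.toNNReal (D (v (t - σ)))) (Ioi 0) := by
  obtain ⟨M, hM0, hM⟩ := S.exists_bound
  have h1 : IntegrableOn (fun σ => M * (‖D‖ * ‖(Iic t).indicator v (t - σ)‖)) (Ioi 0) :=
    ((hvt.comp_sub_left t).norm.const_mul _ |>.const_mul _).integrableOn
  refine h1.mono' ?_ ((ae_restrict_iff' measurableSet_Ioi).2 (Eventually.of_forall fun σ hσ => ?_))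
  · have h2 : StronglyMeasurable fun σ : ℝ => (σ, v (t - σ)) :=
      stronglyMeasurable_id.prodMk (hv.comp_measurable (by fun_prop))
    exact ((S.continuous_mildKernel D).comp_stronglyMeasurable h2).aestronglyMeasurable
  · have hσ0 : (0 : ℝ) < σ := hσ
    rw [indicator_of_mem (show t - σ ∈ Iic t from by simp [hσ0.le])]
    exact ((S σ.toNNReal).le_of_opNorm_le (hM _) _).trans (by gcongr; exact D.le_opNorm _)

theorem stronglyMeasurable_mild (D : U →L[ℂ] Y) {v : ℝ → U} (hv : StronglyMeasurable v) :
    StronglyMeasurable fun t => S.mild D (fun σ => v (t - σ)) := by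
  have h2 : StronglyMeasurable fun q : ℝ × ℝ => (q.2, v (q.1 - q.2)) :=
    measurable_snd.stronglyMeasurable.prodMk (hv.comp_measurable (by fun_prop))
  exact ((S.continuous_mildKernel D).comp_stronglyMeasurable h2).integral_prod_right

section Complete

variable [CompleteSpace Y] [CompleteSpace U]

/-- If `B* e^{A* ·}` is bounded from the range of `Q*` to `L^s(0, T; U)`, then the states reached
from `L^p` controls, `p ≥ s'`, lie in the range of `Q` and depend continuously on time. -/
theorem exists_boundedContinuousFunction_preimage (K : Y →L[ℂ] U) (Q : Y →L[ℂ] Y)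
    (hQ : ∀ t x, S t (Q x) = Q (S t x)) (hinj : Function.Injective Q) {s s' T : ℝ}
    (hs : s.HolderConjugate s') (hT : 0 < T) (C : ℝ≥0)
    (hC : ∀ x, ∫⁻ σ in Ioc 0 T, ‖K (S.adjointSemigroup σ.toNNReal x)‖ₑ ^ s ≤
      C * ‖Q.adjoint x‖ₑ ^ s) {p : ℝ≥0∞} (hp : ENNReal.ofReal s' ≤ p) :
    ∃ C' : ℝ≥0, ∀ v : ℝ → U, StronglyMeasurable v → (∀ t ≤ 0, v t = 0) → MemLp v p volume →
      ∃ w : BoundedContinuousFunction ℝ≥0 Y,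
        (∀ t : ℝ≥0, Q (w t) = S.mild K.adjoint (fun σ => v (t - σ))) ∧
        ‖w‖ₑ ≤ C' * eLpNorm v p volume := by
  obtain ⟨δ, hδ, C₁, hC₁⟩ := exists_lintegral_decay (S := S) K Q hQ le_rfl hT hs.pos C
    (by simpa using hC)
  have hs'1 : 1 ≤ ENNReal.ofReal s' := by
    rw [← ENNReal.ofReal_one]; exact ENNReal.ofReal_le_ofReal hs.symm.lt.le
  -- Hölder with exponential weights combined with Douglas' lemma, for one fixed input history. It
  -- is stated for all exponents because it is used both at p, for the norm bound, and at s', for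
  -- continuity.
  have bound : ∀ p : ℝ≥0∞, ENNReal.ofReal s' ≤ p → ∃ A : ℝ≥0, ∀ u : ℝ → U,
      AEStronglyMeasurable u (volume.restrict (Ioi 0)) →
      eLpNorm u p (volume.restrict (Ioi 0)) ≠ ⊤ →
      ∃ w, Q w = S.mild K.adjoint u ∧ ‖w‖ₑ ≤ A * eLpNorm u p (volume.restrict (Ioi 0)) := by
    intro p hp
    obtain ⟨A, hA⟩ := exists_lintegral_exp_weight_le (U := U) hδ hs.symm.pos hp
    refine ⟨A * C₁ ^ (1 / s), fun u hu hut => ?_⟩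
    set c : ℝ≥0∞ := ((A * C₁ ^ (1 / s) : ℝ≥0) : ℝ≥0∞) * eLpNorm u p (volume.restrict (Ioi 0))
      with hc
    have hct : c ≠ ⊤ := ENNReal.mul_ne_top ENNReal.coe_ne_top hut
    have h1 : ∀ x, ‖inner ℂ x (S.mild K.adjoint u)‖ₑ ≤ c * ‖Q.adjoint x‖ₑ := by
      intro x
      refine (S.enorm_inner_mild_le K u x).trans ?_
      have hB : ∫⁻ σ in Ioi (0 : ℝ), (ENNReal.ofReal (Real.exp (δ * σ)) *
          ‖K (S.adjointSemigroup σ.toNNReal x)‖ₑ) ^ s ≤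
          (((C₁ ^ (1 / s) : ℝ≥0) : ℝ≥0∞) * ‖Q.adjoint x‖ₑ) ^ s := by
        refine (hC₁ x).trans (le_of_eq ?_)
        rw [ENNReal.mul_rpow_of_nonneg _ _ hs.nonneg, ← ENNReal.coe_rpow_of_nonneg _ hs.nonneg,
          ← NNReal.rpow_mul, one_div_mul_cancel hs.ne_zero, NNReal.rpow_one]
      refine (lintegral_mul_le_of_exp_weight hs
        (K.continuous.comp (S.adjointSemigroup.continuous_orbit x)).enorm.measurable.aemeasurable
        hB hu).trans ?_
      refine (mul_le_mul' (hA u hu) le_rfl).trans (le_of_eq ?_)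
      rw [hc, ENNReal.coe_mul]
      ring
    obtain ⟨w, hw, hw'⟩ := exists_apply_eq_of_norm_inner_le Q (S.mild K.adjoint u)
      (c := c.toReal) ENNReal.toReal_nonneg (fun x => by
        have := ENNReal.toReal_mono (ENNReal.mul_ne_top hct enorm_ne_top) (h1 x)
        rwa [ENNReal.toReal_mul, toReal_enorm, toReal_enorm] at this)
    refine ⟨w, hw', ?_⟩
    rw [← ofReal_norm, ← ENNReal.ofReal_toReal hct]
    exact ENNReal.ofReal_le_ofReal hw
  obtain ⟨A, hA⟩ := bound p hp
  obtain ⟨A₀, hA₀⟩ := bound _ le_rfl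
  refine ⟨A, fun v hvm hv0 hv => ?_⟩
  have hvt : ∀ t : ℝ, AEStronglyMeasurable (fun σ => v (t - σ)) (volume.restrict (Ioi 0)) :=
    fun t => (hvm.comp_measurable (by fun_prop)).aestronglyMeasurable
  have hle : ∀ t : ℝ, eLpNorm (fun σ => v (t - σ)) p (volume.restrict (Ioi 0)) ≤
      eLpNorm v p volume := fun t => eLpNorm_comp_sub_left_le p hvm.aestronglyMeasurable t _
  choose w hw hwle using fun t : ℝ => hA (fun σ => v (t - σ)) (hvt t)
    (ne_top_of_le_ne_top hv.eLpNorm_ne_top (hle t))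
  have hwle' : ∀ t, ‖w t‖ₑ ≤ A * eLpNorm v p volume := fun t =>
    (hwle t).trans (mul_le_mul' le_rfl (hle t))
  -- Translations are continuous only for finite exponents, while p may be infinite. Since v
  -- vanishes for negative times, cutting it off at b leaves a bounded interval, on which L^p embeds
  -- in L^{s'}.
  have htrunc : ∀ b : ℝ, MemLp ((Iio b).indicator v) (ENNReal.ofReal s') volume := by
    intro b
    have e : (Iio b).indicator v = (Ioo 0 b).indicator v := by
      ext x
      by_cases h0 : 0 < x
      · by_cases hb : x < b
        · rw [indicator_of_mem (show x ∈ Iio b from hb),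
            indicator_of_mem (show x ∈ Ioo 0 b from ⟨h0, hb⟩)]
        · rw [indicator_of_notMem (show x ∉ Iio b from hb),
            indicator_of_notMem (show x ∉ Ioo 0 b from fun h => hb h.2)]
      · rw [indicator_of_notMem (show x ∉ Ioo 0 b from fun h => h0 h.1)]
        by_cases hb : x < b
        · rw [indicator_of_mem (show x ∈ Iio b from hb), hv0 x (not_lt.1 h0)]
        · rw [indicator_of_notMem (show x ∉ Iio b from hb)]
    rw [e, memLp_indicator_iff_restrict measurableSet_Ioo]
    exact (hv.restrict _).mono_exponent hp
  have hcont : Continuous w := by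
    rw [continuous_iff_continuousAt]
    intro t₀
    -- States at times t < b depend only on v below b, so near t₀ the truncated control gives the
    -- same states.
    set b := t₀ + 1 with hb
    set f := (Iio b).indicator v with hf
    have hfm : StronglyMeasurable f := hvm.indicator measurableSet_Iio
    have hkey : ∀ t < b, ‖w t - w t₀‖ₑ ≤
        A₀ * eLpNorm (fun x => f (x + (t - t₀)) - f x) (ENNReal.ofReal s') volume := by
      intro t ht
      have hint : ∀ t : ℝ, t < b →
          IntegrableOn (fun σ => S σ.toNNReal (K.adjoint (v (t - σ)))) (Ioi 0) := by
        intro t ht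
        refine S.integrableOn_mildKernel K.adjoint hvm ?_
        have h1 : Integrable ((Ioo 0 b).indicator v) := by
          have := (htrunc b).restrict (Ioo 0 b) |>.mono_exponent hs'1
          rw [memLp_one_iff_integrable] at this
          rw [integrable_indicator_iff measurableSet_Ioo]
          refine IntegrableOn.congr_fun this (fun x hx => ?_) measurableSet_Ioo
          exact indicator_of_mem (show x ∈ Iio b from hx.2) v
        have e : (Iic t).indicator v = (Iic t).indicator ((Ioo 0 b).indicator v) := by
          ext x
          by_cases hx : x ≤ t
          · rw [indicator_of_mem (show x ∈ Iic t from hx), indicator_of_mem (show x ∈ Iic t from hx)]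
            by_cases h0 : 0 < x
            · rw [indicator_of_mem (show x ∈ Ioo 0 b from ⟨h0, hx.trans_lt ht⟩)]
            · rw [indicator_of_notMem (show x ∉ Ioo 0 b from fun h => h0 h.1), hv0 x (not_lt.1 h0)]
          · rw [indicator_of_notMem (show x ∉ Iic t from hx),
              indicator_of_notMem (show x ∉ Iic t from hx)]
        rw [e]
        exact h1.indicator measurableSet_Iic
      have hfv : ∀ t < b, ∀ σ ∈ Ioi (0 : ℝ), f (t - σ) = v (t - σ) := fun t ht σ hσ =>
        indicator_of_mem (show t - σ ∈ Iio b from (sub_lt_self t hσ).trans ht) v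
      have ht₀ : t₀ < b := by rw [hb]; linarith
      set u : ℝ → U := fun σ => f (t - σ) - f (t₀ - σ) with hu
      have hum : AEStronglyMeasurable u (volume.restrict (Ioi 0)) :=
        ((hfm.comp_measurable (by fun_prop)).sub
          (hfm.comp_measurable (by fun_prop))).aestronglyMeasurable
      have hmild : S.mild K.adjoint u = Q (w t - w t₀) := by
        rw [map_sub, hw, hw, mild, mild, mild, ← integral_sub (hint t ht) (hint t₀ ht₀)]
        refine setIntegral_congr_fun measurableSet_Ioi fun σ hσ => ?_
        simp only [hu]
        rw [hfv t ht σ hσ, hfv t₀ ht₀ σ hσ, map_sub, map_sub]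
      have hule : eLpNorm u (ENNReal.ofReal s') (volume.restrict (Ioi 0)) ≤
          eLpNorm (fun x => f (x + (t - t₀)) - f x) (ENNReal.ofReal s') volume := by
        have := eLpNorm_comp_sub_left_le (ENNReal.ofReal s')
          (v := fun x => f (x + (t - t₀)) - f x) (((hfm.comp_measurable (by fun_prop)).sub
          hfm).aestronglyMeasurable) t₀ (Ioi 0)
        refine le_of_eq_of_le ?_ this
        congr 1
        ext σ
        simp only [hu]
        congr 2
        ring
      have hfin : eLpNorm (fun x => f (x + (t - t₀)) - f x) (ENNReal.ofReal s') volume ≠ ⊤ := by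
        have h1 : MemLp (fun x => f (x + (t - t₀))) (ENNReal.ofReal s') volume :=
          (htrunc b).comp_measurePreserving (measurePreserving_add_right volume (t - t₀))
        exact (h1.sub (htrunc b)).eLpNorm_ne_top
      -- By linearity of the state and injectivity of Q, the preimage built from the difference of
      -- histories is the difference of preimages.
      obtain ⟨w', hw', hw'le⟩ := hA₀ u hum (ne_top_of_le_ne_top hfin hule)
      rw [hmild] at hw'
      rw [← hinj hw']
      exact hw'le.trans (mul_le_mul' le_rfl hule)
    rw [ContinuousAt, tendsto_iff_edist_tendsto_0]
    have h1 := tendsto_eLpNorm_comp_add_sub hs'1 ENNReal.ofReal_ne_top (htrunc b)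
    have h2 : Tendsto (fun t => t - t₀) (𝓝 t₀) (𝓝 0) := by
      have : Continuous fun t : ℝ => t - t₀ := by fun_prop
      simpa using this.tendsto t₀
    have h3 := ENNReal.Tendsto.const_mul (a := (A₀ : ℝ≥0∞)) (h1.comp h2)
      (Or.inr ENNReal.coe_ne_top)
    rw [mul_zero] at h3
    refine tendsto_of_tendsto_of_tendsto_of_le_of_le' tendsto_const_nhds h3
      (Eventually.of_forall fun _ => zero_le) ?_
    filter_upwards [Iio_mem_nhds (show t₀ < b by rw [hb]; linarith)] with t ht
    rw [edist_eq_enorm_sub]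
    exact hkey t ht
  have hfin : A * eLpNorm v p volume ≠ ⊤ := ENNReal.mul_ne_top ENNReal.coe_ne_top hv.eLpNorm_ne_top
  have hnorm : ∀ t, ‖w t‖ ≤ (A * eLpNorm v p volume).toReal := fun t => by
    rw [← toReal_enorm]
    exact ENNReal.toReal_mono hfin (hwle' t)
  refine ⟨BoundedContinuousFunction.ofNormedAddCommGroup (fun t : ℝ≥0 => w t)
    (hcont.comp NNReal.continuous_coe) _ (fun t => hnorm t), fun t => hw t, ?_⟩
  rw [← ofReal_norm]
  exact (ENNReal.ofReal_le_ofReal (BoundedContinuousFunction.norm_ofNormedAddCommGroup_le _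
    ENNReal.toReal_nonneg _)).trans_eq (ENNReal.ofReal_toReal hfin)

end Complete
end StableSemigroup

/-! ### L^p to L^r bounds for preimages of regularized states. -/

theorem lintegral_Ioc_rpow_neg_ne_top {γ τ : ℝ} (hγ : γ < 1) (hτ : 0 ≤ τ) :
    ∫⁻ σ in Ioc 0 τ, ENNReal.ofReal (σ ^ (-γ)) ≠ ⊤ := by
  have := lintegral_Ioo_rpow_sub_one (s := 1 - γ) (by linarith) hτ
  rw [restrict_Ioo_eq_restrict_Ioc, show 1 - γ - 1 = -γ by ring] at this
  rw [this]
  exact ENNReal.ofReal_ne_top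

/-- The truncated fractional integral maps `L^p` to `L^r`. -/
theorem exists_lintegral_truncated_fracInt_le {γ p r τ : ℝ} (hγ1 : γ < 1) (hτ : 0 < τ)
    (hp : 1 < p) (hpr : p ≤ r) (hγ : 1 / p - 1 / r ≤ 1 - γ) :
    ∃ C : ℝ≥0, ∀ f : ℝ → ℝ≥0∞, Measurable f → ∫⁻ t, f t ^ p ≠ ⊤ →
      ∫⁻ t, (∫⁻ σ in Ioc 0 τ, ENNReal.ofReal (σ ^ (-γ)) * f (t - σ)) ^ r ≤
        C * (∫⁻ t, f t ^ p) ^ (r / p) := by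
  have hr0 : 0 < r := by linarith
  rcases hpr.eq_or_lt with rfl | hpr
  -- The diagonal case is outside the Hardy-Littlewood-Sobolev range, but the truncated kernel is
  -- integrable and Young applies.
  · have hfin := ENNReal.rpow_ne_top_of_nonneg hr0.le (lintegral_Ioc_rpow_neg_ne_top hγ1 hτ.le)
    refine ⟨((∫⁻ σ in Ioc 0 τ, ENNReal.ofReal (σ ^ (-γ))) ^ p).toNNReal, fun f hf _ => ?_⟩
    rw [ENNReal.coe_toNNReal hfin, div_self hr0.ne', ENNReal.rpow_one]
    exact lintegral_rpow_lintegral_mul_comp_sub_le' hp.le (measurable_ofReal_rpow γ) hf _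
  -- The exponent on the Hardy-Littlewood-Sobolev line for p and r. As γ ≤ γ', on (0,τ] the kernel
  -- satisfies σ^{-γ} ≤ τ^{γ'-γ}σ^{-γ'}.
  · set γ' : ℝ := 1 - (1 / p - 1 / r) with hγ'
    have hle : γ ≤ γ' := by linarith
    obtain ⟨C, hC⟩ := exists_lintegral_fracInt_le (γ := γ') hp hpr (by rw [hγ']; ring)
    set b : ℝ≥0 := (τ ^ (γ' - γ)).toNNReal ^ r with hb
    refine ⟨b * C, fun f hf hfin => ?_⟩
    have h1 : ∀ t, ∫⁻ σ in Ioc 0 τ, ENNReal.ofReal (σ ^ (-γ)) * f (t - σ) ≤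
        ENNReal.ofReal (τ ^ (γ' - γ)) * fracInt γ' f t := by
      intro t
      rw [fracInt, ← lintegral_const_mul' _ _ ENNReal.ofReal_ne_top]
      refine (setLIntegral_mono' measurableSet_Ioc fun σ hσ => ?_).trans
        (lintegral_mono_set Ioc_subset_Ioi_self)
      rw [← mul_assoc, ← ENNReal.ofReal_mul (by positivity)]
      have hσ0 : 0 < σ := hσ.1
      gcongr ENNReal.ofReal ?_ * _
      rw [show -γ = (γ' - γ) + -γ' by ring, Real.rpow_add hσ0]
      gcongr
      exact hσ.2
    calc _ ≤ ∫⁻ t, (ENNReal.ofReal (τ ^ (γ' - γ)) * fracInt γ' f t) ^ r :=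
          lintegral_mono fun t => ENNReal.rpow_le_rpow (h1 t) hr0.le
      _ = b * ∫⁻ t, fracInt γ' f t ^ r := by
          simp_rw [ENNReal.mul_rpow_of_nonneg _ _ hr0.le]
          rw [lintegral_const_mul _ ((measurable_fracInt γ' hf).pow_const r), hb,
            ENNReal.coe_rpow_of_nonneg _ hr0.le]
          rfl
      _ ≤ _ := by
          rw [ENNReal.coe_mul, mul_assoc]
          exact mul_le_mul' le_rfl (hC f hf hfin)

theorem eLpNorm_ofReal_exponent {α E : Type*} [MeasurableSpace α] [NormedAddCommGroup E] {p : ℝ} (hp : 0 < p)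
    (f : α → E) (μ : Measure α) :
    eLpNorm f (ENNReal.ofReal p) μ = (∫⁻ x, ‖f x‖ₑ ^ p ∂μ) ^ (1 / p) := by
  rw [eLpNorm_eq_lintegral_rpow_enorm_toReal (by simpa using hp) ENNReal.ofReal_ne_top,
    ENNReal.toReal_ofReal hp.le]

theorem lintegral_enorm_Lp_rpow_le {α Y U : Type*} [MeasurableSpace α] [NormedAddCommGroup Y]
    [NormedSpace ℂ Y] [NormedAddCommGroup U] [NormedSpace ℂ U] {μ : Measure α} {q : ℝ≥0∞}
    [Fact (1 ≤ q)] (hq : q ≠ ∞) (Ψ : Y →L[ℂ] Lp U q μ) (y : Y) :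
    ∫⁻ t, ‖Ψ y t‖ₑ ^ q.toReal ∂μ ≤ ‖Ψ‖ₑ ^ q.toReal * ‖y‖ₑ ^ q.toReal := by
  have hq1 : 1 ≤ q := Fact.out
  have hq0 : q ≠ 0 := (zero_lt_one.trans_le hq1).ne'
  have hs : 0 < q.toReal := ENNReal.toReal_pos hq0 hq
  have h1 : ‖Ψ y‖ₑ ≤ ‖Ψ‖ₑ * ‖y‖ₑ := Ψ.le_opENorm y
  rw [Lp.enorm_def, eLpNorm_eq_lintegral_rpow_enorm_toReal hq0 hq] at h1
  have h2 := ENNReal.rpow_le_rpow h1 hs.le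
  rwa [← ENNReal.rpow_mul, one_div_mul_cancel hs.ne', ENNReal.rpow_one,
    ENNReal.mul_rpow_of_nonneg _ _ hs.le] at h2

namespace StableSemigroup

variable {Y U : Type*} [NormedAddCommGroup Y] [InnerProductSpace ℂ Y]
  [NormedAddCommGroup U] [InnerProductSpace ℂ U] (S : StableSemigroup Y)
  [CompleteSpace Y] [CompleteSpace U]

-- A majorant c in L^r is finite almost everywhere, and at such times the preimage exists and is
-- bounded by c.
omit [CompleteSpace U] in
theorem exists_memLp_preimage {ζ : ℝ → Y} (hζ : StronglyMeasurable ζ) {c : ℝ → ℝ≥0∞}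
    (hc : Measurable c)
    (h : ∀ t x, ‖inner ℂ x (ζ t)‖ₑ ≤ c t * ‖(S.negPow 1 one_pos).adjoint x‖ₑ)
    {r : ℝ} (hr : 0 < r) {B : ℝ≥0∞} (hB : B ≠ ⊤) (hcB : ∫⁻ t, c t ^ r ≤ B ^ r) :
    ∃ w : ℝ → Y, MemLp w (ENNReal.ofReal r) volume ∧
      (∀ᵐ t, S.negPow 1 one_pos (w t) = ζ t) ∧ eLpNorm w (ENNReal.ofReal r) volume ≤ B := by
  obtain ⟨w, hw, hw1, hw2⟩ := S.exists_measurable_preimage ζ hζ c hc h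
  have hle : eLpNorm w (ENNReal.ofReal r) volume ≤ B := by
    rw [eLpNorm_ofReal_exponent hr]
    have h1 : ∫⁻ t, ‖w t‖ₑ ^ r ≤ B ^ r :=
      (lintegral_mono fun t => ENNReal.rpow_le_rpow (hw2 t) hr.le).trans hcB
    refine (ENNReal.rpow_le_rpow h1 (by positivity)).trans (le_of_eq ?_)
    rw [← ENNReal.rpow_mul, mul_one_div_cancel hr.ne', ENNReal.rpow_one]
  refine ⟨w, ⟨hw.aestronglyMeasurable, hle.trans_lt hB.lt_top⟩, ?_, hle⟩
  have hfin : ∫⁻ t, c t ^ r ≠ ⊤ :=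
    ne_top_of_le_ne_top (ENNReal.rpow_ne_top_of_nonneg hr.le hB) hcB
  filter_upwards [ae_lt_top (hc.pow_const r) hfin] with t ht
  exact hw1 t fun hct => by simp [hct, hr] at ht

/-- A pointwise bound of the observation by an `L^r` kernel gives `L^1 → L^r` bounds. -/
theorem exists_memLp_preimage_of_kernel (K : Y →L[ℂ] U) {k : ℝ → ℝ≥0∞} (hk : Measurable k)
    (hK : ∀ σ, 0 < σ → ∀ x, ‖K (S.adjointSemigroup σ.toNNReal x)‖ₑ ≤
      k σ * ‖(S.negPow 1 one_pos).adjoint x‖ₑ) {r : ℝ} (hr : 1 ≤ r)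
    (hkr : ∫⁻ σ in Ioi (0 : ℝ), k σ ^ r ≠ ⊤) :
    ∃ C : ℝ≥0, ∀ v : ℝ → U, StronglyMeasurable v → MemLp v 1 volume →
      ∃ w : ℝ → Y, MemLp w (ENNReal.ofReal r) volume ∧
        (∀ᵐ t, S.negPow 1 one_pos (w t) = S.mild K.adjoint (fun σ => v (t - σ))) ∧
        eLpNorm w (ENNReal.ofReal r) volume ≤ C * eLpNorm v 1 volume := by
  have hr0 : 0 < r := by linarith
  set A := ∫⁻ σ in Ioi (0 : ℝ), k σ ^ r with hA
  have hAt : A ^ (1 / r) ≠ ⊤ := ENNReal.rpow_ne_top_of_nonneg (by positivity) hkr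
  refine ⟨(A ^ (1 / r)).toNNReal, fun v hvm hv => ?_⟩
  rw [ENNReal.coe_toNNReal hAt]
  have hf : Measurable fun t => ‖v t‖ₑ := hvm.enorm
  refine S.exists_memLp_preimage (S.stronglyMeasurable_mild K.adjoint hvm)
    (measurable_lintegral_mul_comp_sub hk hf (volume.restrict (Ioi 0))) (fun t x => ?_) hr0
    (ENNReal.mul_ne_top hAt hv.eLpNorm_ne_top) ?_
  · refine (S.enorm_inner_mild_le K _ x).trans ?_
    rw [← lintegral_mul_const _ (by fun_prop)]
    refine setLIntegral_mono' measurableSet_Ioi fun σ hσ => ?_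
    refine (mul_le_mul' le_rfl (hK σ hσ x)).trans (le_of_eq ?_)
    ring
  · refine (lintegral_rpow_lintegral_mul_comp_sub_le hr hk hf _).trans (le_of_eq ?_)
    rw [eLpNorm_one_eq_lintegral_enorm, ENNReal.mul_rpow_of_nonneg _ _ hr0.le, ← ENNReal.rpow_mul,
      one_div_mul_cancel hr0.ne', ENNReal.rpow_one]

/-- A singular estimate plus an `L^s` part for the observation near time zero gives
`L^p → L^r` bounds in the Hardy-Littlewood-Sobolev range. -/
theorem exists_memLp_preimage_of_singular (K : Y →L[ℂ] U) (g : ℝ → Y → U) {γ N T : ℝ}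
    (hγ0 : 0 ≤ γ) (hγ1 : γ < 1) (hN : 0 ≤ N) (hT : 0 < T)
    (hK : ∀ σ ∈ Ioc 0 T, ∀ x, ‖K (S.adjointSemigroup σ.toNNReal x)‖ₑ ≤
      ENNReal.ofReal (N * σ ^ (-γ)) * ‖(S.negPow 1 one_pos).adjoint x‖ₑ + ‖g σ x‖ₑ)
    (hgm : ∀ x, AEMeasurable (fun σ => ‖g σ x‖ₑ) (volume.restrict (Ioc 0 T)))
    {p r s : ℝ} (hpr : p ≤ r) (hγ : 1 / p - 1 / r ≤ 1 - γ) (hs : s.HolderConjugate p) (C : ℝ≥0)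
    (hg : ∀ x, ∫⁻ σ in Ioc 0 T, ‖g σ x‖ₑ ^ s ≤ C * ‖(S.negPow 1 one_pos).adjoint x‖ₑ ^ s) :
    ∃ C' : ℝ≥0, ∀ v : ℝ → U, StronglyMeasurable v → MemLp v (ENNReal.ofReal p) volume →
      ∃ w : ℝ → Y, MemLp w (ENNReal.ofReal r) volume ∧
        (∀ᵐ t, S.negPow 1 one_pos (w t) = S.mild K.adjoint (fun σ => v (t - σ))) ∧
        eLpNorm w (ENNReal.ofReal r) volume ≤ C' * eLpNorm v (ENNReal.ofReal p) volume := by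
  have hp1 : 1 < p := hs.symm.lt
  have hp0 : 0 < p := by linarith
  have hr0 : 0 < r := by linarith
  have hs0 : 0 < s := hs.pos
  set R := S.negPow 1 one_pos with hR
  -- Half of T leaves the window (τ,2τ] inside (0,T] and away from the singularity. There the
  -- observation is in L^s, and decay propagates this to (τ,∞).
  set τ := T / 2 with hτ
  have hτ0 : 0 < τ := by positivity
  have hττ : τ + τ = T := add_halves T
  have hΦm : ∀ x, Measurable fun σ : ℝ => ‖K (S.adjointSemigroup σ.toNNReal x)‖ₑ := fun x =>
    (K.continuous.comp (S.adjointSemigroup.continuous_orbit x)).enorm.measurable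
  -- the observation on `(τ, 2τ)`
  set b : ℝ≥0∞ := ENNReal.ofReal (N * τ ^ (-γ)) with hb
  set C₂ : ℝ≥0∞ := (2 : ℝ≥0∞) ^ (s - 1) * (b ^ s * ENNReal.ofReal τ + C) with hC₂
  have hC₂t : C₂ ≠ ⊤ := ENNReal.mul_ne_top
    (ENNReal.rpow_ne_top_of_nonneg (by linarith [hs.lt]) (by simp))
    (ENNReal.add_ne_top.2 ⟨ENNReal.mul_ne_top
      (ENNReal.rpow_ne_top_of_nonneg hs0.le ENNReal.ofReal_ne_top) ENNReal.ofReal_ne_top,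
      ENNReal.coe_ne_top⟩)
  have h2τ : ∀ x, ∫⁻ σ in Ioc τ (τ + τ), ‖K (S.adjointSemigroup σ.toNNReal x)‖ₑ ^ s ≤
      (C₂.toNNReal : ℝ≥0∞) * ‖R.adjoint x‖ₑ ^ s := by
    intro x
    rw [ENNReal.coe_toNNReal hC₂t, hττ]
    calc _ ≤ ∫⁻ σ in Ioc τ T, (2 : ℝ≥0∞) ^ (s - 1) *
          ((b * ‖R.adjoint x‖ₑ) ^ s + ‖g σ x‖ₑ ^ s) := by
          refine setLIntegral_mono' measurableSet_Ioc fun σ hσ => ?_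
          refine le_trans (ENNReal.rpow_le_rpow (hK σ ⟨hτ0.trans hσ.1, hσ.2⟩ x) hs0.le) ?_
          refine le_trans (ENNReal.rpow_le_rpow (add_le_add (mul_le_mul'
            (ENNReal.ofReal_le_ofReal ?_) le_rfl) le_rfl) hs0.le)
            (ENNReal.rpow_add_le_mul_rpow_add_rpow _ _ hs.lt.le)
          exact mul_le_mul_of_nonneg_left
            (Real.rpow_le_rpow_of_nonpos hτ0 hσ.1.le (by linarith)) hN
      _ = (2 : ℝ≥0∞) ^ (s - 1) *
          ((b * ‖R.adjoint x‖ₑ) ^ s * ENNReal.ofReal τ + ∫⁻ σ in Ioc τ T, ‖g σ x‖ₑ ^ s) := by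
          rw [lintegral_const_mul' _ _
            (ENNReal.rpow_ne_top_of_nonneg (by linarith [hs.lt]) (by simp)),
            lintegral_add_left measurable_const, setLIntegral_const, Real.volume_Ioc]
          congr 4
          linarith
      _ ≤ (2 : ℝ≥0∞) ^ (s - 1) *
          ((b * ‖R.adjoint x‖ₑ) ^ s * ENNReal.ofReal τ + C * ‖R.adjoint x‖ₑ ^ s) := by
          gcongr
          exact (lintegral_mono_set (Ioc_subset_Ioc_left hτ0.le)).trans (hg x)
      _ = _ := by
          rw [ENNReal.mul_rpow_of_nonneg _ _ hs0.le, hC₂]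
          ring
  obtain ⟨δ, hδ, C₃, hC₃⟩ := exists_lintegral_decay (S := S) K R
    (fun t x => (S.negPow_apply_comm 1 one_pos t x).symm) hτ0.le hτ0 hs0 _ h2τ
  -- the part of the observation that is not singular
  set Φ : Y → ℝ → ℝ≥0∞ := fun x σ =>
    if σ ≤ τ then ‖g σ x‖ₑ else ‖K (S.adjointSemigroup σ.toNNReal x)‖ₑ with hΦ
  have hΦ1 : ∀ x, ∀ σ ∈ Ioc 0 τ, ‖g σ x‖ₑ = Φ x σ := fun x σ hσ => (if_pos hσ.2).symm
  have hΦ2 : ∀ x, ∀ σ ∈ Ioi τ, ‖K (S.adjointSemigroup σ.toNNReal x)‖ₑ = Φ x σ := fun x σ hσ =>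
    (if_neg (not_le.2 hσ)).symm
  have hsubT : Ioc 0 τ ⊆ Ioc 0 T := Ioc_subset_Ioc_right (by linarith)
  have hΦae : ∀ x, AEMeasurable (Φ x) (volume.restrict (Ioi 0)) := by
    intro x
    rw [← Ioc_union_Ioi_eq_Ioi hτ0.le, aemeasurable_union_iff]
    constructor
    · exact ((hgm x).mono_set hsubT).congr ((ae_restrict_iff' measurableSet_Ioc).2
        (Eventually.of_forall (hΦ1 x)))
    · exact (hΦm x).aemeasurable.congr ((ae_restrict_iff' measurableSet_Ioi).2
        (Eventually.of_forall (hΦ2 x)))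
  set C₄ : ℝ≥0∞ := ENNReal.ofReal (Real.exp (δ * τ)) ^ s * C + C₃ with hC₄
  have hC₄t : C₄ ≠ ⊤ := ENNReal.add_ne_top.2 ⟨ENNReal.mul_ne_top
    (ENNReal.rpow_ne_top_of_nonneg hs0.le ENNReal.ofReal_ne_top) ENNReal.coe_ne_top,
    ENNReal.coe_ne_top⟩
  have hΦs : ∀ x, ∫⁻ σ in Ioi (0 : ℝ), (ENNReal.ofReal (Real.exp (δ * σ)) * Φ x σ) ^ s ≤
      (C₄ ^ (1 / s) * ‖R.adjoint x‖ₑ) ^ s := by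
    intro x
    rw [ENNReal.mul_rpow_of_nonneg _ _ hs0.le, ← ENNReal.rpow_mul, one_div_mul_cancel hs0.ne',
      ENNReal.rpow_one, ← Ioc_union_Ioi_eq_Ioi hτ0.le,
      lintegral_union measurableSet_Ioi Ioc_disjoint_Ioi_same, hC₄, add_mul]
    refine add_le_add ?_ ?_
    · rw [mul_assoc]
      have hfin : ENNReal.ofReal (Real.exp (δ * τ)) ^ s ≠ ⊤ :=
        ENNReal.rpow_ne_top_of_nonneg hs0.le ENNReal.ofReal_ne_top
      refine le_trans ?_ (mul_le_mul' le_rfl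
        ((lintegral_mono_set hsubT).trans (hg x)))
      rw [← lintegral_const_mul' _ _ hfin]
      refine setLIntegral_mono' measurableSet_Ioc fun σ hσ => ?_
      rw [← hΦ1 x σ hσ, ← ENNReal.mul_rpow_of_nonneg _ _ hs0.le]
      gcongr
      exact hσ.2
    · refine le_of_eq_of_le (setLIntegral_congr_fun measurableSet_Ioi fun σ hσ => ?_) (hC₃ x)
      simp only [hΦ2 x σ hσ]
  obtain ⟨C₁, hC₁⟩ := exists_lintegral_truncated_fracInt_le hγ1 hτ0 hp1 hpr hγ
  -- the scalar majorant
  have hhm : Measurable fun σ : ℝ => ENNReal.ofReal (Real.exp (-δ * σ)) ^ p := by fun_prop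
  set H : ℝ≥0∞ := ∫⁻ σ in Ioi (0 : ℝ), (ENNReal.ofReal (Real.exp (-δ * σ)) ^ p) ^ (r / p) with hH
  have hHt : H ≠ ⊤ := by
    have h1 := (memLp_exp_neg hδ (q := ENNReal.ofReal r) (by simpa using hr0)).eLpNorm_ne_top
    rw [eLpNorm_ofReal_exponent hr0] at h1
    have h2 := ENNReal.rpow_ne_top_of_nonneg hr0.le h1
    rw [← ENNReal.rpow_mul, one_div_mul_cancel hr0.ne', ENNReal.rpow_one] at h2
    convert h2 using 1
    refine lintegral_congr fun σ => ?_
    rw [← ENNReal.rpow_mul, mul_div_cancel₀ _ hp0.ne', Real.enorm_of_nonneg (Real.exp_pos _).le]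
  set E₁ : ℝ≥0∞ := ENNReal.ofReal N ^ r * C₁ with hE₁
  set E₂ : ℝ≥0∞ := (C₄ ^ (1 / s)) ^ r * H with hE₂
  have hC₄s : C₄ ^ (1 / s) ≠ ⊤ :=
    ENNReal.rpow_ne_top_of_nonneg (one_div_nonneg.2 hs0.le) hC₄t
  set E : ℝ≥0∞ := (2 : ℝ≥0∞) ^ (r - 1) * (E₁ + E₂) with hE
  have hEt : E ≠ ⊤ := ENNReal.mul_ne_top
    (ENNReal.rpow_ne_top_of_nonneg (by linarith) (by simp)) (ENNReal.add_ne_top.2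
      ⟨ENNReal.mul_ne_top (ENNReal.rpow_ne_top_of_nonneg hr0.le ENNReal.ofReal_ne_top)
        ENNReal.coe_ne_top,
      ENNReal.mul_ne_top (ENNReal.rpow_ne_top_of_nonneg hr0.le hC₄s) hHt⟩)
  have hEt' : E ^ (1 / r) ≠ ⊤ := ENNReal.rpow_ne_top_of_nonneg (by positivity) hEt
  refine ⟨(E ^ (1 / r)).toNNReal, fun v hvm hv => ?_⟩
  rw [ENNReal.coe_toNNReal hEt']
  set f : ℝ → ℝ≥0∞ := fun t => ‖v t‖ₑ with hfdef
  have hf : Measurable f := hvm.enorm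
  set X := ∫⁻ t, f t ^ p with hX
  have hvX : eLpNorm v (ENNReal.ofReal p) volume = X ^ (1 / p) := eLpNorm_ofReal_exponent hp0 v volume
  have hXt : X ≠ ⊤ := by
    have := hv.eLpNorm_ne_top
    rw [hvX] at this
    intro h
    rw [h, ENNReal.top_rpow_of_pos (by positivity)] at this
    exact this rfl
  -- The bound for the preimage splits in two. The truncated fractional integral c₁ comes from the
  -- singular part on (0,τ]. The term c₂ comes from Hölder applied to Φ; its p-th power is a
  -- multiple of the convolution of e^{-pδσ} with ‖v‖^p, so Young with exponent r/p bounds it in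
  -- L^r.
  set c₁ : ℝ → ℝ≥0∞ := fun t => ENNReal.ofReal N *
    ∫⁻ σ in Ioc 0 τ, ENNReal.ofReal (σ ^ (-γ)) * f (t - σ) with hc₁
  set c₂ : ℝ → ℝ≥0∞ := fun t => C₄ ^ (1 / s) *
    (∫⁻ σ in Ioi (0 : ℝ), ENNReal.ofReal (Real.exp (-δ * σ)) ^ p * f (t - σ) ^ p) ^ (1 / p) with hc₂
  have hm₁ := measurable_lintegral_mul_comp_sub (measurable_ofReal_rpow γ) hf
    (volume.restrict (Ioc 0 τ))
  have hm₂ := measurable_lintegral_mul_comp_sub hhm (hf.pow_const p) (volume.restrict (Ioi 0))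
  have hc₁m : Measurable c₁ := hm₁.const_mul _
  have hc₂m : Measurable c₂ := (hm₂.pow_const _).const_mul _
  refine S.exists_memLp_preimage (S.stronglyMeasurable_mild K.adjoint hvm)
    (c := fun t => c₁ t + c₂ t) (hc₁m.add hc₂m) (fun t x => ?_) hr0
    (ENNReal.mul_ne_top hEt' hv.eLpNorm_ne_top) ?_
  · refine (S.enorm_inner_mild_le K _ x).trans ?_
    set k : ℝ → ℝ≥0∞ := (Ioc 0 τ).indicator fun σ => ENNReal.ofReal (N * σ ^ (-γ)) with hk
    have hkm : Measurable k := (by fun_prop : Measurable fun σ : ℝ =>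
      ENNReal.ofReal (N * σ ^ (-γ))).indicator measurableSet_Ioc
    have hfm : Measurable fun σ => f (t - σ) := by fun_prop
    have hsplit : ∀ σ ∈ Ioi (0 : ℝ), ‖v (t - σ)‖ₑ * ‖K (S.adjointSemigroup σ.toNNReal x)‖ₑ ≤
        (k σ * f (t - σ)) * ‖R.adjoint x‖ₑ + ‖v (t - σ)‖ₑ * Φ x σ := by
      intro σ hσ
      by_cases hστ : σ ≤ τ
      · have hm : σ ∈ Ioc 0 τ := ⟨hσ, hστ⟩
        have := hK σ (hsubT hm) x
        rw [hk, indicator_of_mem hm, ← hΦ1 x σ hm]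
        refine (mul_le_mul' le_rfl this).trans (le_of_eq ?_)
        rw [mul_add]
        congr 1
        change f (t - σ) * _ = _
        ring
      · rw [hΦ2 x σ (not_le.1 hστ)]
        exact le_add_self
    refine (setLIntegral_mono' measurableSet_Ioi hsplit).trans ?_
    have hkfm : Measurable fun σ => k σ * f (t - σ) := hkm.mul hfm
    rw [lintegral_add_left (hkfm.mul_const _), add_mul]
    refine add_le_add ?_ ?_
    · rw [lintegral_mul_const _ hkfm]
      refine mul_le_mul' (le_of_eq ?_) le_rfl
      have e : ∀ σ, k σ * f (t - σ) =
          (Ioc 0 τ).indicator (fun σ => ENNReal.ofReal (N * σ ^ (-γ)) * f (t - σ)) σ := fun σ =>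
        (indicator_mul_left (Ioc 0 τ) (fun σ => ENNReal.ofReal (N * σ ^ (-γ)))
          (fun σ => f (t - σ))).symm
      simp_rw [e]
      rw [setLIntegral_indicator measurableSet_Ioc,
        inter_eq_self_of_subset_left Ioc_subset_Ioi_self]
      change _ = ENNReal.ofReal N * ∫⁻ σ in Ioc 0 τ, ENNReal.ofReal (σ ^ (-γ)) * f (t - σ)
      rw [← lintegral_const_mul' _ _ ENNReal.ofReal_ne_top]
      refine setLIntegral_congr_fun measurableSet_Ioc fun σ hσ => ?_
      rw [ENNReal.ofReal_mul hN, mul_assoc]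
    · refine (lintegral_mul_le_of_exp_weight (u := fun σ => v (t - σ)) hs (hΦae x) (hΦs x)
        (hvm.comp_measurable (g := fun σ => t - σ)
          (by fun_prop)).aestronglyMeasurable).trans (le_of_eq ?_)
      simp_rw [ENNReal.mul_rpow_of_nonneg _ _ hp0.le]
      change (∫⁻ σ in Ioi (0 : ℝ), ENNReal.ofReal (Real.exp (-δ * σ)) ^ p * f (t - σ) ^ p) ^ (1 / p)
        * (C₄ ^ (1 / s) * ‖R.adjoint x‖ₑ) = c₂ t * ‖R.adjoint x‖ₑ
      simp only [hc₂]
      rw [← mul_assoc, mul_comm (_ ^ (1 / p))]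
  · have hrp : 1 ≤ r / p := (one_le_div hp0).2 hpr
    have hi₁ : ∫⁻ t, c₁ t ^ r ≤ E₁ * X ^ (r / p) := by
      simp_rw [hc₁, ENNReal.mul_rpow_of_nonneg _ _ hr0.le]
      rw [lintegral_const_mul _ (hm₁.pow_const r), hE₁, mul_assoc]
      exact mul_le_mul' le_rfl (hC₁ f hf hXt)
    have hi₂ : ∫⁻ t, c₂ t ^ r ≤ E₂ * X ^ (r / p) := by
      simp_rw [hc₂, ENNReal.mul_rpow_of_nonneg _ _ hr0.le, ← ENNReal.rpow_mul,
        show 1 / p * r = r / p by ring]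
      rw [lintegral_const_mul _ (hm₂.pow_const _), hE₂, mul_assoc, ← ENNReal.rpow_mul]
      exact mul_le_mul' le_rfl
        (lintegral_rpow_lintegral_mul_comp_sub_le hrp hhm (hf.pow_const p) (Ioi 0))
    have h2t : (2 : ℝ≥0∞) ^ (r - 1) ≠ ⊤ :=
      ENNReal.rpow_ne_top_of_nonneg (by linarith) (by simp)
    calc ∫⁻ t, (c₁ t + c₂ t) ^ r ≤ ∫⁻ t, (2 : ℝ≥0∞) ^ (r - 1) * (c₁ t ^ r + c₂ t ^ r) :=
          lintegral_mono fun t => ENNReal.rpow_add_le_mul_rpow_add_rpow _ _ (by linarith)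
      _ = (2 : ℝ≥0∞) ^ (r - 1) * ((∫⁻ t, c₁ t ^ r) + ∫⁻ t, c₂ t ^ r) := by
          rw [lintegral_const_mul' _ _ h2t, lintegral_add_left (hc₁m.pow_const r)]
      _ ≤ (2 : ℝ≥0∞) ^ (r - 1) * (E₁ * X ^ (r / p) + E₂ * X ^ (r / p)) := by gcongr
      _ = (E ^ (1 / r) * eLpNorm v (ENNReal.ofReal p) volume) ^ r := by
          rw [hvX, ENNReal.mul_rpow_of_nonneg _ _ hr0.le, ← ENNReal.rpow_mul, ← ENNReal.rpow_mul,
            one_div_mul_cancel hr0.ne', ENNReal.rpow_one, show 1 / p * r = r / p by ring, hE]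
          ring

end StableSemigroup

/-! ### Functionals on the domain of an operator induced by elements of the pivot space -/

section AppDual

variable {Y : Type*} [NormedAddCommGroup Y] [InnerProductSpace ℂ Y]

/-- The operator `T` as a bounded operator on its domain with the graph norm. -/
noncomputable def GraphDom.appL (T : Y →ₗ.[ℂ] Y) : GraphDom T →L[ℂ] Y :=
  LinearMap.mkContinuous T.toFun 1 fun x => by
    have h := GraphDom.norm_sq (T := T) x
    rw [one_mul]
    refine le_of_sq_le_sq ?_ (norm_nonneg _)
    rw [h]
    exact le_add_of_nonneg_left (sq_nonneg _)

/-- The functional `x ↦ (z, T x)` on `D(T)`. -/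
noncomputable def appDual (T : Y →ₗ.[ℂ] Y) : Y →L[ℂ] AntiDual T :=
  LinearMap.mkContinuous
    { toFun := fun z => (innerSLFlip ℂ z).comp (GraphDom.appL T)
      map_add' := fun z w => by rw [map_add, ContinuousLinearMap.add_comp]
      map_smul' := fun c z => by rw [map_smul, ContinuousLinearMap.smul_comp, RingHom.id_apply] }
    ‖GraphDom.appL T‖ fun z => by
      change ‖(innerSLFlip ℂ z).comp (GraphDom.appL T)‖ ≤ _
      refine ContinuousLinearMap.opNorm_le_bound _ (by positivity) fun x => ?_
      change ‖inner ℂ (GraphDom.appL T x) z‖ ≤ _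
      refine (norm_inner_le_norm _ _).trans ?_
      rw [mul_right_comm]
      gcongr
      exact (GraphDom.appL T).le_opNorm x

theorem appDual_apply (T : Y →ₗ.[ℂ] Y) (z : Y) (x : GraphDom T) :
    appDual T z x = inner ℂ x.app z := rfl

end AppDual

/-! ### The input-to-state map expressed through regularized states. -/

namespace StableSemigroup

variable {Y U : Type*} [NormedAddCommGroup Y] [InnerProductSpace ℂ Y] [CompleteSpace Y]
  [NormedAddCommGroup U] [InnerProductSpace ℂ U] [CompleteSpace U]
  (S : StableSemigroup Y)

/-- The functional `x ↦ (z, -A* x)` on `D(A*)`: the element `-A z` of `[D(A*)]'`. -/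
noncomputable def extrapDual : Y →L[ℂ] AntiDual S.adjGen := -appDual S.adjGen

theorem extrapDual_apply (z : Y) (x : GraphDom S.adjGen) :
    S.extrapDual z x = inner ℂ (-x.app) z := by
  rw [inner_neg_left]; rfl

theorem extrap_extrapDual (t : ℝ≥0) (z : Y) : S.extrap t (S.extrapDual z) = S.extrapDual (S t z) := by
  ext x
  change S.extrapDual z (S.adjDom t x) = _
  rw [extrapDual_apply, extrapDual_apply, show (S.adjDom t x).app = (S t).adjoint x.app from
    (S.adjGen_comm t x).2, ← map_neg, ContinuousLinearMap.adjoint_inner_left]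

/-- The observation `B* (-A*)⁻¹`. -/
noncomputable def observation (B : U →L[ℂ] AntiDual S.adjGen) : Y →L[ℂ] U :=
  controlAdjoint B ∘L S.toAdjDom

theorem observation_orbit (B : U →L[ℂ] AntiDual S.adjGen) (t : ℝ≥0) (x : Y) :
    S.observation B (S.adjointSemigroup t x) = controlAdjoint B (S.adjDom t (S.toAdjDom x)) := by
  rw [adjDom_toAdjDom]; rfl

/-- Every x in D(A*) is (-A*)⁻¹(-A*x), so (u,B*x) = (K*u,-A*x) with K the bounded observation. The
unbounded control operator is thereby replaced by a bounded one followed by -A. -/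
theorem control_eq_extrapDual (B : U →L[ℂ] AntiDual S.adjGen) (u : U) :
    B u = S.extrapDual ((S.observation B).adjoint u) := by
  ext x
  rw [extrapDual_apply, ContinuousLinearMap.adjoint_inner_right, ← inner_controlAdjoint]
  change inner ℂ (controlAdjoint B x) u = inner ℂ (controlAdjoint B (S.toAdjDom (-x.app))) u
  rw [toAdjDom_neg_app]

theorem isElem_extrapDual {z y : Y} (h : S.negPow 1 one_pos y = z) : IsElem (S.extrapDual z) y := by
  intro x
  rw [extrapDual_apply, ← h]
  conv_rhs => rw [← S.toAdjDom_neg_app x, toAdjDom_val, ← adjoint_negPow,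
    ContinuousLinearMap.adjoint_inner_left]

/-- A common test vector is x = (-A*)^{-α}a = (-A*)⁻¹b, and the claim is (b,z) = (a,w). Pairing x
with (S(t)z - z)/t in both representations gives difference quotients with limits -(a,w) and -(b,z).
This needs no comparison of α with 1, nor any nesting of the two domains. -/
theorem sameFunctional_extrapDual {α : ℝ} (hα : 0 < α) {z w : Y}
    (h : S.negPow 1 one_pos w = S.negPow α hα z) :
    SameFunctional (S.extrapDual z) (appDual (S.adjointSemigroup.fracPow α hα) w) := by
  intro x hx hx'
  rw [extrapDual_apply, appDual_apply]
  set b : Y := -(GraphDom.mk x hx : GraphDom S.adjGen).app with hb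
  set a : Y := (GraphDom.mk x hx' : GraphDom (S.adjointSemigroup.fracPow α hα)).app with ha
  have ea : S.adjointSemigroup.negPow α hα a = x :=
    congrArg GraphDom.val (S.adjointSemigroup.toFracDom_app_self α hα (GraphDom.mk x hx'))
  have eb : S.adjointSemigroup.negPow 1 one_pos b = x :=
    congrArg GraphDom.val (S.toAdjDom_neg_app (GraphDom.mk x hx))
  have h1 := (tendsto_const_nhds (x := a)).inner (𝕜 := ℂ) (S.tendsto_negPow_one w)
  have h2 := (tendsto_const_nhds (x := b)).inner (𝕜 := ℂ) (S.tendsto_negPow_one z)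
  have e : ∀ y, inner ℂ a (S.negPow α hα y) = inner ℂ b (S.negPow 1 one_pos y) := fun y => by
    rw [← ContinuousLinearMap.adjoint_inner_left, ← ContinuousLinearMap.adjoint_inner_left,
      adjoint_negPow, adjoint_negPow, ea, eb]
  have h3 := h1.congr fun t : ℝ≥0 => show _ = inner ℂ b (((t : ℝ)⁻¹ : ℝ) •
      (S t (S.negPow 1 one_pos z) - S.negPow 1 one_pos z)) by
    rw [h, ← negPow_apply_comm, ← negPow_apply_comm, ← map_sub, ← map_sub,
      ← ContinuousLinearMap.map_smul_of_tower, ← ContinuousLinearMap.map_smul_of_tower, e]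
  have := tendsto_nhds_unique h3 h2
  rw [inner_neg_right, inner_neg_right, neg_inj] at this
  exact this.symm

/-- The state reached under a control, up to the identification of the control with a
strongly measurable function on the line that vanishes on `(-∞, 0]`. -/
theorem exists_inputToState_eq (B : U →L[ℂ] AntiDual S.adjGen) {p : ℝ≥0∞} (hp : 1 ≤ p)
    {v : ℝ → U} (hv : MemLp v p halfLine) :
    ∃ v₀ : ℝ → U, StronglyMeasurable v₀ ∧ (∀ t ≤ 0, v₀ t = 0) ∧ MemLp v₀ p volume ∧
      eLpNorm v₀ p volume = eLpNorm v p halfLine ∧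
      ∀ t : ℝ, 0 ≤ t → inputToState S B v t =
        S.extrapDual (S.mild (S.observation B).adjoint (fun σ => v₀ (t - σ))) := by
  set v₁ := hv.1.mk v with hv₁
  have hm₁ : StronglyMeasurable v₁ := hv.1.stronglyMeasurable_mk
  have hae : v =ᵐ[halfLine] v₁ := hv.1.ae_eq_mk
  set v₀ := (Ioi (0 : ℝ)).indicator v₁ with hv₀
  have hm₀ : StronglyMeasurable v₀ := hm₁.indicator measurableSet_Ioi
  have hz : ∀ t ≤ 0, v₀ t = 0 := fun t ht => indicator_of_notMem (by simpa using ht) _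
  have hn : eLpNorm v₀ p volume = eLpNorm v p halfLine := by
    rw [eLpNorm_indicator_eq_eLpNorm_restrict measurableSet_Ioi]
    exact (eLpNorm_congr_ae hae).symm
  have hL : MemLp v₀ p volume := ⟨hm₀.aestronglyMeasurable, hn ▸ hv.2⟩
  refine ⟨v₀, hm₀, hz, hL, hn, fun t ht => ?_⟩
  set D := (S.observation B).adjoint with hD
  have hint : Integrable ((Iic t).indicator v₀) := by
    have e : (Iic t).indicator v₀ = (Ioc 0 t).indicator v₀ := by
      rw [hv₀, indicator_indicator, indicator_indicator]
      congr 1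
      ext s
      simp only [mem_inter_iff, mem_Iic, mem_Ioi, mem_Ioc]
      tauto
    rw [e, integrable_indicator_iff measurableSet_Ioc]
    exact (hL.restrict _).integrable hp
  have hk := S.integrableOn_mildKernel D hm₀ hint
  set f : ℝ → Y := fun σ => S σ.toNNReal (D (v₀ (t - σ))) with hf
  have e1 : inputToState S B v t = ∫ s in (0 : ℝ)..t, S.extrapDual (f (t - s)) := by
    refine intervalIntegral.integral_congr_ae ?_
    have h1 := (ae_restrict_iff' measurableSet_Ioi).1 hae
    filter_upwards [h1] with s hs hst
    rw [uIoc_of_le ht] at hst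
    have e2 : v s = v₀ s := by
      rw [hs hst.1, hv₀, indicator_of_mem (show s ∈ Ioi (0 : ℝ) from hst.1)]
    rw [e2, control_eq_extrapDual, extrap_extrapDual, hf]
    simp only [sub_sub_cancel, hD]
  rw [e1, intervalIntegral.integral_comp_sub_left (fun σ => S.extrapDual (f σ)) t, sub_self,
    sub_zero, ContinuousLinearMap.intervalIntegral_comp_comm]
  · congr 1
    rw [intervalIntegral.integral_of_le ht, mild]
    -- The history v₀(t-σ) vanishes for σ ≥ t, so the integral over (0,t] is the one over the
    -- half-line.
    refine (setIntegral_eq_of_subset_of_forall_sdiff_eq_zero measurableSet_Ioi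
      Ioc_subset_Ioi_self fun σ hσ => ?_).symm
    have h2 : t - σ ≤ 0 := by
      by_contra h3
      exact hσ.2 ⟨hσ.1, by linarith⟩
    change S σ.toNNReal (D (v₀ (t - σ))) = 0
    rw [hz _ h2, map_zero, map_zero]
  · rw [intervalIntegrable_iff_integrableOn_Ioc_of_le ht]
    exact hk.mono_set Ioc_subset_Ioi_self

/-- Transfer of an `L^p → L^r` bound for the regularized states to the input-to-state map. -/
theorem mapsLpLp_inputToState (B : U →L[ℂ] AntiDual S.adjGen) {E : Type*} [NormedAddCommGroup E]
    [NormedSpace ℂ E] {J : AntiDual S.adjGen → E → Prop} {P : Y → Y → Prop} (Λ : Y →L[ℂ] E)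
    (hJ : ∀ z w, P z w → J (S.extrapDual z) (Λ w)) {p r : ℝ≥0∞} (hp : 1 ≤ p)
    (h : ∃ C : ℝ≥0, ∀ v : ℝ → U, StronglyMeasurable v → MemLp v p volume →
      ∃ w : ℝ → Y, MemLp w r volume ∧
        (∀ᵐ t, P (S.mild (S.observation B).adjoint (fun σ => v (t - σ))) (w t)) ∧
        eLpNorm w r volume ≤ C * eLpNorm v p volume) :
    MapsLpLp J (inputToState S B) p r := by
  obtain ⟨C, hC⟩ := h
  refine ⟨‖Λ‖₊ * C, fun v hv => ?_⟩
  obtain ⟨v₀, hm, -, hL, hn, hstate⟩ := S.exists_inputToState_eq B hp hv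
  obtain ⟨w, hw, hwP, hwn⟩ := hC v₀ hm hL
  refine ⟨fun t => Λ (w t), Λ.comp_memLp' (hw.restrict _), ?_, ?_⟩
  · filter_upwards [ae_restrict_of_ae (s := Ioi (0 : ℝ)) hwP, ae_restrict_mem measurableSet_Ioi]
      with t ht ht0
    rw [hstate t (le_of_lt ht0)]
    exact hJ _ _ ht
  · calc eLpNorm (fun t => Λ (w t)) r halfLine ≤ ‖Λ‖₊ • eLpNorm w r halfLine :=
          eLpNorm_le_nnreal_smul_eLpNorm_of_ae_le_mul
            (Eventually.of_forall fun t => Λ.le_opNorm _) r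
      _ ≤ ‖Λ‖₊ • (C * eLpNorm v p halfLine) := by
          gcongr
          rw [← hn]
          exact (eLpNorm_restrict_le _ _ _ _).trans hwn
      _ = _ := by
          rw [ENNReal.smul_def, smul_eq_mul, ENNReal.coe_mul, mul_assoc]

/-- Transfer of an `L^p → C_b` bound for the regularized states to the input-to-state map. -/
theorem mapsLpCb_inputToState (B : U →L[ℂ] AntiDual S.adjGen) {E : Type*} [NormedAddCommGroup E]
    [NormedSpace ℂ E] {J : AntiDual S.adjGen → E → Prop} {P : Y → Y → Prop} (Λ : Y →L[ℂ] E)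
    (hJ : ∀ z w, P z w → J (S.extrapDual z) (Λ w)) {p : ℝ≥0∞} (hp : 1 ≤ p)
    (h : ∃ C : ℝ≥0, ∀ v : ℝ → U, StronglyMeasurable v → (∀ t ≤ 0, v t = 0) → MemLp v p volume →
      ∃ w : BoundedContinuousFunction ℝ≥0 Y,
        (∀ t : ℝ≥0, P (S.mild (S.observation B).adjoint (fun σ => v (t - σ))) (w t)) ∧
        ‖w‖ₑ ≤ C * eLpNorm v p volume) :
    MapsLpCb J (inputToState S B) p := by
  obtain ⟨C, hC⟩ := h
  refine ⟨‖Λ.compLeftContinuousBounded ℝ≥0‖₊ * C, fun v hv => ?_⟩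
  obtain ⟨v₀, hm, hz, hL, hn, hstate⟩ := S.exists_inputToState_eq B hp hv
  obtain ⟨w, hwP, hwn⟩ := hC v₀ hm hz hL
  refine ⟨Λ.compLeftContinuousBounded ℝ≥0 w, fun t => ?_, ?_⟩
  · rw [hstate t t.2]
    exact hJ _ _ (hwP t)
  · refine ((Λ.compLeftContinuousBounded ℝ≥0).le_opENorm w).trans ?_
    rw [← hn, ENNReal.coe_mul, mul_assoc]
    exact mul_le_mul' le_rfl hwn

end StableSemigroup

theorem MapsLpCb.mapsLpLp_top {U V E : Type*} [NormedAddCommGroup U] [NormedAddCommGroup E]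
    {J : V → E → Prop} {L : (ℝ → U) → ℝ → V} {p : ℝ≥0∞} (h : MapsLpCb J L p) :
    MapsLpLp J L p ∞ := by
  obtain ⟨C, hC⟩ := h
  refine ⟨C, fun v hv => ?_⟩
  obtain ⟨y, hy, hyn⟩ := hC v hv
  have hle : eLpNorm (fun t : ℝ => y t.toNNReal) ∞ halfLine ≤ ‖y‖ₑ :=
    eLpNormEssSup_le_of_ae_enorm_bound (Eventually.of_forall fun t => by
      simpa [enorm_le_iff_norm_le] using y.norm_coe_le_norm t.toNNReal)
  refine ⟨fun t => y t.toNNReal, ⟨?_, hle.trans_lt enorm_lt_top⟩, ?_, hle.trans hyn⟩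
  · exact (y.continuous.comp continuous_real_toNNReal).aestronglyMeasurable
  · filter_upwards [ae_restrict_mem measurableSet_Ioi] with t ht
    have := hy t.toNNReal
    rwa [Real.coe_toNNReal _ (le_of_lt ht)] at this

/-! ### Bounds from the decomposition of the observation into F and G. -/

namespace StableSemigroup

variable {Y U : Type*} [NormedAddCommGroup Y] [InnerProductSpace ℂ Y] [CompleteSpace Y]
  [NormedAddCommGroup U] [InnerProductSpace ℂ U] [CompleteSpace U]
  (S : StableSemigroup Y)

section Decomposition

variable (B : U →L[ℂ] AntiDual S.adjGen) {F : ℝ → Y →L[ℂ] U}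
  {G : ℝ → GraphDom S.adjGen →L[ℂ] U} {γ N : ℝ}

theorem enorm_observation_le (hFG : ∀ t : ℝ≥0, 0 < t → ∀ x : GraphDom S.adjGen,
      controlAdjoint B (S.adjDom t x) = F t x.val + G t x)
    (hF : ∀ t : ℝ, 0 < t → ‖F t‖ ≤ N * t ^ (-γ)) {σ : ℝ} (hσ : 0 < σ) (x : Y) :
    ‖S.observation B (S.adjointSemigroup σ.toNNReal x)‖ₑ ≤
      ENNReal.ofReal (N * σ ^ (-γ)) * ‖(S.negPow 1 one_pos).adjoint x‖ₑ
        + ‖G σ (S.toAdjDom x)‖ₑ := by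
  rw [observation_orbit, hFG _ (Real.toNNReal_pos.2 hσ), Real.coe_toNNReal _ hσ.le, toAdjDom_val,
    adjoint_negPow]
  refine (enorm_add_le _ _).trans (add_le_add ((F σ).le_opENorm _ |>.trans ?_) le_rfl)
  gcongr
  rw [← ofReal_norm]
  exact ENNReal.ofReal_le_ofReal (hF σ hσ)

variable {T₁ : ℝ} (hG : ∀ (p : ℝ≥0∞) [Fact (1 ≤ p)], p ≠ ∞ →
      ∃ Ψ : Y →L[ℂ] Lp U p (volume.restrict (Ioo 0 T₁)), ∀ x : GraphDom S.adjGen,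
        Ψ x.val =ᵐ[volume.restrict (Ioo 0 T₁)] fun t => G t x)
include hG

-- The extension Ψ of G is bounded for the norm of Y, so G composed with (-A*)⁻¹ is controlled by
-- ‖(-A*)⁻¹x‖ itself, the quantity required by Douglas' lemma.
omit [CompleteSpace U] in
theorem exists_lintegral_regular_le {s : ℝ} (hs : 1 ≤ s) :
    (∀ x, AEMeasurable (fun σ => ‖G σ (S.toAdjDom x)‖ₑ) (volume.restrict (Ioc 0 T₁))) ∧
    ∃ C : ℝ≥0, ∀ x, ∫⁻ σ in Ioc 0 T₁, ‖G σ (S.toAdjDom x)‖ₑ ^ s ≤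
      C * ‖(S.negPow 1 one_pos).adjoint x‖ₑ ^ s := by
  have hs0 : 0 < s := by linarith
  have : Fact (1 ≤ ENNReal.ofReal s) := ⟨by
    rw [← ENNReal.ofReal_one]; exact ENNReal.ofReal_le_ofReal hs⟩
  obtain ⟨Ψ, hΨ⟩ := hG (ENNReal.ofReal s) ENNReal.ofReal_ne_top
  rw [← restrict_Ioo_eq_restrict_Ioc]
  refine ⟨fun x => ((Lp.aestronglyMeasurable _).congr (hΨ (S.toAdjDom x))).enorm,
    ‖Ψ‖₊ ^ s, fun x => ?_⟩
  have h := lintegral_enorm_Lp_rpow_le ENNReal.ofReal_ne_top Ψ ((S.negPow 1 one_pos).adjoint x)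
  rw [ENNReal.toReal_ofReal hs0.le] at h
  rw [ENNReal.coe_rpow_of_nonneg _ hs0.le, ← enorm_eq_nnnorm]
  refine le_trans (le_of_eq (lintegral_congr_ae ?_)) h
  filter_upwards [hΨ (S.toAdjDom x)] with σ hσ
  rw [adjoint_negPow, ← toAdjDom_val, hσ]

variable (hFG : ∀ t : ℝ≥0, 0 < t → ∀ x : GraphDom S.adjGen,
      controlAdjoint B (S.adjDom t x) = F t x.val + G t x)
  (hF : ∀ t : ℝ, 0 < t → ‖F t‖ ≤ N * t ^ (-γ))
  (hγ0 : 0 ≤ γ) (hγ1 : γ < 1) (hN : 0 ≤ N) (hT₁ : 0 < T₁)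
include hFG hF hγ0 hγ1 hN hT₁

/-- The Hardy-Littlewood-Sobolev range of `L^p → L^r` bounds for the input-to-state map. -/
theorem mapsLpLp_isElem {p r : ℝ} (hp : 1 < p) (hpr : p ≤ r) (hγ : 1 / p - 1 / r ≤ 1 - γ) :
    MapsLpLp IsElem (inputToState S B) (ENNReal.ofReal p) (ENNReal.ofReal r) := by
  have hs := (Real.HolderConjugate.conjExponent hp).symm
  obtain ⟨hm, C, hC⟩ := S.exists_lintegral_regular_le hG hs.lt.le
  refine S.mapsLpLp_inputToState B (P := fun z w => S.negPow 1 one_pos w = z)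
    (ContinuousLinearMap.id ℂ Y) (fun z w h => S.isElem_extrapDual h) ?_
    (S.exists_memLp_preimage_of_singular (S.observation B) (fun σ x => G σ (S.toAdjDom x))
      hγ0 hγ1 hN hT₁ (fun σ hσ x => S.enorm_observation_le B hFG hF hσ.1 x) hm hpr hγ hs C hC)
  rw [← ENNReal.ofReal_one]
  exact ENNReal.ofReal_le_ofReal hp.le

/-- The supercritical `L^p → C_b` bounds for the input-to-state map. -/
theorem mapsLpCb_isElem {p : ℝ≥0∞} {p₀ : ℝ} (hp₀ : 1 / (1 - γ) < p₀) (hp : ENNReal.ofReal p₀ ≤ p) :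
    MapsLpCb IsElem (inputToState S B) p := by
  have hγ' : 0 < 1 - γ := by linarith
  have hp₀1 : 1 < p₀ := lt_of_le_of_lt ((one_le_div hγ').2 (by linarith)) hp₀
  have hs := (Real.HolderConjugate.conjExponent hp₀1).symm
  set s := Real.conjExponent p₀ with hsdef
  have hs0 := hs.pos
  -- The supercritical condition p₀ > 1/(1-γ), for the conjugate exponent s: it makes σ^{-γ}
  -- s-integrable at zero, so F and G can be treated alike.
  have hγs : γ * s < 1 := by
    have h1 := hs.inv_add_inv_eq_one
    have h2 : p₀⁻¹ < 1 - γ := by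
      rw [inv_lt_comm₀ (by linarith) hγ', ← one_div]
      exact hp₀
    have h3 : γ < s⁻¹ := by linarith
    calc γ * s < s⁻¹ * s := mul_lt_mul_of_pos_right h3 hs0
      _ = 1 := inv_mul_cancel₀ hs0.ne'
  obtain ⟨hm, C, hC⟩ := S.exists_lintegral_regular_le hG hs.lt.le
  set A : ℝ≥0∞ := ∫⁻ σ in Ioc 0 T₁, ENNReal.ofReal (N * σ ^ (-γ)) ^ s with hA
  have hAt : A ≠ ⊤ := by
    have e : ∀ σ ∈ Ioc 0 T₁, ENNReal.ofReal (N * σ ^ (-γ)) ^ s =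
        ENNReal.ofReal (N ^ s) * ENNReal.ofReal (σ ^ (-(γ * s))) := fun σ hσ => by
      have h1 : 0 ≤ σ ^ (-γ) := Real.rpow_nonneg hσ.1.le _
      rw [ENNReal.ofReal_rpow_of_nonneg (mul_nonneg hN h1) hs0.le, Real.mul_rpow hN h1,
        ← Real.rpow_mul hσ.1.le, neg_mul, ENNReal.ofReal_mul (Real.rpow_nonneg hN _)]
    rw [hA, setLIntegral_congr_fun measurableSet_Ioc e,
      lintegral_const_mul' _ _ ENNReal.ofReal_ne_top]
    exact ENNReal.mul_ne_top ENNReal.ofReal_ne_top (lintegral_Ioc_rpow_neg_ne_top hγs hT₁.le)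
  have h2t : (2 : ℝ≥0∞) ^ (s - 1) ≠ ⊤ :=
    ENNReal.rpow_ne_top_of_nonneg (by linarith [hs.lt]) (by simp)
  set C' : ℝ≥0∞ := (2 : ℝ≥0∞) ^ (s - 1) * (A + C) with hC'
  have hC't : C' ≠ ⊤ := ENNReal.mul_ne_top h2t (ENNReal.add_ne_top.2 ⟨hAt, ENNReal.coe_ne_top⟩)
  refine S.mapsLpCb_inputToState B (P := fun z w => S.negPow 1 one_pos w = z)
    (ContinuousLinearMap.id ℂ Y) (fun z w h => S.isElem_extrapDual h) ?_
    (S.exists_boundedContinuousFunction_preimage (S.observation B) (S.negPow 1 one_pos)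
      (fun t x => (S.negPow_apply_comm 1 one_pos t x).symm) (S.negPow_injective 1 one_pos)
      hs hT₁ C'.toNNReal (fun x => ?_) hp)
  · refine le_trans ?_ hp
    rw [← ENNReal.ofReal_one]
    exact ENNReal.ofReal_le_ofReal hp₀1.le
  · rw [ENNReal.coe_toNNReal hC't]
    set X := ‖(S.negPow 1 one_pos).adjoint x‖ₑ
    have hm1 : Measurable fun σ : ℝ => ENNReal.ofReal (N * σ ^ (-γ)) ^ s := by fun_prop
    calc ∫⁻ σ in Ioc 0 T₁, ‖S.observation B (S.adjointSemigroup σ.toNNReal x)‖ₑ ^ s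
        ≤ ∫⁻ σ in Ioc 0 T₁, (2 : ℝ≥0∞) ^ (s - 1) * (ENNReal.ofReal (N * σ ^ (-γ)) ^ s * X ^ s +
            ‖G σ (S.toAdjDom x)‖ₑ ^ s) := by
          refine setLIntegral_mono' measurableSet_Ioc fun σ hσ => ?_
          rw [← ENNReal.mul_rpow_of_nonneg _ _ hs0.le]
          exact (ENNReal.rpow_le_rpow (S.enorm_observation_le B hFG hF hσ.1 x) hs0.le).trans
            (ENNReal.rpow_add_le_mul_rpow_add_rpow _ _ hs.lt.le)
      _ = (2 : ℝ≥0∞) ^ (s - 1) * (A * X ^ s +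
            ∫⁻ σ in Ioc 0 T₁, ‖G σ (S.toAdjDom x)‖ₑ ^ s) := by
          rw [lintegral_const_mul' _ _ h2t, lintegral_add_left (hm1.mul_const _),
            lintegral_mul_const _ hm1]
      _ ≤ (2 : ℝ≥0∞) ^ (s - 1) * (A * X ^ s + C * X ^ s) := by
          gcongr
          exact hC x
      _ = C' * X ^ s := by rw [hC', ← add_mul, mul_assoc]

end Decomposition

/-- Admissibility of `(-A*)^ε` in the observation gives states in `D((-A)^ε)`. -/
theorem mapsLpCb_fracPow (B : U →L[ℂ] AntiDual S.adjGen) {T ε : ℝ} (hT : 0 < T) (hε : 0 < ε)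
    {q : ℝ≥0∞} [Fact (1 ≤ q)] (hq1 : 1 < q) (hq : q ≠ ∞)
    (hBq : ∃ Ψ : Y →L[ℂ] Lp U q (volume.restrict (Ioo 0 T)),
      ∀ (x : GraphDom (S.adjointSemigroup.fracPow ε hε)) (h : x.app ∈ S.adjGen.domain),
        Ψ x.val =ᵐ[volume.restrict (Ioo 0 T)]
          fun t => controlAdjoint B (S.adjDom t.toNNReal (GraphDom.mk x.app h)))
    {r : ℝ≥0∞} (hr : ENNReal.conjExponent q ≤ r) :
    MapsLpCb (E := GraphDom (S.fracPow ε hε)) (fun φ y => IsElem φ y.val)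
      (inputToState S B) r := by
  have hq't : ENNReal.conjExponent q ≠ ∞ := by
    rw [ENNReal.conjExponent]
    exact ENNReal.add_ne_top.2 ⟨ENNReal.one_ne_top, ENNReal.inv_ne_top.2 (tsub_pos_of_lt hq1).ne'⟩
  have hs : q.toReal.HolderConjugate (ENNReal.conjExponent q).toReal :=
    ENNReal.HolderConjugate.toReal_of_ne_top hq hq't
  obtain ⟨Ψ, hΨ⟩ := hBq
  have hs0 := hs.pos
  set R := S.negPow 1 one_pos with hR
  -- If z = R(-A)^{-ε}w, then the state -Az equals (-A)^{-ε}w, which lies in D((-A)^ε) with graph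
  -- norm controlled by ‖w‖.
  set Q := R ∘L S.negPow ε hε with hQ
  refine S.mapsLpCb_inputToState B (P := fun z w => Q w = z) (S.toFracDom ε hε) (fun z w h => ?_)
    (le_trans (by rw [ENNReal.conjExponent]; exact le_self_add) hr)
    (S.exists_boundedContinuousFunction_preimage (S.observation B) Q (fun t x => ?_) ?_
      hs hT (‖Ψ‖₊ ^ q.toReal) (fun x => ?_) (by rwa [ENNReal.ofReal_toReal hq't]))
  · rw [toFracDom_val]
    exact S.isElem_extrapDual h
  · rw [hQ, ContinuousLinearMap.comp_apply, ContinuousLinearMap.comp_apply, hR, negPow_apply_comm,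
      negPow_apply_comm]
  · exact (S.negPow_injective 1 one_pos).comp (S.negPow_injective ε hε)
  · rw [ENNReal.coe_rpow_of_nonneg _ hs0.le, ← enorm_eq_nnnorm,
      ← restrict_Ioo_eq_restrict_Ioc]
    -- The vector a is Q*x, and its image under (-A*)^ε is (-A*)⁻¹x. The hypothesis at a therefore
    -- bounds the regularized observation of x by ‖Q*x‖.
    set a : GraphDom (S.adjointSemigroup.fracPow ε hε) :=
      S.adjointSemigroup.toFracDom ε hε (S.adjointSemigroup.negPow 1 one_pos x) with ha
    have ha1 : a.app = S.adjointSemigroup.negPow 1 one_pos x :=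
      S.adjointSemigroup.toFracDom_app ε hε _
    have ha2 : a.app ∈ S.adjGen.domain := by rw [ha1]; exact S.adjoint_negPow_one_mem x
    have ha3 : (GraphDom.mk a.app ha2 : GraphDom S.adjGen) = S.toAdjDom x := Subtype.ext ha1
    have ha4 : Q.adjoint x = a.val := by
      rw [hQ, ContinuousLinearMap.adjoint_comp, ContinuousLinearMap.comp_apply, hR, adjoint_negPow,
        adjoint_negPow]
      rfl
    rw [ha4]
    refine le_trans (le_of_eq (lintegral_congr_ae ?_)) (lintegral_enorm_Lp_rpow_le hq Ψ a.val)
    filter_upwards [hΨ a ha2] with σ hσ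
    rw [hσ, ha3, observation_orbit]

end StableSemigroup

/-! ### The L¹ bound in the dual of the fractional domain. -/

namespace StableSemigroup

variable {Y U : Type*} [NormedAddCommGroup Y] [InnerProductSpace ℂ Y] [CompleteSpace Y]
  [NormedAddCommGroup U] [InnerProductSpace ℂ U] [CompleteSpace U]
  (S : StableSemigroup Y)

/-- The regularized observation `B* (-A*)⁻¹ (-A*)^{-ε}` has an integrable singularity. -/
theorem exists_observation_negPow_le (B : U →L[ℂ] AntiDual S.adjGen) {F : ℝ → Y →L[ℂ] U}
    {G : ℝ → GraphDom S.adjGen →L[ℂ] U} {γ N T ε : ℝ} (hγ0 : 0 ≤ γ) (hN : 0 ≤ N) (hT : 0 < T)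
    (hε : 0 < ε)
    (hFG : ∀ t : ℝ≥0, 0 < t → ∀ x : GraphDom S.adjGen,
      controlAdjoint B (S.adjDom t x) = F t x.val + G t x)
    (hF : ∀ t : ℝ, 0 < t → ‖F t‖ ≤ N * t ^ (-γ))
    (hGε : ∃ Ψ : Y →L[ℂ] C(Icc (0 : ℝ) T, U), ∀ (y : Y)
      (h : S.adjointSemigroup.negPow ε hε y ∈ S.adjGen.domain) (t : Icc (0 : ℝ) T),
        0 < (t : ℝ) → Ψ y t = G t (GraphDom.mk (S.adjointSemigroup.negPow ε hε y) h)) :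
    ∃ C : ℝ, 0 ≤ C ∧ ∀ σ ∈ Ioc 0 T, ∀ x,
      ‖(S.observation B ∘L S.adjointSemigroup.negPow ε hε) (S.adjointSemigroup σ.toNNReal x)‖ₑ ≤
        ENNReal.ofReal (C * σ ^ (-γ)) * ‖(S.negPow 1 one_pos).adjoint x‖ₑ := by
  obtain ⟨Ψ, hΨ⟩ := hGε
  set E := S.adjointSemigroup.negPow ε hε with hE
  -- On (0,T] one has 1 ≤ T^γ σ^{-γ}, so the bounded contribution of G is absorbed into the singular
  -- bound for F.
  refine ⟨N * ‖E‖ + ‖Ψ‖ * T ^ γ, by positivity, fun σ hσ x => ?_⟩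
  set y := (S.negPow 1 one_pos).adjoint x with hy
  have hcomm : S.adjointSemigroup.negPow 1 one_pos (E x) = E y := by
    rw [hy, adjoint_negPow, hE, negPow_negPow_comm]
  have hmem : E y ∈ S.adjGen.domain := by rw [← hcomm]; exact S.adjoint_negPow_one_mem _
  have hdom : S.toAdjDom (E x) = GraphDom.mk (E y) hmem := Subtype.ext hcomm
  have e : (S.observation B ∘L E) (S.adjointSemigroup σ.toNNReal x) = F σ (E y) +
      Ψ y ⟨σ, hσ.1.le, hσ.2⟩ := by
    have horb : E (S.adjointSemigroup σ.toNNReal x) = S.adjointSemigroup σ.toNNReal (E x) :=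
      S.adjointSemigroup.negPow_apply_comm ε hε _ x
    rw [hΨ y hmem _ hσ.1, ContinuousLinearMap.comp_apply, horb, observation_orbit, hdom, hFG _ (Real.toNNReal_pos.2 hσ.1), Real.coe_toNNReal _ hσ.1.le]
    rfl
  have hσγ : 1 ≤ T ^ γ * σ ^ (-γ) := by
    rw [Real.rpow_neg hσ.1.le, ← div_eq_mul_inv, one_le_div (Real.rpow_pos_of_pos hσ.1 _)]
    exact Real.rpow_le_rpow hσ.1.le hσ.2 hγ0
  have hσ0 : 0 ≤ σ ^ (-γ) := Real.rpow_nonneg hσ.1.le _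
  rw [e, ← ofReal_norm, ← ofReal_norm, ← ENNReal.ofReal_mul (by positivity)]
  refine ENNReal.ofReal_le_ofReal ?_
  calc ‖F σ (E y) + Ψ y ⟨σ, hσ.1.le, hσ.2⟩‖
      ≤ (N * σ ^ (-γ)) * (‖E‖ * ‖y‖) + ‖Ψ‖ * ‖y‖ * (T ^ γ * σ ^ (-γ)) := by
        refine (norm_add_le _ _).trans (add_le_add ?_ ?_)
        · exact ((F σ).le_of_opNorm_le (hF σ hσ.1) _).trans (by gcongr; exact E.le_opNorm y)
        · refine ((Ψ y).norm_coe_le_norm _).trans ((Ψ.le_opNorm y).trans ?_)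
          exact le_mul_of_one_le_right (by positivity) hσγ
    _ = _ := by ring

/-- The `L^1 → L^r` bound for the input-to-state map in `[D((-A*)^ε)]'`. -/
theorem mapsLpLp_sameFunctional (B : U →L[ℂ] AntiDual S.adjGen) {F : ℝ → Y →L[ℂ] U}
    {G : ℝ → GraphDom S.adjGen →L[ℂ] U} {γ N T ε : ℝ} (hγ0 : 0 ≤ γ) (hN : 0 ≤ N) (hT : 0 < T)
    (hε : 0 < ε)
    (hFG : ∀ t : ℝ≥0, 0 < t → ∀ x : GraphDom S.adjGen,
      controlAdjoint B (S.adjDom t x) = F t x.val + G t x)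
    (hF : ∀ t : ℝ, 0 < t → ‖F t‖ ≤ N * t ^ (-γ))
    (hGε : ∃ Ψ : Y →L[ℂ] C(Icc (0 : ℝ) T, U), ∀ (y : Y)
      (h : S.adjointSemigroup.negPow ε hε y ∈ S.adjGen.domain) (t : Icc (0 : ℝ) T),
        0 < (t : ℝ) → Ψ y t = G t (GraphDom.mk (S.adjointSemigroup.negPow ε hε y) h))
    {r : ℝ} (hr : 1 ≤ r) (hγr : γ * r < 1) :
    MapsLpLp (E := AntiDual (S.adjointSemigroup.fracPow ε hε)) SameFunctional
      (inputToState S B) 1 (ENNReal.ofReal r) := by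
  have hr0 : 0 < r := by linarith
  set K := S.observation B ∘L S.adjointSemigroup.negPow ε hε with hK
  obtain ⟨C, hC0, hC⟩ := S.exists_observation_negPow_le B hγ0 hN hT hε hFG hF hGε
  have hT2 : 0 < T / 2 := by positivity
  -- Decay is started from (T/2,T], where the singular bound is at most its value at T/2. Thus k₁
  -- dominates the observation up to T and k₂ beyond; k₁ is r-integrable because γr < 1.
  obtain ⟨δ, hδ, C', hC'0, hC'⟩ := exists_pointwise_decay (S := S) K (S.negPow 1 one_pos)
    (fun t x => (S.negPow_apply_comm 1 one_pos t x).symm) hT2.le hT2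
    (C * (T / 2) ^ (-γ)).toNNReal (fun σ hσ x => (hC σ ⟨hT2.trans hσ.1, by linarith [hσ.2]⟩ x).trans
      (by
        change _ ≤ ENNReal.ofReal _ * _
        gcongr ENNReal.ofReal (C * ?_) * _
        exact Real.rpow_le_rpow_of_nonpos hT2 hσ.1.le (by linarith)))
  set k₁ : ℝ → ℝ≥0∞ := (Ioc 0 T).indicator fun σ => ENNReal.ofReal (C * σ ^ (-γ)) with hk₁
  set k₂ : ℝ → ℝ≥0∞ := fun σ => ENNReal.ofReal (C' * Real.exp (-δ * σ)) with hk₂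
  have hk₁m : Measurable k₁ := Measurable.indicator (by fun_prop) measurableSet_Ioc
  have hk₂m : Measurable k₂ := by fun_prop
  have hKk : ∀ σ, 0 < σ → ∀ x, ‖K (S.adjointSemigroup σ.toNNReal x)‖ₑ ≤
      (k₁ σ + k₂ σ) * ‖(S.negPow 1 one_pos).adjoint x‖ₑ := by
    intro σ hσ x
    by_cases h : σ ≤ T
    · refine (hC σ ⟨hσ, h⟩ x).trans (mul_le_mul' ?_ le_rfl)
      rw [hk₁, indicator_of_mem (show σ ∈ Ioc 0 T from ⟨hσ, h⟩)]
      exact le_self_add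
    · exact (hC' σ (by linarith) x).trans (mul_le_mul' le_add_self le_rfl)
  have hI₁ : ∫⁻ σ in Ioi (0 : ℝ), k₁ σ ^ r ≠ ⊤ := by
    have e : ∀ σ, k₁ σ ^ r = (Ioc 0 T).indicator (fun σ =>
        ENNReal.ofReal (C ^ r) * ENNReal.ofReal (σ ^ (-(γ * r)))) σ := fun σ => by
      by_cases h : σ ∈ Ioc 0 T
      · have h1 : 0 ≤ σ ^ (-γ) := Real.rpow_nonneg h.1.le _
        rw [hk₁, indicator_of_mem h, indicator_of_mem h,
          ENNReal.ofReal_rpow_of_nonneg (mul_nonneg hC0 h1) hr0.le, Real.mul_rpow hC0 h1,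
          ← Real.rpow_mul h.1.le, neg_mul, ENNReal.ofReal_mul (Real.rpow_nonneg hC0 _)]
      · rw [hk₁, indicator_of_notMem h, indicator_of_notMem h, ENNReal.zero_rpow_of_pos hr0]
    simp_rw [e]
    rw [setLIntegral_indicator measurableSet_Ioc, inter_eq_self_of_subset_left Ioc_subset_Ioi_self,
      lintegral_const_mul' _ _ ENNReal.ofReal_ne_top]
    exact ENNReal.mul_ne_top ENNReal.ofReal_ne_top (lintegral_Ioc_rpow_neg_ne_top hγr hT.le)
  have hI₂ : ∫⁻ σ in Ioi (0 : ℝ), k₂ σ ^ r ≠ ⊤ := by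
    have h1 := ((memLp_exp_neg hδ (q := ENNReal.ofReal r) (by simpa using hr0)).const_mul
      C').eLpNorm_ne_top
    rw [eLpNorm_ofReal_exponent hr0] at h1
    have h2 := ENNReal.rpow_ne_top_of_nonneg hr0.le h1
    rw [← ENNReal.rpow_mul, one_div_mul_cancel hr0.ne', ENNReal.rpow_one] at h2
    convert h2 using 3 with σ
    rw [hk₂, Real.enorm_of_nonneg (by positivity)]
  have hI : ∫⁻ σ in Ioi (0 : ℝ), (k₁ σ + k₂ σ) ^ r ≠ ⊤ := by
    refine ne_top_of_le_ne_top ?_ (lintegral_mono fun σ =>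
      ENNReal.rpow_add_le_mul_rpow_add_rpow (k₁ σ) (k₂ σ) hr)
    have h2t : (2 : ℝ≥0∞) ^ (r - 1) ≠ ⊤ :=
      ENNReal.rpow_ne_top_of_nonneg (by linarith) (by simp)
    rw [lintegral_const_mul' _ _ h2t, lintegral_add_left (hk₁m.pow_const r)]
    exact ENNReal.mul_ne_top h2t (ENNReal.add_ne_top.2 ⟨hI₁, hI₂⟩)
  obtain ⟨C₃, hC₃⟩ := S.exists_memLp_preimage_of_kernel K (hk₁m.add hk₂m) hKk hr hI
  refine S.mapsLpLp_inputToState B (P := fun z w => S.negPow 1 one_pos w = S.negPow ε hε z)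
    (appDual (S.adjointSemigroup.fracPow ε hε)) (fun z w h => S.sameFunctional_extrapDual hε h)
    le_rfl ⟨C₃, fun v hvm hv => ?_⟩
  obtain ⟨w, hw, hwae, hwn⟩ := hC₃ v hvm hv
  refine ⟨w, hw, ?_, hwn⟩
  filter_upwards [hwae] with t ht
  -- The adjoint of the smoothed observation is (-A)^{-ε} times that of the original, and (-A)^{-ε}
  -- commutes with the semigroup. The state it generates is therefore (-A)^{-ε} applied to the
  -- regularized state.
  rw [ht, hK, ContinuousLinearMap.adjoint_comp, ← adjoint_negPow,
    ContinuousLinearMap.adjoint_adjoint]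
  exact map_mild _ _ _ (fun h x => (S.negPow_apply_comm ε hε h x).symm) _
    (S.integrableOn_mildKernel _ hvm ((memLp_one_iff_integrable.1 hv).indicator measurableSet_Iic))

end StableSemigroup

/-! ### Assembly of the five claims. -/

theorem proposition2p6
    {Y U : Type*}
    [NormedAddCommGroup Y] [InnerProductSpace ℂ Y] [CompleteSpace Y]
    [TopologicalSpace.SeparableSpace Y]
    [NormedAddCommGroup U] [InnerProductSpace ℂ U] [CompleteSpace U]
    [TopologicalSpace.SeparableSpace U]
    -- the semigroup `e^{At}` and the control operator `B`
    (S : StableSemigroup Y) (B : U →L[ℂ] AntiDual S.adjGen)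
    -- the decomposition `B* e^{A* t} x = F(t) x + G(t) x`
    (F : ℝ → Y →L[ℂ] U) (G : ℝ → GraphDom S.adjGen →L[ℂ] U)
    (hFG : ∀ t : ℝ≥0, 0 < t → ∀ x : GraphDom S.adjGen,
      controlAdjoint B (S.adjDom t x) = F t x.val + G t x)
    -- the singular estimate for `F`
    (γ η N : ℝ) (hγ0 : 0 < γ) (hγ1 : γ < 1) (hη : 0 < η) (hN : 0 < N)
    (hF : ∀ t : ℝ, 0 < t → ‖F t‖ ≤ N * t ^ (-γ) * Real.exp (-η * t))
    -- `G(·) ∈ L(Y, L^p(0,T₁;U))` for all finite `p ≥ 1`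
    (T₁ : ℝ) (hT₁ : 0 < T₁)
    (hG : ∀ (p : ℝ≥0∞) [Fact (1 ≤ p)], p ≠ ∞ →
      ∃ Ψ : Y →L[ℂ] Lp U p (volume.restrict (Ioo 0 T₁)), ∀ x : GraphDom S.adjGen,
        Ψ x.val =ᵐ[volume.restrict (Ioo 0 T₁)] fun t => G t x)
    (T ε : ℝ) (hT : 0 < T) (hε : 0 < ε)
    -- `G(·) A*^{-ε} ∈ L(Y, C([0,T];U))`
    (hGε : ∃ Ψ : Y →L[ℂ] C(Icc (0 : ℝ) T, U), ∀ (y : Y)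
      (h : S.adjointSemigroup.negPow ε hε y ∈ S.adjGen.domain) (t : Icc (0 : ℝ) T),
        0 < (t : ℝ) → Ψ y t = G t (GraphDom.mk (S.adjointSemigroup.negPow ε hε y) h))
    -- `B* e^{A* ·} A*^ε`, defined on `D(A*^{1+ε})`, extends to `L(Y, L^q(0,T;U))`
    (q : ℝ≥0∞) [Fact (1 ≤ q)] (hq1 : 1 < q) (hq2 : q < 2)
    (hBq : ∃ Ψ : Y →L[ℂ] Lp U q (volume.restrict (Ioo 0 T)),
      ∀ (x : GraphDom (S.adjointSemigroup.fracPow ε hε)) (h : x.app ∈ S.adjGen.domain),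
        Ψ x.val =ᵐ[volume.restrict (Ioo 0 T)]
          fun t => controlAdjoint B (S.adjDom t.toNNReal (GraphDom.mk x.app h))) :
    -- `L¹(U) → L^r([D(A*^ε)]')`
    (∀ r : ℝ, 1 ≤ r → r < 1 / γ →
      MapsLpLp (E := AntiDual (S.adjointSemigroup.fracPow ε hε)) SameFunctional
        (inputToState S B) 1 (ENNReal.ofReal r)) ∧
    -- `L^p(U) → L^r(Y)`, subcritical `p`
    (∀ p r : ℝ, 1 < p → p < 1 / (1 - γ) → p ≤ r → r ≤ p / (1 - (1 - γ) * p) →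
      MapsLpLp (E := Y) IsElem (inputToState S B) (ENNReal.ofReal p) (ENNReal.ofReal r)) ∧
    -- `L^p(U) → L^r(Y)`, critical `p`
    (∀ r : ℝ, 1 / (1 - γ) ≤ r →
      MapsLpLp (E := Y) IsElem (inputToState S B) (ENNReal.ofReal (1 / (1 - γ)))
        (ENNReal.ofReal r)) ∧
    -- `L^p(U) → L^r(Y) ∩ C_b(Y)`, supercritical `p`
    (∀ p r : ℝ≥0∞, ENNReal.ofReal (1 / (1 - γ)) < p → p ≤ r →
      MapsLpLp (E := Y) IsElem (inputToState S B) p r ∧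
      MapsLpCb (E := Y) IsElem (inputToState S B) p) ∧
    -- `L^r(U) → C_b(D(A^ε))`, `r ≥ q'`
    (∀ r : ℝ≥0∞, ENNReal.conjExponent q ≤ r →
      MapsLpCb (E := GraphDom (S.fracPow ε hε)) (fun φ y => IsElem φ y.val)
        (inputToState S B) r) := by

  have hF' : ∀ t : ℝ, 0 < t → ‖F t‖ ≤ N * t ^ (-γ) := fun t ht => (hF t ht).trans <|
    mul_le_of_le_one_right (mul_nonneg hN.le (Real.rpow_nonneg ht.le _))
      (Real.exp_le_one_iff.2 (by nlinarith))
  have hγ' : 0 < 1 - γ := by linarith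
  have hcrit : 1 < 1 / (1 - γ) := (one_lt_div hγ').2 (by linarith)
  have key {p r : ℝ} (hp : 1 < p) (hpr : p ≤ r) (h : 1 / p - 1 / r ≤ 1 - γ) :=
    S.mapsLpLp_isElem B hG hFG hF' hγ0.le hγ1 hN.le hT₁ hp hpr h
  -- From the critical exponent on, 1/p ≤ 1-γ already, so every finite r ≥ p is admissible.
  have hsuper {p : ℝ} (hp : 1 / (1 - γ) ≤ p) {r : ℝ} (hpr : p ≤ r) : 1 / p - 1 / r ≤ 1 - γ := by
    have h1 : 1 / p ≤ 1 - γ := (one_div_le (by linarith) hγ').2 hp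
    have h2 : 0 ≤ 1 / r := one_div_nonneg.2 (by linarith)
    linarith
  refine ⟨fun r hr hrγ => ?_, fun p r hp hpγ hpr hr => key hp hpr ?_,
    fun r hr => key hcrit hr (hsuper le_rfl hr), fun p r hp hpr => ?_, fun r hr => ?_⟩
  · refine S.mapsLpLp_sameFunctional B hγ0.le hN.le hT hε hFG hF' hGε hr ?_
    rwa [mul_comm, ← lt_div_iff₀ hγ0]
  · have hp0 : 0 < p := by linarith
    have hr0 : 0 < r := by linarith
    have h1 : 0 < 1 - (1 - γ) * p := by
      rw [lt_div_iff₀ hγ'] at hpγ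
      linarith
    rw [le_div_iff₀ h1] at hr
    rw [div_sub_div _ _ hp0.ne' hr0.ne', div_le_iff₀ (mul_pos hp0 hr0)]
    linarith
  -- A finite supercritical p₀ below p supplies a conjugate exponent s > 1 even when p is infinite.
  · obtain ⟨p₀, hp₀, hp₀p⟩ := ENNReal.lt_iff_exists_nnreal_btwn.1 hp
    have hCb : MapsLpCb IsElem (inputToState S B) p := by
      refine S.mapsLpCb_isElem B hG hFG hF' hγ0.le hγ1 hN.le hT₁ (p₀ := p₀) ?_ ?_
      · rw [← ENNReal.ofReal_coe_nnreal] at hp₀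
        exact (ENNReal.ofReal_lt_ofReal_iff_of_nonneg (by positivity)).1 hp₀
      · rw [ENNReal.ofReal_coe_nnreal]
        exact hp₀p.le
    refine ⟨?_, hCb⟩
    by_cases hr : r = ∞
    · rw [hr]
      exact hCb.mapsLpLp_top
    · have hpt : p ≠ ∞ := ne_top_of_le_ne_top hr hpr
      rw [← ENNReal.ofReal_toReal hpt] at hp
      have hp' : 1 / (1 - γ) < p.toReal :=
        (ENNReal.ofReal_lt_ofReal_iff_of_nonneg (by positivity)).1 hp
      have hpr' : p.toReal ≤ r.toReal := ENNReal.toReal_mono hr hpr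
      rw [← ENNReal.ofReal_toReal hpt, ← ENNReal.ofReal_toReal hr]
      exact key (hcrit.trans hp') hpr' (hsuper hp'.le hpr')
  · exact S.mapsLpCb_fracPow B hT hε hq1 (hq2.trans ENNReal.ofNat_lt_top).ne hBq hr
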